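/- **Setting.** Structures have finitely many unary predicates $0,\dots,k^{\mathsf u}-1$ and binary relation symbols $0,\dots,k-1$ ($k\ge 1$), with an involution $\mathrm{Flip}$ of $k$ fixing $0$: each vertex $a$ has exactly one unary predicate $U(a)$, each ordered pair of distinct vertices has exactly one binary symbol $R(a,b)$, and $R(b,a)=\mathrm{Flip}(R(a,b))$. The symbol $0$ means "no relation"; a structure is irreducible if $R(a,b)\neq 0$ for all $a\ne b$. Let $\mathcal F$ be a finite set of finite irreducible structures with at least two vertices each, pairwise non-embeddable, and let $\mathcal K=\mathrm{Forb}(\mathcal F)$ be the class of finite structures into which no member of $\mathcal F$ embeds. Assume every unary predicate $i$ is non-degenerate: some two-vertex structure in $\mathcal K$ with a non-zero relation has a vertex with predicate $i$. An enumerated structure is one whose underlying set is a cardinal $N\le\omega$. Let $\mathbf K$ be a Fraïssé limit of $\mathcal K$ with underlying set $\omega$ that is *left dense*: for each $m$ and each structure $\mathbf M\in\mathcal K$ on $\{0,\dots,m\}$ agreeing with $\mathbf K$ on $\{0,\dots,m-1\}$, there is an increasing embedding $f:\mathbf M\to\mathbf K$ which is the identity below $m$ and has $R(f(m),r)=0$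 for $m\le r<f(m)$. Subsets of $\omega$ are identified with induced substructures of $\mathbf K$. **Tree.** $T=k^{\mathsf u}\times k^{<\omega}$; for $t=(t^{\mathsf u},t^{\mathsf b})\in T$, $\ell(t)$ is the length of $t^{\mathsf b}$, $t(m)=t^{\mathsf b}(m)$, $t|_m$ is the restriction to length $m$, $s\sqsubseteq t$ means initial segment, $s\perp t$ incomparable, $s\wedge t$ is the longest common initial segment (for $s^{\mathsf u}=t^{\mathsf u}$). Level subsets of $T$ are ordered lexicographically. Put $c(n)=(U(n),(R(n,m))_{m<n})$, $\mathrm{CT}=\{t:\exists a,\ t\sqsubseteq c(a)\}$, $\emptyset_i=(i,\emptyset)$. $\mathrm{Start}(t)$ is the least $m$ with $t(m)\ne0$, if it exists; $\mathrm{Start}(a)=\mathrm{Start}(c(a))$. **Ages.** A $d$-labelled structure has labels $V(b)<d$ in place of unary predicates. A gluing $\gamma=(\rho,\eta,\mathbf I)$ of sort $\rho:d\to k^{\mathsf u}$ consists of $\eta:d\times n\to k$ and a structure $\mathbf I\in\mathcal K$ on $n$. For $d$-labelled $\mathbf B$, $\mathbf B[\gamma]$ is the structure on $\mathbf I\sqcup\mathbf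 B$ extending $\mathbf I$ and the binary part of $\mathbf B$ with $U(b)=\rho(V(b))$ and $R(b,x)=\eta(V(b),x)$. Let $\mathcal K(\gamma)$ be the class of finite $\mathbf B$ with $\mathbf B[\gamma]\in\mathcal K$. For a set $S=\{s_0<\dots<s_{d-1}\}$ of nodes of length $m$ let $\mathcal K(S)=\mathcal K(\gamma)$ where $\rho(i)=s_i^{\mathsf u}$ (the sort $S^{\mathsf u}$), $\eta(i,x)=s_i(x)$, $\mathbf I=\mathbf K\restriction m$; $\mathcal K(s)=\mathcal K(\{s\})$. Classes of structures with different numbers of labels are regarded as different. $P(\rho)$ is the set of all $\mathcal K(S)$ with $S\subseteq\mathrm{CT}\cap T(m)$ for some $m$ and $S^{\mathsf u}=\rho$, ordered by inclusion. $P_i=P(\rho)$ for $\rho$ the sort of rank $1$ with value $i$, and $P_i^{\min}$ is its least element. For $e:d_0\to d$, $\mathcal A^e$ is the class of $d_0$-labelled structures that lie in $\mathcal A$ after relabelling along $e$. $(\mathcal A,\mathcal B)\in\mathrm{Con}(\rho)$ if $\mathcal B\subsetneq\mathcal A$ are in $P(\rho)$ with nothing of $P(\rho)$ strictly between; it is essential,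 $(\mathcal A,\mathcal B)\in\mathrm{ECon}(\rho)$, if moreover $\mathcal A^e=\mathcal B^e$ for every increasing $e:d_0\to d$ with $d_0<d$. $\mathrm{Spec}(\mathcal A)$ is the set of gluings $(\rho,\eta,\mathbf I)$ with $\mathbf I\in\mathcal K$ embeddable in a member of $\mathcal F$ and $\mathcal A\subseteq\mathcal K(\rho,\eta,\mathbf I)$. Let $\gamma\langle i,q,j\rangle$ be the gluing of rank $1$, sort $i$, with $\mathbf I$ a single vertex of unary predicate $j$ and attachment value $q$. We call $(q,j)$ a free relation for $i$ if $q\neq0$ and $\mathcal K(\gamma\langle i,q,j\rangle)=\mathcal K(\emptyset_i)$. Write $i\in\mathsf{Free}$ if $i$ has a free relation. A path in $P_i$ is a chain in $P_i$; for $a\in\mathbf K$ with $U(a)=i$, $\mathrm{Path}(a)=\{\mathcal K(c(a)|_m):m\le a\}$, regarded as a path in $P_i$; paths of vertices with different unary predicates count as different. Fix once and for all arbitrary choices: for every essential change $(\mathcal A,\mathcal B)$, an element $\mathrm{Cause}(\mathcal A,\mathcal B)$ of $\mathrm{Spec}(\mathcal B)\setminus\mathrm{Spec}(\mathcal A)$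 with $|\mathbf I|$ minimum; for every $i\in\mathsf{Free}$, a free relation $\mathsf{Free}(i)=(q,j)$, with $\mathsf{Free}(i)^{\mathsf b}=q$ and $\mathsf{Free}(i)^{\mathsf u}=j$; and a linear order $\le_{path}$ of the maximal paths of all the $P_i$ in which those of $P_i$ precede those of $P_j$ when $i<j$. For $(\mathcal A,\mathcal B)\in\mathrm{Con}(\rho)$ take the increasing injection $e$ with $(\mathcal A^e,\mathcal B^e)\in\mathrm{ECon}(\rho\circ e)$; $\mathrm{Cause}(\mathcal A,\mathcal B)$ is the gluing of sort $\rho$ obtained from $\mathrm{Cause}(\mathcal A^e,\mathcal B^e)$ by setting $\eta(e(i),x)$ to be its value at $(i,x)$ and $\eta=0$ off the image of $e$. **Closure, interior, envelope.** For $\mathbf A\subseteq\mathbf K$ let $c[\mathbf A]|_m=\{c(a)|_m:a\in\mathbf A,\ a\ge m\}$; $\mathrm{SpNode}(\mathbf A)=\{c(a)\wedge c(b):a,b\in\mathbf A,\ U(a)=U(b),\ c(a)\perp c(b)\}$; $\mathrm{sp}(\mathbf A)=\{\ell(x):x\in\mathrm{SpNode}(\mathbf A)\}$; $\mathrm{AC}(\mathbf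 A)=\{m\notin\mathbf A\cup\mathrm{sp}(\mathbf A):\mathcal K(c[\mathbf A]|_m)\ne\mathcal K(c[\mathbf A]|_{m+1})\}$; $\mathrm{Crit}(\mathbf A)=\mathbf A\cup\mathrm{sp}(\mathbf A)\cup\mathrm{AC}(\mathbf A)$. $\mathbf A$ is closed if $\mathrm{Crit}(\mathbf A)=\mathbf A$; the closure $\overline{\mathbf A}$ is the smallest closed set containing $\mathbf A$; the interior $\mathrm{Int}(\mathbf A)$ is the smallest subset of $\mathbf A$ with the same closure as $\mathbf A$; the envelope $\widetilde{\mathbf A}$ is the enumerated structure on $|\overline{\mathbf A}|$ for which the increasing bijection $\widetilde{\mathbf A}\to\overline{\mathbf A}$ is an embedding. Let $\mathrm{Start}(\mathbf A)$ be the set of all existing $\mathrm{Start}(a)$, $a\in\mathbf A$; $\mathrm{FreeStart}(\mathbf A)$ the set of those with $U(a)\in\mathsf{Free}$; $\mathrm{Crit}^+(\mathbf A)=\mathrm{Crit}(\mathbf A)\cup\mathrm{Start}(\mathbf A)$. **Diagonal substructures.** $\mathbf A\subseteq\mathbf K$ is *diagonal* if the following five conditions hold. (1) *Weakly diagonal*: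 $c[\mathbf A]$ is an antichain; $\mathrm{sp}(\mathbf A)\cap\mathbf A=\emptyset$; for $m\in\mathrm{sp}(\mathbf A)$ there is exactly one $s\in\mathrm{SpNode}(\mathbf A)$ of length $m$, it has exactly two successors in $c[\mathbf A]|_{m+1}$, and $t^\frown0\in c[\mathbf A]|_{m+1}$ for all $t\in c[\mathbf A]|_m$; $\mathrm{Start}(a)$ exists for every $a\in\mathbf A$; and $\mathrm{FreeStart}(\mathbf A)$ is an initial segment of $\mathrm{Crit}^+(\mathbf A)$. (2) *Controlled paths*: $\mathrm{Path}(a)$ is a maximal path for each $a\in\mathbf A$; if $a,b\in\mathbf A$, $U(a)=U(b)\notin\mathsf{Free}$ and $\mathrm{Start}(a)=\mathrm{Start}(b)$, then $\mathrm{Path}(a)=\mathrm{Path}(b)$; if $a,b\in\mathbf A$ and $U(a)=U(b)\in\mathsf{Free}$, then $\mathrm{Start}(a)\le\mathrm{Start}(b)$ iff $\mathrm{Path}(a)\le_{path}\mathrm{Path}(b)$; if $a\in\mathbf A$, $i=U(a)\in\mathsf{Free}$ and $m=\mathrm{Start}(a)$, then $c(m)=(\mathsf{Free}(i)^{\mathsf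 u},0^m)$, $c(a)(m)=\mathsf{Free}(i)^{\mathsf b}$, and $c(b)(m)=0$ for all $b\in\mathbf A$ with $b>m$ and $\mathrm{Path}(b)\ne\mathrm{Path}(a)$; and if $a,b\in\mathbf A$, $U(a)<U(b)$ and $U(a),U(b)\in\mathsf{Free}$, then $\mathrm{Start}(a)<\mathrm{Start}(b)$. (3) *Controlled age changes*: for each $m\in\mathrm{AC}(\mathbf A)$, with $\rho=(c[\mathbf A]|_m)^{\mathsf u}$ and $c[\mathbf A]|_{m+1}=\{t_0<\dots<t_{d-1}\}$: the pair $(\mathcal K(c[\mathbf A]|_m),\mathcal K(c[\mathbf A]|_{m+1}))$ is in $\mathrm{Con}(\rho)$, and if $(\rho,\eta,\mathbf I)$ is its cause, there is an increasing embedding $\phi:\mathbf I\to\mathbf K$ with left-leaning image (if $a\in\phi[\mathbf I]$, $x<a$ and $R(a,x)\ne0$ then $x\in\phi[\mathbf I]$) and $\max\phi[\mathbf I]=m$ such that, with $i=\min\phi[\mathbf I]$, $t_j(\phi(x))=\eta(j,x)$ for all $j,x$, $t_j(y)=0$ for $y\in[i,m]\setminus\phi[\mathbf I]$, and $\mathrm{Crit}^+(\mathbf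 A)\cap[i,m]=\{m\}$. (4) *Controlled coding levels*: for each $m\in\mathbf A$, with $c[\mathbf A]|_m=\{s_0<\dots<s_{d-1}\}$, $\rho$ its sort, $c[\mathbf A]|_{m+1}=\{t_0<\dots<t_{d-2}\}$, $c(m)=s_j$, $\phi(\alpha)=t_\alpha(m)$, $\mathcal A=\mathcal K(c[\mathbf A]|_m)$ and $\epsilon:d-1\to d$ the increasing map omitting $j$: for a class $\mathcal C$ let $\mathcal C'$ be the class of $(d-1)$-labelled $\mathbf B$ such that relabelling $\mathbf B$ along $\epsilon$ and adding a new vertex $x$ with label $j$ and $R(b,x)=\phi(V(b))$ gives a member of $\mathcal C$. Then $\mathcal A^{j}=P^{\min}_{\rho(j)}$ (where $\mathcal A^{j}$ is $\mathcal A^{e}$ for $e:1\to d$ with value $j$), $\mathcal A'=\mathcal A^{\epsilon}$, and every $\mathcal B\in P(\rho)$ with $\mathcal B\subsetneq\mathcal A$ has $\mathcal B^\epsilon\subsetneq\mathcal A^\epsilon$ or $\mathcal B'\subsetneq\mathcal A^\epsilon$. (5) *Controlled splitting levels*: for each $m\in\mathrm{sp}(\mathbf A)$, with splitting node $s$ of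 length $m$, $i=s^{\mathsf u}$, and lexicographically smaller and larger successors $t<t'$ of $s$ in $c[\mathbf A]|_{m+1}$: if $i\in\mathsf{Free}$, then $c(m)=(\mathsf{Free}(i)^{\mathsf u},0^m)$ and $t'=s^\frown\mathsf{Free}(i)^{\mathsf b}$; if $i\notin\mathsf{Free}$ and $s\ne(i,0^m)$, then with $r=\mathrm{Start}(s)$, $c(m)=(U(r),0^m)$ and $t'=s^\frown s(r)$; if $i\notin\mathsf{Free}$ and $s=(i,0^m)$, then $(\mathcal K(c[\mathbf A]|_m),\mathcal K(c[\mathbf A]|_{m+1}\setminus\{t\}))\in\mathrm{Con}((c[\mathbf A]|_m)^{\mathsf u})$ and, for some $q\neq 0$ and $j$, $t'=s^\frown q$, $\mathrm{Cause}(\mathcal K(s),\mathcal K(s^\frown q))=\gamma\langle i,q,j\rangle$ and $c(m)=(j,0^m)$. **Diaries.** The diary $\Delta^{\mathbf A}$ of a diagonal $\mathbf A$ is the function with domain $|\mathrm{Crit}(\mathbf A)|\le\omega$ whose value at $n$, for $m$ the $n$-th element of $\mathrm{Crit}(\mathbf A)$, consists of: the label $\mathrm{Cd}$, $\mathrm{sp}$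 or $\mathrm{AC}$ according to whether $m$ is in $\mathbf A$, $\mathrm{sp}(\mathbf A)$ or $\mathrm{AC}(\mathbf A)$; the sort $(c[\mathbf A]|_m)^{\mathsf u}$ and the class $\mathcal K(c[\mathbf A]|_m)$; the position in $c[\mathbf A]|_m$, in lexicographic order, of $c(m)$ (label $\mathrm{Cd}$) or of the splitting node (label $\mathrm{sp}$), and $0$ for label $\mathrm{AC}$; and the passing numbers $(t_0(m),\dots,t_{d-2}(m))$ where $c[\mathbf A]|_{m+1}=\{t_0<\dots<t_{d-2}\}$ for label $\mathrm{Cd}$, and $0$ for the other labels. **Proposition.** If $\mathbf A,\mathbf B\subseteq\mathbf K$ are diagonal and $\Delta^{\mathbf A}=\Delta^{\mathbf B}$, then $\widetilde{\mathbf A}=\widetilde{\mathbf B}$. Furthermore, every diagonal $\mathbf A\subseteq\mathbf K$ satisfies $\mathbf A=\mathrm{Int}(\overline{\mathbf A})$. -/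

import Mathlib

noncomputable section

open Classical

namespace DiaryEnvelope

/-- A finite binary relational language: `ku` unary symbols, `k` binary symbols, of which the
symbol `0` means "no relation", and the involution `flip` relating `R a b` to `R b a`. -/
structure Lang where
  ku : ℕ
  k : ℕ
  k_ne : NeZero k
  flip : Fin k → Fin k
  flip_flip : ∀ q, flip (flip q) = q
  flip_zero : flip 0 = 0

attribute [instance] Lang.k_ne

variable {L : Lang}

/-! ### Structures -/

/-- An `L`-structure on `V`: each vertex satisfies exactly one unary symbol, each pair of distinct
vertices satisfies exactly one binary symbol. The value of `R` on the diagonal is `0` by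
convention. -/
@[ext]
structure Str (L : Lang) (V : Type) where
  U : V → Fin L.ku
  R : V → V → Fin L.k
  R_self : ∀ a, R a a = 0
  R_flip : ∀ a b, R b a = L.flip (R a b)

/-- The structure on `W` induced along `f : W → V`. -/
def Str.pullback {V W : Type} (M : Str L V) (f : W → V) : Str L W where
  U a := M.U (f a)
  R a b := M.R (f a) (f b)
  R_self a := M.R_self (f a)
  R_flip a b := M.R_flip (f a) (f b)

def IsEmb {V W : Type} (f : V → W) (M : Str L V) (N : Str L W) : Prop :=
  Function.Injective f ∧ (∀ a, N.U (f a) = M.U a) ∧ ∀ a b, N.R (f a) (f b) = M.R a b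

def Embeds {V W : Type} (M : Str L V) (N : Str L W) : Prop := ∃ f : V → W, IsEmb f M N

/-- Finite enumerated structures. Every finite structure is isomorphic to one of these. -/
abbrev FinStr (L : Lang) : Type := Σ n : ℕ, Str L (Fin n)

def Irreducible {V : Type} (M : Str L V) : Prop := ∀ a b, a ≠ b → M.R a b ≠ 0

/-- The standing assumptions on the set of forbidden structures. -/
structure Admissible (F : Set (FinStr L)) : Prop where
  finite : F.Finite
  irreducible : ∀ M ∈ F, Irreducible M.2
  two_le : ∀ M ∈ F, 2 ≤ M.1
  incomparable : ∀ M ∈ F, ∀ N ∈ F, M ≠ N → ¬ Embeds M.2 N.2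

/-- No member of `F` embeds into `M`. For finite `M` this says that `M` is in `Forb(F)`. -/
def Forb (F : Set (FinStr L)) {V : Type} (M : Str L V) : Prop := ∀ N ∈ F, ¬ Embeds N.2 M

/-- `i` is non-degenerate: in some two-element structure in `Forb(F)` with a nonzero relation,
at least one of the vertices has unary predicate `i`. -/
def NonDegenerate (F : Set (FinStr L)) (i : Fin L.ku) : Prop :=
  ∃ M : Str L (Fin 2), Forb F M ∧ (∃ v, M.U v = i) ∧ M.R 0 1 ≠ 0

/-- `K` is an enumerated Fraisse limit of `Forb(F)`: its age is `Forb(F)` and it is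
ultrahomogeneous. -/
structure IsFraisseLimit (F : Set (FinStr L)) (K : Str L ℕ) : Prop where
  age : ∀ M : FinStr L, Forb F M.2 ↔ Embeds M.2 K
  ultrahomogeneous : ∀ (M : FinStr L) (f g : Fin M.1 → ℕ), IsEmb f M.2 K → IsEmb g M.2 K →
    ∃ h : ℕ ≃ ℕ, IsEmb h K K ∧ ∀ a, h (f a) = g a

/-- The induced substructure on the first `m` vertices. -/
def initial (K : Str L ℕ) (m : ℕ) : Str L (Fin m) := K.pullback (fun i : Fin m => (i : ℕ))

def LeftDense (F : Set (FinStr L)) (K : Str L ℕ) : Prop :=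
  ∀ (m : ℕ) (M : Str L (Fin (m + 1))), Forb F M → M.pullback Fin.castSucc = initial K m →
    ∃ f : Fin (m + 1) → ℕ, StrictMono f ∧ IsEmb f M K ∧ (∀ i : Fin m, f i.castSucc = i) ∧
      ∀ r, m ≤ r → r < f (Fin.last m) → K.R (f (Fin.last m)) r = 0

/-! ### The tree of types -/

/-- The tree `T = ku × k^{<ω}`, with the lexicographic order (used on level subsets). -/
abbrev Node (L : Lang) : Type := Fin L.ku ×ₗ List (Fin L.k)

def mkNode (i : Fin L.ku) (b : List (Fin L.k)) : Node L := toLex (i, b)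

namespace Node

def un (t : Node L) : Fin L.ku := (ofLex t).1

def bin (t : Node L) : List (Fin L.k) := (ofLex t).2

def len (t : Node L) : ℕ := t.bin.length

/-- The value `t(m)`, for `m < len t`. -/
def val (t : Node L) (m : ℕ) : Fin L.k := t.bin.getD m 0

/-- The restriction `t|_m`. -/
def restr (t : Node L) (m : ℕ) : Node L := mkNode t.un (t.bin.take m)

/-- The immediate successor of `t` in direction `q`. -/
def succ (t : Node L) (q : Fin L.k) : Node L := mkNode t.un (t.bin ++ [q])

/-- `s` is an initial segment of `t`. -/
def Below (s t : Node L) : Prop := s.un = t.un ∧ s.bin <+: t.bin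

def Perp (s t : Node L) : Prop := ¬ Below s t ∧ ¬ Below t s

/-- `x` is the longest common initial segment of `s` and `t`. -/
def IsMeet (x s t : Node L) : Prop :=
  Below x s ∧ Below x t ∧ ∀ y, Below y s → Below y t → Below y x

/-- The node `(i, 0^m)` on the left branch. -/
def left (i : Fin L.ku) (m : ℕ) : Node L := mkNode i (List.replicate m 0)

/-- `m` is the least integer with `t(m) ≠ 0`. -/
def IsStart (t : Node L) (m : ℕ) : Prop := m < t.len ∧ t.val m ≠ 0 ∧ ∀ r < m, t.val r = 0

end Node

/-- The coding function: `code K n` is the type of the vertex `n` over the first `n` vertices. -/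
def code (K : Str L ℕ) (n : ℕ) : Node L :=
  mkNode (K.U n) (List.ofFn fun m : Fin n => K.R n m)

/-- Level `n` of the coding tree. -/
def CT (K : Str L ℕ) (n : ℕ) : Set (Node L) := {t | t.len = n ∧ ∃ a, t.Below (code K a)}

/-! ### Labelled structures, gluings and ages -/

/-- A structure whose vertices carry one of `d` labels in place of unary predicates. -/
@[ext]
structure LabStr (L : Lang) (d : ℕ) (V : Type) where
  lab : V → Fin d
  R : V → V → Fin L.k
  R_self : ∀ a, R a a = 0
  R_flip : ∀ a b, R b a = L.flip (R a b)

/-- The finite structures with `d` labels, represented on the sets `Fin n`. -/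
abbrev FinLab (L : Lang) (d : ℕ) : Type := Σ n : ℕ, LabStr L d (Fin n)

/-- Classes of finite structures with `d` labels. -/
abbrev AgeClass (L : Lang) (d : ℕ) : Type := Set (FinLab L d)

/-- `e · B`: change labels along `e`. -/
def LabStr.relabel {d d' : ℕ} {V : Type} (e : Fin d → Fin d') (B : LabStr L d V) :
    LabStr L d' V where
  lab b := e (B.lab b)
  R := B.R
  R_self := B.R_self
  R_flip := B.R_flip

/-- The class `A^e` of all `B` with `e · B` in `A`. -/
def AgeClass.pull {d d' : ℕ} (A : AgeClass L d') (e : Fin d → Fin d') : AgeClass L d :=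
  {B | (⟨B.1, B.2.relabel e⟩ : FinLab L d') ∈ A}

/-- A gluing `(ρ, η, I)` of rank `d`. Membership of `I` in `Forb(F)` is imposed where gluings are
quantified over. -/
structure Gluing (L : Lang) (d : ℕ) where
  sort : Fin d → Fin L.ku
  size : ℕ
  att : Fin d → Fin size → Fin L.k
  str : Str L (Fin size)

/-- The structure `B[γ]`. -/
def glue {d : ℕ} {V : Type} (B : LabStr L d V) (γ : Gluing L d) : Str L (Fin γ.size ⊕ V) where
  U
    | .inl x => γ.str.U x
    | .inr b => γ.sort (B.lab b)
  R
    | .inl x, .inl y => γ.str.R x y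
    | .inl x, .inr b => L.flip (γ.att (B.lab b) x)
    | .inr b, .inl x => γ.att (B.lab b) x
    | .inr b, .inr b' => B.R b b'
  R_self
    | .inl x => γ.str.R_self x
    | .inr b => B.R_self b
  R_flip
    | .inl x, .inl y => γ.str.R_flip x y
    | .inl _, .inr _ => (L.flip_flip _).symm
    | .inr _, .inl _ => rfl
    | .inr b, .inr b' => B.R_flip b b'

/-- The age of a gluing. -/
def gluingAge (F : Set (FinStr L)) {d : ℕ} (γ : Gluing L d) : AgeClass L d :=
  {B | Forb F (glue B.2 γ)}

/-- The gluing of a function `σ` into level `m` of `T`. -/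
def treeGluing (K : Str L ℕ) (m : ℕ) {d : ℕ} (σ : Fin d → Node L) : Gluing L d where
  sort i := (σ i).un
  size := m
  att i x := (σ i).val x
  str := initial K m

/-- The age of a function `σ` into level `m` of `T`. -/
def age (F : Set (FinStr L)) (K : Str L ℕ) (m : ℕ) {d : ℕ} (σ : Fin d → Node L) : AgeClass L d :=
  gluingAge F (treeGluing K m σ)

/-- The age of a single node. -/
def nodeAge (F : Set (FinStr L)) (K : Str L ℕ) (t : Node L) : AgeClass L 1 :=
  age F K t.len (fun _ : Fin 1 => t)

/-- The poset `P(ρ)` of ages of sort `ρ`. -/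
def P (F : Set (FinStr L)) (K : Str L ℕ) {d : ℕ} (ρ : Fin d → Fin L.ku) : Set (AgeClass L d) :=
  {A | ∃ (n : ℕ) (σ : Fin d → Node L), StrictMono σ ∧ (∀ i, σ i ∈ CT K n) ∧
    (∀ i, (σ i).un = ρ i) ∧ A = age F K n σ}

/-- The sort of rank one with value `i`. -/
def sort1 (i : Fin L.ku) : Fin 1 → Fin L.ku := fun _ => i

/-- The least element of `P_i`. -/
def Pmin (F : Set (FinStr L)) (K : Str L ℕ) (i : Fin L.ku) : AgeClass L 1 :=
  ⋂₀ P F K (sort1 i)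

/-- Consecutive age changes. -/
def Con (F : Set (FinStr L)) (K : Str L ℕ) {d : ℕ} (ρ : Fin d → Fin L.ku)
    (A B : AgeClass L d) : Prop :=
  A ∈ P F K ρ ∧ B ∈ P F K ρ ∧ B ⊂ A ∧ ¬ ∃ C ∈ P F K ρ, B ⊂ C ∧ C ⊂ A

/-- Essential consecutive age changes. -/
def ECon (F : Set (FinStr L)) (K : Str L ℕ) {d : ℕ} (ρ : Fin d → Fin L.ku)
    (A B : AgeClass L d) : Prop :=
  Con F K ρ A B ∧ ∀ (d₀ : ℕ) (e : Fin d₀ → Fin d), StrictMono e → d₀ < d → A.pull e = B.pull e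

/-- The spectrum of a class `A` of sort `ρ`: gluings of sort `ρ`, whose structure is in `Forb(F)`
and embeds into a member of `F`, and whose age contains `A`. -/
def Spec (F : Set (FinStr L)) {d : ℕ} (ρ : Fin d → Fin L.ku) (A : AgeClass L d) :
    Set (Gluing L d) :=
  {γ | γ.sort = ρ ∧ Forb F γ.str ∧ (∃ M ∈ F, Embeds γ.str M.2) ∧ A ⊆ gluingAge F γ}

/-- The gluing `(ρ, e) · ζ`: extend the attachment map by zero off the image of `e`. -/
def Gluing.extend {d₀ d : ℕ} (ρ : Fin d → Fin L.ku) (e : Fin d₀ → Fin d) (ζ : Gluing L d₀) :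
    Gluing L d where
  sort := ρ
  size := ζ.size
  att i x := Function.extend e (fun i₀ => ζ.att i₀ x) (fun _ => 0) i
  str := ζ.str

/-- The rank one gluing attaching everything by `q` to a single vertex with unary predicate `j`. -/
def pointGluing (i : Fin L.ku) (q : Fin L.k) (j : Fin L.ku) : Gluing L 1 where
  sort := sort1 i
  size := 1
  att _ _ := q
  str :=
    { U := fun _ => j
      R := fun _ _ => 0
      R_self := fun _ => rfl
      R_flip := fun _ _ => L.flip_zero.symm }

/-- `(q, j)` is a free relation for `i`. -/
def IsFreeRel (F : Set (FinStr L)) (K : Str L ℕ) (i : Fin L.ku) (q : Fin L.k) (j : Fin L.ku) :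
    Prop :=
  q ≠ 0 ∧ gluingAge F (pointGluing i q j) = nodeAge F K (Node.left i 0)

/-- `i` has a free relation. -/
def HasFree (F : Set (FinStr L)) (K : Str L ℕ) (i : Fin L.ku) : Prop :=
  ∃ q j, IsFreeRel F K i q j

/-! ### Paths -/

/-- A path in `P_i`: a linearly ordered subset. -/
def IsPath (F : Set (FinStr L)) (K : Str L ℕ) (i : Fin L.ku) (p : Set (AgeClass L 1)) : Prop :=
  p ⊆ P F K (sort1 i) ∧ IsChain (· ⊆ ·) p

/-- `x.2` is a maximal path in `P_i`, where `i = x.1`. -/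
def IsMaxPath (F : Set (FinStr L)) (K : Str L ℕ) (x : Fin L.ku × Set (AgeClass L 1)) : Prop :=
  Maximal (IsPath F K x.1) x.2

/-- The path of the vertex `a`, tagged with its unary predicate. -/
def path (F : Set (FinStr L)) (K : Str L ℕ) (a : ℕ) : Fin L.ku × Set (AgeClass L 1) :=
  (K.U a, {C | ∃ m ≤ a, C = nodeAge F K ((code K a).restr m)})

/-- The three arbitrary choices that are fixed once and for all: a cause of each essential
consecutive age change (of minimum size), a free relation for each `i` that has one, and a linear
order of the maximal paths which respects the unary predicates. -/
structure Choices (F : Set (FinStr L)) (K : Str L ℕ) where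
  cause : ∀ {d : ℕ}, (Fin d → Fin L.ku) → AgeClass L d → AgeClass L d → Gluing L d
  cause_mem : ∀ {d : ℕ} (ρ : Fin d → Fin L.ku) (A B : AgeClass L d), ECon F K ρ A B →
    cause ρ A B ∈ Spec F ρ B \ Spec F ρ A
  cause_min : ∀ {d : ℕ} (ρ : Fin d → Fin L.ku) (A B : AgeClass L d), ECon F K ρ A B →
    ∀ γ ∈ Spec F ρ B \ Spec F ρ A, (cause ρ A B).size ≤ γ.size
  free : Fin L.ku → Fin L.k × Fin L.ku
  free_spec : ∀ i, HasFree F K i → IsFreeRel F K i (free i).1 (free i).2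
  pathLE : Fin L.ku × Set (AgeClass L 1) → Fin L.ku × Set (AgeClass L 1) → Prop
  pathLE_total : ∀ x y, IsMaxPath F K x → IsMaxPath F K y → pathLE x y ∨ pathLE y x
  pathLE_antisymm : ∀ x y, IsMaxPath F K x → IsMaxPath F K y → pathLE x y → pathLE y x → x = y
  pathLE_trans : ∀ x y z, IsMaxPath F K x → IsMaxPath F K y → IsMaxPath F K z →
    pathLE x y → pathLE y z → pathLE x z
  pathLE_of_lt : ∀ x y, IsMaxPath F K x → IsMaxPath F K y → x.1 < y.1 → pathLE x y

/-- `γ` is the cause of the (not necessarily essential) consecutive age change `(A, B)`. -/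
def IsCause {F : Set (FinStr L)} {K : Str L ℕ} (ch : Choices F K) {d : ℕ}
    (ρ : Fin d → Fin L.ku) (A B : AgeClass L d) (γ : Gluing L d) : Prop :=
  ∃ (d₀ : ℕ) (e : Fin d₀ → Fin d), StrictMono e ∧ ECon F K (ρ ∘ e) (A.pull e) (B.pull e) ∧
    γ = Gluing.extend ρ e (ch.cause (ρ ∘ e) (A.pull e) (B.pull e))

/-! ### Critical levels, closures, interiors, envelopes -/

theorem level_finite (K : Str L ℕ) (A : Set ℕ) (m : ℕ) :
    {t : Node L | ∃ a ∈ A, m ≤ a ∧ t = (code K a).restr m}.Finite := by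
  have h1 : {l : List (Fin L.k) | l.length = m}.Finite := List.finite_length_eq _ _
  have h2 : ((Set.univ : Set (Fin L.ku)) ×ˢ {l : List (Fin L.k) | l.length = m}).Finite :=
    Set.finite_univ.prod h1
  refine (h2.image toLex).subset ?_
  rintro t ⟨a, -, hm, rfl⟩
  refine ⟨((code K a).un, (code K a).bin.take m), ⟨Set.mem_univ _, ?_⟩, rfl⟩
  simp [code, mkNode, Node.bin, hm]

/-- The level set `c[A]|_m = {c(a)|_m : a ∈ A, a ≥ m}`. -/
def level (K : Str L ℕ) (A : Set ℕ) (m : ℕ) : Finset (Node L) := (level_finite K A m).toFinset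

/-- The lexicographically increasing enumeration of a level set. -/
def vec (S : Finset (Node L)) : Fin S.card → Node L := S.orderEmbOfFin rfl

/-- `S = {s 0 < s 1 < ... < s (d-1)}`. -/
def Lists {d : ℕ} (s : Fin d → Node L) (S : Finset (Node L)) : Prop :=
  StrictMono s ∧ Set.range s = (S : Set (Node L))

/-- The age of `c[A]|_m`, together with the size of `c[A]|_m`. -/
def levelAge (F : Set (FinStr L)) (K : Str L ℕ) (A : Set ℕ) (m : ℕ) : Σ d : ℕ, AgeClass L d :=
  ⟨(level K A m).card, age F K m (vec (level K A m))⟩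

/-- Splitting nodes. -/
def SpNode (K : Str L ℕ) (A : Set ℕ) : Set (Node L) :=
  {x | ∃ a ∈ A, ∃ b ∈ A, K.U a = K.U b ∧ (code K a).Perp (code K b) ∧
    x.IsMeet (code K a) (code K b)}

/-- Splitting levels. -/
def Sp (K : Str L ℕ) (A : Set ℕ) : Set ℕ := Node.len '' SpNode K A

/-- Age-change levels. -/
def AC (F : Set (FinStr L)) (K : Str L ℕ) (A : Set ℕ) : Set ℕ :=
  {m | m ∉ A ∪ Sp K A ∧ levelAge F K A m ≠ levelAge F K A (m + 1)}

/-- Critical levels. -/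
def Crit (F : Set (FinStr L)) (K : Str L ℕ) (A : Set ℕ) : Set ℕ := A ∪ Sp K A ∪ AC F K A

def Closed (F : Set (FinStr L)) (K : Str L ℕ) (A : Set ℕ) : Prop := Crit F K A = A

/-- The closure: the smallest closed set containing `A`. -/
def cl (F : Set (FinStr L)) (K : Str L ℕ) (A : Set ℕ) : Set ℕ :=
  ⋂₀ {C | A ⊆ C ∧ Closed F K C}

/-- `S` is the interior of `A`: the smallest subset of `A` with the same closure as `A`. -/
def IsInteriorOf (F : Set (FinStr L)) (K : Str L ℕ) (A S : Set ℕ) : Prop :=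
  IsLeast {S' | S' ⊆ A ∧ cl F K S' = cl F K A} S

/-- The set `N = {0, ..., N-1}` for `N ≤ ω`. -/
abbrev Below (N : ℕ∞) : Type := {n : ℕ // (n : ℕ∞) < N}

/-- Countable enumerated structures: structures whose underlying set is a cardinal `N ≤ ω`. -/
abbrev EnumStr (L : Lang) : Type := Σ N : ℕ∞, Str L (Below N)

/-- The increasing enumeration of a set of natural numbers. -/
def enum (A : Set ℕ) (n : Below A.encard) : ℕ := Nat.nth (· ∈ A) n.1

/-- The envelope of `A`: the enumerated structure on `|cl A|` for which the increasing bijection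
onto `cl A` is an embedding. -/
def envelope (F : Set (FinStr L)) (K : Str L ℕ) (A : Set ℕ) : EnumStr L :=
  ⟨(cl F K A).encard, K.pullback (enum (cl F K A))⟩

/-! ### Diagonal substructures -/

/-- `m` is the start level of the vertex `a`. -/
def IsStart (K : Str L ℕ) (a m : ℕ) : Prop := (code K a).IsStart m

def Start (K : Str L ℕ) (A : Set ℕ) : Set ℕ := {m | ∃ a ∈ A, IsStart K a m}

/-- The start levels of vertices whose unary predicate has a free relation. -/
def FreeStart (F : Set (FinStr L)) (K : Str L ℕ) (A : Set ℕ) : Set ℕ :=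
  {m | ∃ a ∈ A, HasFree F K (K.U a) ∧ IsStart K a m}

def CritPlus (F : Set (FinStr L)) (K : Str L ℕ) (A : Set ℕ) : Set ℕ := Crit F K A ∪ Start K A

structure WeaklyDiagonal (F : Set (FinStr L)) (K : Str L ℕ) (A : Set ℕ) : Prop where
  antichain : ∀ a ∈ A, ∀ b ∈ A, a ≠ b → ¬ (code K a).Below (code K b)
  disjoint : Sp K A ∩ A = ∅
  unique_split : ∀ m ∈ Sp K A, ∃! s, s ∈ SpNode K A ∧ s.len = m
  two_succ : ∀ s ∈ SpNode K A, {t | t ∈ level K A (s.len + 1) ∧ s.Below t}.ncard = 2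
  succ_zero : ∀ m ∈ Sp K A, ∀ t ∈ level K A m, t.succ 0 ∈ level K A (m + 1)
  exists_start : ∀ a ∈ A, ∃ m, IsStart K a m
  freeStart_subset : FreeStart F K A ⊆ CritPlus F K A
  freeStart_initial : ∀ x ∈ CritPlus F K A, ∀ y ∈ FreeStart F K A, x < y → x ∈ FreeStart F K A

/-- Controlled paths. In `free_start`, the start vertex of a path `p` in `P_i`, where `i` has a free
relation, is a vertex coded on the left branch, related by the chosen free relation to the vertices
of `A` with path `p` and unrelated to every other vertex of `A` above it. -/
structure ControlledPaths {F : Set (FinStr L)} {K : Str L ℕ} (ch : Choices F K) (A : Set ℕ) :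
    Prop where
  maximal : ∀ a ∈ A, IsMaxPath F K (path F K a)
  nonfree : ∀ a ∈ A, ∀ b ∈ A, K.U a = K.U b → ¬ HasFree F K (K.U a) →
    ∀ m, IsStart K a m → IsStart K b m → path F K a = path F K b
  free_order : ∀ a ∈ A, ∀ b ∈ A, K.U a = K.U b → HasFree F K (K.U a) →
    ∀ m n, IsStart K a m → IsStart K b n → (m ≤ n ↔ ch.pathLE (path F K a) (path F K b))
  free_start : ∀ a ∈ A, HasFree F K (K.U a) → ∀ m, IsStart K a m →
    code K m = Node.left (ch.free (K.U a)).2 m ∧ (code K a).val m = (ch.free (K.U a)).1 ∧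
      ∀ b ∈ A, m < b → path F K b ≠ path F K a → (code K b).val m = 0
  free_sep : ∀ a ∈ A, ∀ b ∈ A, HasFree F K (K.U a) → HasFree F K (K.U b) → K.U a < K.U b →
    ∀ m n, IsStart K a m → IsStart K b n → m < n

/-- Whenever `a ∈ S`, `x < a` and `R(a, x) ≠ 0`, then `x ∈ S`. -/
def LeftLeaning (K : Str L ℕ) (S : Set ℕ) : Prop := ∀ a ∈ S, ∀ x < a, K.R a x ≠ 0 → x ∈ S

/-- `m` is a controlled age-change level of `A`. -/
def ControlledACLevel {F : Set (FinStr L)} {K : Str L ℕ} (ch : Choices F K) (A : Set ℕ) (m : ℕ) :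
    Prop :=
  ∃ (d : ℕ) (s t : Fin d → Node L), Lists s (level K A m) ∧ Lists t (level K A (m + 1)) ∧
    Con F K (fun i => (s i).un) (age F K m s) (age F K (m + 1) t) ∧
    ∃ γ : Gluing L d, IsCause ch (fun i => (s i).un) (age F K m s) (age F K (m + 1) t) γ ∧
    ∃ φ : Fin γ.size → ℕ, StrictMono φ ∧ IsEmb φ γ.str K ∧ LeftLeaning K (Set.range φ) ∧
      IsGreatest (Set.range φ) m ∧
      ∃ i, IsLeast (Set.range φ) i ∧
        (∀ j x, (t j).val (φ x) = γ.att j x) ∧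
        (∀ j, ∀ y ∈ Set.Icc i m, y ∉ Set.range φ → (t j).val y = 0) ∧
        CritPlus F K A ∩ Set.Icc i m = {m}

/-- The structure `B⟨j, π, φ⟩`: add a new (last) vertex `x` labelled `j`, with `R(b, x)` given by
`φ`, and change the labels of the old vertices along `π`. -/
def LabStr.addPoint {l d n : ℕ} (B : LabStr L l (Fin n)) (j : Fin d) (π : Fin l → Fin d)
    (φ : Fin l → Fin L.k) : LabStr L d (Fin (n + 1)) where
  lab := Fin.lastCases j fun b => π (B.lab b)
  R := Fin.lastCases (Fin.lastCases 0 fun b => L.flip (φ (B.lab b)))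
    fun b => Fin.lastCases (φ (B.lab b)) fun b' => B.R b b'
  R_self a := by
    induction a using Fin.lastCases with
    | last => simp
    | cast b => simp [B.R_self]
  R_flip a c := by
    induction a using Fin.lastCases with
    | last =>
      induction c using Fin.lastCases with
      | last => simp [L.flip_zero]
      | cast b => simp [L.flip_flip]
    | cast a =>
      induction c using Fin.lastCases with
      | last => simp
      | cast b => simpa using B.R_flip a b

/-- The class of all `B` with `B⟨j, π, φ⟩` in `A`. -/
def AgeClass.next {l d : ℕ} (A : AgeClass L d) (j : Fin d) (π : Fin l → Fin d)
    (φ : Fin l → Fin L.k) : AgeClass L l :=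
  {B | (⟨B.1 + 1, B.2.addPoint j π φ⟩ : FinLab L d) ∈ A}

/-- Controlled coding triples `(A, j, φ)`; `j.succAbove` is the increasing map skipping `j`. -/
structure ControlledCodingTriple (F : Set (FinStr L)) (K : Str L ℕ) {e : ℕ}
    (ρ : Fin (e + 1) → Fin L.ku) (A : AgeClass L (e + 1)) (j : Fin (e + 1))
    (φ : Fin e → Fin L.k) : Prop where
  mem : A ∈ P F K ρ
  min : A.pull (fun _ : Fin 1 => j) = Pmin F K (ρ j)
  next_eq : A.next j j.succAbove φ = A.pull j.succAbove
  minimal : ∀ B ∈ P F K ρ, B ⊂ A →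
    B.pull j.succAbove ⊂ A.pull j.succAbove ∨ B.next j j.succAbove φ ⊂ A.pull j.succAbove

/-- `m` is a controlled coding level of `A`. -/
def ControlledCodingLevel (F : Set (FinStr L)) (K : Str L ℕ) (A : Set ℕ) (m : ℕ) : Prop :=
  ∃ (e : ℕ) (s : Fin (e + 1) → Node L) (t : Fin e → Node L), Lists s (level K A m) ∧
    Lists t (level K A (m + 1)) ∧ ∃ j, s j = code K m ∧
      ControlledCodingTriple F K (fun i => (s i).un) (age F K m s) j (fun α => (t α).val m)

/-- `m` is a controlled splitting level of `A`. Here `s α` is the splitting node, and `t α.castSucc`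
and `t α.succ` are its two successors. -/
def ControlledSpLevel {F : Set (FinStr L)} {K : Str L ℕ} (ch : Choices F K) (A : Set ℕ) (m : ℕ) :
    Prop :=
  ∃ (d : ℕ) (s : Fin d → Node L) (t : Fin (d + 1) → Node L), Lists s (level K A m) ∧
    Lists t (level K A (m + 1)) ∧ ∃ α : Fin d, s α ∈ SpNode K A ∧
      (HasFree F K (s α).un →
        code K m = Node.left (ch.free (s α).un).2 m ∧
          t α.succ = (s α).succ (ch.free (s α).un).1) ∧
      (¬ HasFree F K (s α).un → s α ≠ Node.left (s α).un m →
        ∃ r, (s α).IsStart r ∧ code K m = Node.left (K.U r) m ∧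
          t α.succ = (s α).succ ((s α).val r)) ∧
      (¬ HasFree F K (s α).un → s α = Node.left (s α).un m →
        Con F K (fun i => (s i).un) (age F K m s)
          (age F K (m + 1) (t ∘ α.castSucc.succAbove)) ∧
        ∃ q j, q ≠ 0 ∧ t α.succ = (s α).succ q ∧
          ch.cause (sort1 (s α).un) (nodeAge F K (s α)) (nodeAge F K ((s α).succ q)) =
            pointGluing (s α).un q j ∧
          code K m = Node.left j m)

structure Diagonal {F : Set (FinStr L)} {K : Str L ℕ} (ch : Choices F K) (A : Set ℕ) : Prop where
  weak : WeaklyDiagonal F K A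
  paths : ControlledPaths ch A
  ageChange : ∀ m ∈ AC F K A, ControlledACLevel ch A m
  coding : ∀ m ∈ A, ControlledCodingLevel F K A m
  splitting : ∀ m ∈ Sp K A, ControlledSpLevel ch A m

/-! ### Diaries -/

inductive Label
  | Cd
  | AC
  | sp

/-- The possible entries of a diary: label, class (with its sort), position, passing numbers. -/
structure Entry (L : Lang) where
  label : Label
  size : ℕ
  sort : Fin size → Fin L.ku
  cls : AgeClass L size
  pos : ℕ
  pass : Fin (size - 1) → Fin L.k

/-- The diary entry of `A` at the critical level `m`. The position of a node is the number of nodes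
of the level set that precede it lexicographically; at a splitting level it is that of the (unique)
splitting node of length `m`. -/
def entry (F : Set (FinStr L)) (K : Str L ℕ) (A : Set ℕ) (m : ℕ) : Entry L where
  label := if m ∈ A then .Cd else if m ∈ Sp K A then .sp else .AC
  size := (level K A m).card
  sort i := (vec (level K A m) i).un
  cls := age F K m (vec (level K A m))
  pos :=
    if m ∈ A then ((level K A m).filter (· < code K m)).card
    else if m ∈ Sp K A then
      ((level K A m).filter fun s => ∀ x ∈ SpNode K A, x.len = m → s < x).card
    else 0
  pass j :=
    if m ∈ A then
      if h : (j : ℕ) < (level K A (m + 1)).card then (vec (level K A (m + 1)) ⟨j, h⟩).val m else 0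
    else 0

/-- The diary of `A`: a function from `|Crit A|` to entries. -/
def diary (F : Set (FinStr L)) (K : Str L ℕ) (A : Set ℕ) : Σ N : ℕ∞, (Below N → Entry L) :=
  ⟨(Crit F K A).encard, fun n => entry F K A (enum (Crit F K A) n)⟩

end DiaryEnvelope

end

/-!
Members of `F` are irreducible, so membership in `Forb F` is decided by cliques, and a level can
affect the age of a set only through the vertices related to it.

The closure of a diagonal set `A` is contained in its hull: the critical levels, the levels at which
vertices with a free relation start, and, for every age-change level, the vertices of `K` realising
the cause of the change. A vertex of the hull outside `A` is related only to those smaller vertices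
which realise the same cause, so the hull creates no new critical levels and is closed. For a
vertex `a` of `A`, no nodes split at the level `a`, and by the condition on coding levels it changes
no ages, even of the closure. Hence the closure of `A` without `a` is still closed, and no vertex of
`A` can be omitted from a set with the same closure.

The diary of `A` determines the relations between the vertices of the hull. Passing numbers are read
off at coding levels; at an age-change level the two consecutive diary classes determine the cause;
at a splitting level the splitting node is determined by its position, and its larger successor is
prescribed by the choices or by where the node starts; free start levels are determined by the order
of the maximal paths. So if `A` and `B` have the same diary, the bijection between their critical
levels extends to an increasing partial isomorphism between their hulls. By minimality of causes,
the vertices realising them belong to the closure, so that the only vertices of the hull which may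
lie outside the closure are free start levels. It follows that the vertices of the hull of `A`
corresponding to vertices of the closure of `B` form a closed set containing `A`, so the partial
isomorphism matches the closures, and the envelopes coincide.
-/

noncomputable section

namespace DiaryEnvelope

variable {L : Lang}

/-! ### Embeddings, cliques and joins -/

section Embeddings

variable {F : Set (FinStr L)} {V W X : Type} {M : Str L V} {N : Str L W} {O : Str L X}

theorem IsEmb.comp {f : V → W} {g : W → X} (hg : IsEmb g N O) (hf : IsEmb f M N) :
    IsEmb (g ∘ f) M O :=
  ⟨hg.1.comp hf.1, fun a => (hg.2.1 _).trans (hf.2.1 a),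
    fun a b => (hg.2.2 _ _).trans (hf.2.2 a b)⟩

theorem IsEmb.of_comp {f : V → W} {g : W → X} (hg : IsEmb g N O) (hgf : IsEmb (g ∘ f) M O) :
    IsEmb f M N :=
  ⟨hgf.1.of_comp, fun a => (hg.2.1 _).symm.trans (hgf.2.1 a),
    fun a b => (hg.2.2 _ _).symm.trans (hgf.2.2 a b)⟩

theorem isEmb_pullback (M : Str L W) {f : V → W} (hf : Function.Injective f) :
    IsEmb f (M.pullback f) M :=
  ⟨hf, fun _ => rfl, fun _ _ => rfl⟩

theorem Irreducible.of_isEmb (hN : Irreducible N) {f : V → W} (hf : IsEmb f M N) :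
    Irreducible M := fun a b hab => by
  rw [← hf.2.2]
  exact hN _ _ (hf.1.ne hab)

theorem Forb.of_isEmb (hN : Forb F N) {f : V → W} (hf : IsEmb f M N) : Forb F M :=
  fun O hO ⟨_, hg⟩ => hN O hO ⟨_, hf.comp hg⟩

/-- Any two distinct vertices of `S` are related in `M`. Since forbidden structures are irreducible,
whether `M` belongs to `Forb F` is decided by its cliques. -/
def Clique (M : Str L V) (S : Set V) : Prop := ∀ u ∈ S, ∀ v ∈ S, u ≠ v → M.R u v ≠ 0

theorem IsEmb.clique_range {g : W → V} (hg : IsEmb g N M) (hN : Irreducible N) :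
    Clique M (Set.range g) := by
  rintro _ ⟨a, rfl⟩ _ ⟨b, rfl⟩ hab
  rw [hg.2.2]
  exact hN a b (ne_of_apply_ne g hab)

theorem IsEmb.forb_of_forall_clique (hF : ∀ M ∈ F, Irreducible M.2) {π : V → X} (hπ : IsEmb π M O)
    (h : ∀ S ⊆ Set.range π, Clique O S →
      ∃ (W : Type) (N : Str L W) (e : W → X), Forb F N ∧ IsEmb e N O ∧ S ⊆ Set.range e) :
    Forb F M := by
  rintro Q hQ ⟨g, hg⟩
  have hπg := hπ.comp hg
  obtain ⟨W, N, e, hN, he, hS⟩ :=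
    h _ (Set.range_comp_subset_range g π) (hπg.clique_range (hF Q hQ))
  choose l hl using fun a => hS (Set.mem_range_self a)
  have hel : e ∘ l = π ∘ g := funext hl
  exact hN Q hQ ⟨l, he.of_comp (hel ▸ hπg)⟩

theorem forb_of_forall_clique (hF : ∀ M ∈ F, Irreducible M.2)
    (h : ∀ S : Set V, Clique M S →
      ∃ (W : Type) (N : Str L W) (e : W → V), Forb F N ∧ IsEmb e N M ∧ S ⊆ Set.range e) :
    Forb F M :=
  IsEmb.forb_of_forall_clique hF ⟨Function.injective_id, fun _ => rfl, fun _ _ => rfl⟩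
    fun S _ => h S

theorem Forb.of_range_subset {f : V → X} {g : W → X} (hN : Forb F N) (hg : IsEmb g N O)
    (hf : IsEmb f M O) (h : Set.range f ⊆ Set.range g) : Forb F M := by
  choose l hl using fun a => h (Set.mem_range_self a)
  obtain rfl : g ∘ l = f := funext hl
  exact hN.of_isEmb (hg.of_comp hf)

end Embeddings

/-- The structure on `W ⊕ V` extending `I` and `M` in which `R (b, x) = η b x`. A structure `B[γ]`
is of this form (`glue_eq_join`). -/
def join {V W : Type} (I : Str L W) (M : Str L V) (η : V → W → Fin L.k) : Str L (W ⊕ V) where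
  U := Sum.elim I.U M.U
  R
    | .inl x, .inl y => I.R x y
    | .inl x, .inr b => L.flip (η b x)
    | .inr b, .inl x => η b x
    | .inr b, .inr b' => M.R b b'
  R_self
    | .inl x => I.R_self x
    | .inr b => M.R_self b
  R_flip
    | .inl x, .inl y => I.R_flip x y
    | .inl _, .inr _ => (L.flip_flip _).symm
    | .inr _, .inl _ => rfl
    | .inr b, .inr b' => M.R_flip b b'

section Join

variable {F : Set (FinStr L)} {V W : Type} {I : Str L W} {M : Str L V} {η : V → W → Fin L.k}

variable (I M η) in
theorem isEmb_inl : IsEmb Sum.inl I (join I M η) :=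
  ⟨Sum.inl_injective, fun _ => rfl, fun _ _ => rfl⟩

variable (I M η) in
theorem isEmb_inr : IsEmb Sum.inr M (join I M η) :=
  ⟨Sum.inr_injective, fun _ => rfl, fun _ _ => rfl⟩

theorem IsEmb.join {V' W' : Type} {I' : Str L W'} {M' : Str L V'} {η' : V' → W' → Fin L.k}
    {f : W → W'} {g : V → V'} (hf : IsEmb f I I') (hg : IsEmb g M M')
    (h : ∀ b x, η' (g b) (f x) = η b x) : IsEmb (Sum.map f g) (join I M η) (join I' M' η') := by
  refine ⟨hf.1.sumMap hg.1, ?_, ?_⟩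
  · rintro (x | b)
    exacts [hf.2.1 x, hg.2.1 b]
  · rintro (x | b) (y | c)
    exacts [hf.2.2 x y, congrArg L.flip (h c x), h b y, hg.2.2 b c]

theorem Clique.ne_zero_of_join {S : Set (W ⊕ V)} (hS : Clique (join I M η) S) {x : W} {b : V}
    (hx : .inl x ∈ S) (hb : .inr b ∈ S) : η b x ≠ 0 :=
  hS _ hb _ hx Sum.inr_ne_inl

theorem forb_join_of_forall_eq_zero (hF : ∀ M ∈ F, Irreducible M.2) (hI : Forb F I)
    (hM : Forb F M) (hη : ∀ b x, η b x = 0) : Forb F (join I M η) := by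
  refine forb_of_forall_clique hF fun S hS => ?_
  by_cases hx : ∃ x, .inl x ∈ S
  · obtain ⟨x, hx⟩ := hx
    refine ⟨_, I, _, hI, isEmb_inl I M η, ?_⟩
    rintro (y | b) hb
    · exact ⟨y, rfl⟩
    · exact absurd (hη b x) (hS.ne_zero_of_join hx hb)
  · refine ⟨_, M, _, hM, isEmb_inr I M η, ?_⟩
    rintro (y | b) hb
    · exact absurd ⟨y, hb⟩ hx
    · exact ⟨b, rfl⟩

end Join

/-- The structure obtained from a labelled structure by replacing the label `i` with the unary
predicate `ρ i`. -/
def LabStr.toStr {d : ℕ} {V : Type} (B : LabStr L d V) (ρ : Fin d → Fin L.ku) : Str L V where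
  U b := ρ (B.lab b)
  R := B.R
  R_self := B.R_self
  R_flip := B.R_flip

/-- The structure obtained from `M` by replacing the unary predicates with labels. -/
def Str.toLab {d : ℕ} {V : Type} (M : Str L V) (lab : V → Fin d) : LabStr L d V where
  lab := lab
  R := M.R
  R_self := M.R_self
  R_flip := M.R_flip

theorem glue_eq_join {d : ℕ} {V : Type} (B : LabStr L d V) (γ : Gluing L d) :
    glue B γ = join γ.str (B.toStr γ.sort) (fun b x => γ.att (B.lab b) x) := by
  ext u v
  · rcases u with u | u <;> rfl
  · rcases u with u | u <;> rcases v with v | v <;> rfl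

theorem mem_gluingAge {F : Set (FinStr L)} {d n : ℕ} {γ : Gluing L d} {B : LabStr L d (Fin n)} :
    (⟨n, B⟩ : FinLab L d) ∈ gluingAge F γ ↔
      Forb F (join γ.str (B.toStr γ.sort) (fun b x => γ.att (B.lab b) x)) := by
  rw [← glue_eq_join]
  rfl

theorem mem_age {F : Set (FinStr L)} {K : Str L ℕ} {m d n : ℕ} {s : Fin d → Node L}
    {B : LabStr L d (Fin n)} : (⟨n, B⟩ : FinLab L d) ∈ age F K m s ↔
      Forb F (join (initial K m) (B.toStr fun i => (s i).un)
        (fun b x => (s (B.lab b)).val x)) :=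
  mem_gluingAge

theorem IsFraisseLimit.forb {F : Set (FinStr L)} {K : Str L ℕ} (hK : IsFraisseLimit F K) :
    Forb F K := fun N hN hNK =>
  (hK.age N).2 hNK N hN ⟨id, Function.injective_id, fun _ => rfl, fun _ _ => rfl⟩

theorem Forb.initial {F : Set (FinStr L)} {K : Str L ℕ} (hK : Forb F K) (m : ℕ) :
    Forb F (initial K m) :=
  hK.of_isEmb (isEmb_pullback K Fin.val_injective)

/-- The structure `M` glued to the vertices `φ x` of `K`, where `b` is attached as the vertex `f b`
of `K` is. -/
def attachAlong (K : Str L ℕ) {V W : Type} (φ : W → ℕ) (M : Str L V) (f : V → ℕ) :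
    Str L (W ⊕ V) :=
  join (K.pullback φ) M fun b x => K.R (f b) (φ x)

/-- The structure `M` glued to the first `m` vertices of `K`, where `b` is attached as the vertex
`f b` of `K` is. -/
def attach (K : Str L ℕ) (m : ℕ) {V : Type} (M : Str L V) (f : V → ℕ) : Str L (Fin m ⊕ V) :=
  attachAlong K (fun x : Fin m => (x : ℕ)) M f

/-- The vertex `m` together with the smaller vertices related to it. -/
def nbhd (K : Str L ℕ) (m : ℕ) : Set ℕ := {x | x = m ∨ x < m ∧ K.R m x ≠ 0}

section Attach

variable {F : Set (FinStr L)} {K : Str L ℕ} {m x : ℕ} {V W : Type} (M : Str L V) (f : V → ℕ)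

theorem le_of_mem_nbhd (h : x ∈ nbhd K m) : x ≤ m := by
  rcases h with h | h
  exacts [h.le, h.1.le]

theorem isEmb_attachAlong {φ : W → ℕ} (hφ : Function.Injective φ) :
    IsEmb (Sum.map φ id) (attachAlong K φ M f) (attachAlong K id M f) :=
  IsEmb.join ⟨hφ, fun _ => rfl, fun _ _ => rfl⟩
    ⟨Function.injective_id, fun _ => rfl, fun _ _ => rfl⟩ fun _ _ => rfl

variable (K m) in
theorem isEmb_attach :
    IsEmb (Sum.map Fin.val id) (attach K m M f) (attachAlong K id M f) :=
  isEmb_attachAlong M f Fin.val_injective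

theorem isEmb_attach_pullback {g : W → V} (hg : Function.Injective g) :
    IsEmb (Sum.map id g) (attach K m (M.pullback g) (f ∘ g)) (attach K m M f) :=
  IsEmb.join ⟨Function.injective_id, fun _ => rfl, fun _ _ => rfl⟩ (isEmb_pullback M hg)
    fun _ _ => rfl

theorem isEmb_attach_castLE {n : ℕ} (h : m ≤ n) :
    IsEmb (Sum.map (Fin.castLE h) id) (attach K m M f) (attach K n M f) :=
  IsEmb.join ⟨Fin.castLE_injective h, fun _ => rfl, fun _ _ => rfl⟩
    ⟨Function.injective_id, fun _ => rfl, fun _ _ => rfl⟩ fun _ _ => rfl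

variable {M f}

theorem subset_range_attach_castLE {S : Set (Fin (m + 1) ⊕ V)}
    (hS : .inl (Fin.last m) ∉ S) :
    S ⊆ Set.range (Sum.map (Fin.castLE m.le_succ) id : Fin m ⊕ V → Fin (m + 1) ⊕ V) := by
  rintro (x | b) hx
  · induction x using Fin.lastCases with
    | last => exact absurd hx hS
    | cast x => exact ⟨.inl x, rfl⟩
  · exact ⟨.inr b, rfl⟩

theorem forb_attach_succ_iff (hF : ∀ M ∈ F, Irreducible M.2) {φ : W → ℕ}
    (hφ : Function.Injective φ) (hr : Set.range φ = nbhd K m) :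
    Forb F (attach K (m + 1) M f) ↔ Forb F (attach K m M f) ∧ Forb F (attachAlong K φ M f) := by
  constructor
  · refine fun h => ⟨h.of_isEmb (isEmb_attach_castLE M f m.le_succ),
      h.of_range_subset (isEmb_attach K (m + 1) M f) (isEmb_attachAlong M f hφ) ?_⟩
    rintro _ ⟨x | b, rfl⟩
    · have hx : φ x ∈ nbhd K m := hr ▸ ⟨x, rfl⟩
      exact ⟨.inl ⟨φ x, Nat.lt_succ_of_le (le_of_mem_nbhd hx)⟩, rfl⟩
    · exact ⟨.inr b, rfl⟩
  · rintro ⟨hm, hφM⟩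
    refine (isEmb_attach K (m + 1) M f).forb_of_forall_clique hF fun S hSr hS => ?_
    have hlt {x : ℕ} (hx : .inl x ∈ S) : x < m + 1 := by
      obtain ⟨y | y, hy⟩ := hSr hx
      · exact Sum.inl_injective hy ▸ y.2
      · exact absurd hy Sum.inr_ne_inl
    by_cases hlast : .inl m ∈ S
    · refine ⟨_, _, _, hφM, isEmb_attachAlong M f hφ, ?_⟩
      rintro (x | b) hx
      · have hxr : x ∈ nbhd K m := (Nat.lt_succ_iff_lt_or_eq.1 (hlt hx)).symm.imp_right
          fun hxm => ⟨hxm, hS _ hlast _ hx (Sum.inl_injective.ne hxm.ne')⟩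
        obtain ⟨w, rfl⟩ := hr.symm.subset hxr
        exact ⟨.inl w, rfl⟩
      · exact ⟨.inr b, rfl⟩
    · refine ⟨_, _, _, hm, isEmb_attach K m M f, ?_⟩
      rintro (x | b) hx
      · have hxm : x ≠ m := fun h => hlast (h ▸ hx)
        exact ⟨.inl ⟨x, by have := hlt hx; omega⟩, rfl⟩
      · exact ⟨.inr b, rfl⟩

end Attach

/-! ### Nodes -/

namespace Node

theorem eq_iff {s t : Node L} : s = t ↔ s.un = t.un ∧ s.bin = t.bin :=
  ofLex.injective.eq_iff.symm.trans Prod.ext_iff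

@[simp] theorem un_mkNode (i : Fin L.ku) (b : List (Fin L.k)) : (mkNode i b).un = i := rfl
@[simp] theorem bin_mkNode (i : Fin L.ku) (b : List (Fin L.k)) : (mkNode i b).bin = b := rfl

theorem lt_iff {s t : Node L} : s < t ↔ s.un < t.un ∨ s.un = t.un ∧ s.bin < t.bin :=
  Prod.Lex.lt_iff

end Node

theorem append_singleton_lt_append_singleton_iff {α : Type*} [LinearOrder α] {l l' : List α}
    (h : l.length = l'.length) (p q : α) : l ++ [p] < l' ++ [q] ↔ l < l' ∨ l = l' ∧ p < q := by
  induction l generalizing l' with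
  | nil =>
    obtain rfl : l' = [] := by simpa using h.symm
    simp [List.cons_lt_cons_iff]
  | cons a l ih =>
    cases l' with
    | nil => simp at h
    | cons b l' =>
      have := ih (l' := l') (by simpa using h)
      simp only [List.cons_append, List.cons_lt_cons_iff, this, List.cons.injEq]
      tauto

namespace Node

theorem succ_lt_succ_iff {s t : Node L} (h : s.len = t.len) (p q : Fin L.k) :
    s.succ p < t.succ q ↔ s < t ∨ s = t ∧ p < q := by
  simp only [lt_iff, eq_iff, succ, un_mkNode, bin_mkNode,
    append_singleton_lt_append_singleton_iff h]
  tauto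

theorem succ_inj {s t : Node L} {p q : Fin L.k} : s.succ p = t.succ q ↔ s = t ∧ p = q := by
  simp only [eq_iff, succ, un_mkNode, bin_mkNode, ← List.concat_eq_append, List.concat_inj]
  tauto

theorem Below.antisymm {s t : Node L} (h : s.Below t) (h' : t.Below s) : s = t :=
  eq_iff.2 ⟨h.1, h.2.eq_of_length_le h'.2.length_le⟩

theorem IsMeet.eq {x y s t : Node L} (hx : x.IsMeet s t) (hy : y.IsMeet s t) : x = y :=
  (hy.2.2 x hx.1 hx.2.1).antisymm (hx.2.2 y hy.1 hy.2.1)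

end Node

/-- The restriction `c(a)|_m` of the node coded by the vertex `a`. -/
def cut (K : Str L ℕ) (a m : ℕ) : Node L := (code K a).restr m

section Cut

variable {K : Str L ℕ} {a b m : ℕ}

theorem cut_eq_mkNode (h : m ≤ a) :
    cut K a m = mkNode (K.U a) (List.ofFn fun r : Fin m => K.R a r) :=
  Node.eq_iff.2 ⟨rfl, List.ext_getElem (by simp [cut, code, Node.restr, h])
    fun n _ _ => by simp [cut, code, Node.restr]⟩

@[simp] theorem un_cut (K : Str L ℕ) (a m : ℕ) : (cut K a m).un = K.U a := rfl

theorem len_cut (h : m ≤ a) : (cut K a m).len = m := by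
  simp [cut_eq_mkNode h, Node.len]

@[simp] theorem len_code (K : Str L ℕ) (a : ℕ) : (code K a).len = a := by
  simp [code, Node.len]

theorem val_cut {x : ℕ} (h : m ≤ a) (hx : x < m) : (cut K a m).val x = K.R a x := by
  simp [cut_eq_mkNode h, Node.val, hx]

theorem cut_self (K : Str L ℕ) (a : ℕ) : cut K a a = code K a := cut_eq_mkNode le_rfl

theorem val_code {x : ℕ} (hx : x < a) : (code K a).val x = K.R a x := by
  rw [← cut_self, val_cut le_rfl hx]

theorem cut_eq_cut_iff (ha : m ≤ a) (hb : m ≤ b) :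
    cut K a m = cut K b m ↔ K.U a = K.U b ∧ ∀ r < m, K.R a r = K.R b r := by
  rw [cut_eq_mkNode ha, cut_eq_mkNode hb, Node.eq_iff]
  simp only [Node.un_mkNode, Node.bin_mkNode, List.ofFn_inj, funext_iff, Fin.forall_iff]

theorem cut_eq_left_iff (h : m ≤ a) (i : Fin L.ku) :
    cut K a m = Node.left i m ↔ K.U a = i ∧ ∀ r < m, K.R a r = 0 := by
  rw [cut_eq_mkNode h, Node.eq_iff]
  simp only [Node.left, Node.un_mkNode, Node.bin_mkNode, ← List.ofFn_const, List.ofFn_inj,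
    funext_iff, Fin.forall_iff]

theorem code_eq_left_iff (i : Fin L.ku) :
    code K m = Node.left i m ↔ K.U m = i ∧ ∀ r < m, K.R m r = 0 := by
  rw [← cut_self, cut_eq_left_iff le_rfl]

theorem cut_succ (h : m < a) : cut K a (m + 1) = (cut K a m).succ (K.R a m) := by
  rw [cut_eq_mkNode h, cut_eq_mkNode h.le, Node.eq_iff]
  exact ⟨rfl, List.ofFn_succ_last⟩

theorem cut_succ_lt_cut_succ_iff (ha : m < a) (hb : m < b) :
    cut K a (m + 1) < cut K b (m + 1) ↔
      cut K a m < cut K b m ∨ cut K a m = cut K b m ∧ K.R a m < K.R b m := by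
  rw [cut_succ ha, cut_succ hb,
    Node.succ_lt_succ_iff ((len_cut ha.le).trans (len_cut hb.le).symm)]

theorem restr_cut {n : ℕ} (h : m ≤ n) : (cut K a n).restr m = cut K a m := by
  simp [cut, Node.restr, List.take_take, h]

theorem below_code_iff {x : Node L} : x.Below (code K a) ↔ x.len ≤ a ∧ x = cut K a x.len := by
  constructor
  · rintro ⟨hun, hbin⟩
    refine ⟨?_, Node.eq_iff.2 ⟨hun, List.prefix_iff_eq_take.1 hbin⟩⟩
    exact hbin.length_le.trans_eq (len_code K a)
  · rintro ⟨-, h⟩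
    rw [h]
    exact ⟨rfl, List.take_prefix _ _⟩

theorem cut_below_code_iff (ha : m ≤ a) :
    (cut K a m).Below (code K b) ↔ m ≤ b ∧ cut K a m = cut K b m := by
  rw [below_code_iff, len_cut ha]

theorem code_below_code_iff :
    (code K a).Below (code K b) ↔ a ≤ b ∧ cut K a a = cut K b a := by
  rw [← cut_self K a, cut_below_code_iff le_rfl]

theorem isStart_iff : IsStart K a m ↔ m < a ∧ K.R a m ≠ 0 ∧ ∀ r < m, K.R a r = 0 := by
  rw [IsStart, Node.IsStart, len_code]
  refine and_congr_right fun h => ?_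
  rw [val_code h]
  exact and_congr_right fun _ => forall₂_congr fun r hr => by rw [val_code (hr.trans h)]

theorem IsStart.unique {n : ℕ} (h : IsStart K a m) (h' : IsStart K a n) : m = n := by
  rw [isStart_iff] at h h'
  rcases lt_trichotomy m n with hl | rfl | hl
  · exact absurd (h'.2.2 m hl) h.2.1
  · rfl
  · exact absurd (h.2.2 n hl) h'.2.1

end Cut

/-- The nodes coded by `a` and `b` agree below `m` and differ at `m`, so that their meet has
length `m`. -/
structure SplitAt (K : Str L ℕ) (a b m : ℕ) : Prop where
  lt_left : m < a
  lt_right : m < b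
  cut_eq : cut K a m = cut K b m
  ne : K.R a m ≠ K.R b m

section SplitAt

variable {K : Str L ℕ} {A B : Set ℕ} {a b m : ℕ} {x : Node L}

theorem SplitAt.symm (h : SplitAt K a b m) : SplitAt K b a m :=
  ⟨h.lt_right, h.lt_left, h.cut_eq.symm, h.ne.symm⟩

theorem SplitAt.not_below (h : SplitAt K a b m) : ¬ (code K a).Below (code K b) := fun hab => by
  rw [code_below_code_iff] at hab
  exact h.ne (((cut_eq_cut_iff le_rfl hab.1).1 hab.2).2 m h.lt_left)

theorem SplitAt.isMeet (h : SplitAt K a b m) : (cut K a m).IsMeet (code K a) (code K b) := by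
  refine ⟨(cut_below_code_iff h.lt_left.le).2 ⟨h.lt_left.le, rfl⟩,
    (cut_below_code_iff h.lt_left.le).2 ⟨h.lt_right.le, h.cut_eq⟩, fun y hya hyb => ?_⟩
  rw [below_code_iff] at hya hyb
  have hy : y.len ≤ m := by
    by_contra! hm
    exact h.ne (((cut_eq_cut_iff hya.1 hyb.1).1 (hya.2.symm.trans hyb.2)).2 m hm)
  rw [hya.2, ← restr_cut hy]
  exact ⟨rfl, List.take_prefix _ _⟩

theorem exists_splitAt_le {n : ℕ} (hU : K.U a = K.U b) (ha : n < a) (hb : n < b)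
    (hne : K.R a n ≠ K.R b n) : ∃ m ≤ n, SplitAt K a b m := by
  have hex : ∃ m, K.R a m ≠ K.R b m := ⟨n, hne⟩
  have hle : Nat.find hex ≤ n := Nat.find_min' hex hne
  exact ⟨Nat.find hex, hle, hle.trans_lt ha, hle.trans_lt hb,
    (cut_eq_cut_iff (hle.trans ha.le) (hle.trans hb.le)).2
      ⟨hU, fun r hr => not_not.1 (Nat.find_min hex hr)⟩, Nat.find_spec hex⟩

theorem exists_splitAt (hab : ¬ (code K a).Below (code K b)) (hU : K.U a = K.U b) (h : a ≤ b) :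
    ∃ m, SplitAt K a b m := by
  obtain ⟨n, hna, hne⟩ : ∃ n, n < a ∧ K.R a n ≠ K.R b n := by
    by_contra! hcon
    exact hab (code_below_code_iff.2 ⟨h, (cut_eq_cut_iff le_rfl h).2 ⟨hU, hcon⟩⟩)
  obtain ⟨m, -, hm⟩ := exists_splitAt_le hU hna (hna.trans_le h) hne
  exact ⟨m, hm⟩

theorem mem_spNode :
    x ∈ SpNode K A ↔ ∃ a ∈ A, ∃ b ∈ A, ∃ m, SplitAt K a b m ∧ x = cut K a m := by
  constructor
  · rintro ⟨a, ha, b, hb, hU, hperp, hx⟩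
    obtain ⟨m, hm⟩ : ∃ m, SplitAt K a b m := by
      rcases le_total a b with hab | hab
      · exact exists_splitAt hperp.1 hU hab
      · obtain ⟨m, hm⟩ := exists_splitAt hperp.2 hU.symm hab
        exact ⟨m, hm.symm⟩
    exact ⟨a, ha, b, hb, m, hm, hx.eq hm.isMeet⟩
  · rintro ⟨a, ha, b, hb, m, hm, rfl⟩
    exact ⟨a, ha, b, hb, congrArg Node.un hm.cut_eq, ⟨hm.not_below, hm.symm.not_below⟩, hm.isMeet⟩

theorem mem_sp : m ∈ Sp K A ↔ ∃ a ∈ A, ∃ b ∈ A, SplitAt K a b m := by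
  constructor
  · rintro ⟨x, hx, rfl⟩
    obtain ⟨a, ha, b, hb, m, hm, rfl⟩ := mem_spNode.1 hx
    rw [len_cut hm.lt_left.le]
    exact ⟨a, ha, b, hb, hm⟩
  · rintro ⟨a, ha, b, hb, hm⟩
    exact ⟨cut K a m, mem_spNode.2 ⟨a, ha, b, hb, m, hm, rfl⟩, len_cut hm.lt_left.le⟩

theorem sp_mono (h : A ⊆ B) : Sp K A ⊆ Sp K B := fun m hm => by
  obtain ⟨a, ha, b, hb, hab⟩ := mem_sp.1 hm
  exact mem_sp.2 ⟨a, h ha, b, h hb, hab⟩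

end SplitAt

/-! ### Ranks and enumerations -/

/-- The number of elements of `S` below `t`. -/
def rank {α : Type*} [LinearOrder α] (S : Finset α) (t : α) : ℕ := (S.filter (· < t)).card

section Rank

variable {α : Type*} [LinearOrder α] {S : Finset α} {s t : α}

theorem rank_lt_rank (hs : s ∈ S) (h : s < t) : rank S s < rank S t :=
  Finset.card_lt_card <| Finset.ssubset_iff_of_subset
    (Finset.monotone_filter_right S fun _ _ hu => hu.trans h) |>.2 ⟨s, by simp [hs, h], by simp⟩

theorem rank_inj (hs : s ∈ S) (ht : t ∈ S) (h : rank S s = rank S t) : s = t := by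
  rcases lt_trichotomy s t with hl | rfl | hl
  · exact absurd h (rank_lt_rank hs hl).ne
  · rfl
  · exact absurd h (rank_lt_rank ht hl).ne'

theorem rank_lt_rank_iff (hs : s ∈ S) (ht : t ∈ S) : rank S s < rank S t ↔ s < t := by
  refine ⟨fun h => ?_, rank_lt_rank hs⟩
  by_contra! hts
  rcases hts.lt_or_eq with hl | rfl
  · exact h.not_gt (rank_lt_rank ht hl)
  · exact h.false

theorem rank_image {β : Type*} [LinearOrder β] [DecidableEq β] {f : α → β}
    (hf : StrictMonoOn f S) (ht : t ∈ S) :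
    rank (S.image f) (f t) = rank S t := by
  have : (S.image f).filter (· < f t) = (S.filter (· < t)).image f := by
    rw [Finset.filter_image]
    exact congrArg _ (Finset.filter_congr fun u hu => hf.lt_iff_lt hu ht)
  rw [rank, this, Finset.card_image_of_injOn
    (hf.injOn.mono (Finset.coe_subset.2 (Finset.filter_subset _ _))), rank]

theorem rank_insert [DecidableEq α] (hs : s ∉ S) :
    rank (insert s S) t = rank S t + if s < t then 1 else 0 := by
  rw [rank, Finset.filter_insert]
  split_ifs with h
  · rw [Finset.card_insert_of_notMem (by simp [hs]), rank]
  · rfl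

theorem rank_eq_rank_add_one (hs : s ∈ S) (hst : s < t) (h : ∀ u ∈ S, u < t → u ≤ s) :
    rank S t = rank S s + 1 := by
  have hins : S.filter (· < t) = insert s (S.filter (· < s)) := by
    ext u
    simp only [Finset.mem_filter, Finset.mem_insert]
    constructor
    · rintro ⟨hu, hut⟩
      exact (h u hu hut).eq_or_lt.imp_right fun hus => ⟨hu, hus⟩
    · rintro (rfl | ⟨hu, hus⟩)
      exacts [⟨hs, hst⟩, ⟨hu, hus.trans hst⟩]
  rw [rank, hins, Finset.card_insert_of_notMem (by simp), rank]

theorem rank_eq_rank_erase_add [DecidableEq α] (hs : s ∈ S) (ht : t ∈ S) (hts : t ≠ s) :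
    rank S t = rank (S.erase s) t + if rank S s ≤ rank (S.erase s) t then 1 else 0 := by
  have h : rank S t = rank (S.erase s) t + if s < t then 1 else 0 := by
    rw [← rank_insert (Finset.notMem_erase s S), Finset.insert_erase hs]
  rcases lt_or_gt_of_ne hts with hlt | hlt
  · have := rank_lt_rank ht hlt
    rw [if_neg hlt.not_gt] at h
    rw [if_neg (by omega), h]
  · have := rank_lt_rank hs hlt
    rw [if_pos hlt] at h
    rw [if_pos (by omega), h]

end Rank

namespace Lists

variable {d : ℕ} {s t : Fin d → Node L} {S : Finset (Node L)}

theorem card_eq (h : Lists s S) : S.card = d := by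
  rw [← Set.ncard_coe_finset, ← h.2, Set.ncard_range_of_injective h.1.injective, Nat.card_fin]

theorem mem (h : Lists s S) (i : Fin d) : s i ∈ S := by
  rw [← Finset.mem_coe, ← h.2]
  exact ⟨i, rfl⟩

theorem exists_eq (h : Lists s S) {u : Node L} (hu : u ∈ S) : ∃ i, s i = u := by
  rwa [← Finset.mem_coe, ← h.2] at hu

theorem rank_eq (h : Lists s S) (i : Fin d) : rank S (s i) = i := by
  have hS : S = Finset.univ.image s := Finset.coe_injective (by simp [h.2])
  rw [hS, rank_image (h.1.strictMonoOn _) (Finset.mem_univ i), rank, Finset.filter_gt_eq_Iio,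
    Fin.card_Iio]

theorem unique (hs : Lists s S) (ht : Lists t S) : s = t :=
  funext fun i => rank_inj (hs.mem i) (ht.mem i) (by rw [hs.rank_eq, ht.rank_eq])

end Lists

theorem lists_vec (S : Finset (Node L)) : Lists (vec S) S :=
  ⟨(S.orderEmbOfFin rfl).strictMono, S.range_orderEmbOfFin rfl⟩

theorem exists_lists {d : ℕ} {S : Finset (Node L)} (h : S.card = d) : ∃ s : Fin d → Node L,
    Lists s S :=
  h ▸ ⟨_, lists_vec S⟩

theorem levelAge_eq {F : Set (FinStr L)} {K : Str L ℕ} {A : Set ℕ} {m d : ℕ} {s : Fin d → Node L}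
    (h : Lists s (level K A m)) : levelAge F K A m = ⟨d, age F K m s⟩ := by
  obtain rfl := h.card_eq
  rw [h.unique (lists_vec _)]
  rfl

/-! ### Levels -/

/-- The position of `c(a)|_m` in the level set `c[A]|_m`. -/
def position (K : Str L ℕ) (A : Set ℕ) (m a : ℕ) : ℕ := rank (level K A m) (cut K a m)

section Level

variable {K : Str L ℕ} {A : Set ℕ} {a b m : ℕ}

theorem mem_level {t : Node L} : t ∈ level K A m ↔ ∃ a ∈ A, m ≤ a ∧ t = cut K a m := by
  rw [level, Set.Finite.mem_toFinset]
  rfl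

theorem cut_mem_level (ha : a ∈ A) (h : m ≤ a) : cut K a m ∈ level K A m :=
  mem_level.2 ⟨a, ha, h, rfl⟩

theorem code_mem_level (ha : a ∈ A) : code K a ∈ level K A a :=
  cut_self K a ▸ cut_mem_level ha le_rfl

theorem Lists.exists_vertex {d : ℕ} {s : Fin d → Node L} (h : Lists s (level K A m)) (i : Fin d) :
    ∃ a ∈ A, m ≤ a ∧ s i = cut K a m :=
  mem_level.1 (h.mem i)

theorem Lists.exists_index {d : ℕ} {s : Fin d → Node L} (h : Lists s (level K A m)) (ha : a ∈ A)
    (hm : m ≤ a) : ∃ i : Fin d, s i = cut K a m ∧ (i : ℕ) = position K A m a := by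
  obtain ⟨i, hi⟩ := h.exists_eq (cut_mem_level ha hm)
  exact ⟨i, hi, by rw [position, ← hi, h.rank_eq]⟩

theorem position_lt_card (ha : a ∈ A) (hm : m ≤ a) : position K A m a < (level K A m).card := by
  obtain ⟨i, -, hi⟩ := (lists_vec (level K A m)).exists_index ha hm
  exact hi ▸ i.2

theorem image_restr_level_succ (K : Str L ℕ) (A : Set ℕ) (m : ℕ) :
    (level K A (m + 1)).image (·.restr m) = level K (A ∩ Set.Ioi m) m := by
  ext s
  simp only [Finset.mem_image, mem_level]
  constructor
  · rintro ⟨_, ⟨a, ha, hma, rfl⟩, rfl⟩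
    exact ⟨a, ⟨ha, hma⟩, Nat.le_of_succ_le hma, restr_cut m.le_succ⟩
  · rintro ⟨a, ⟨ha, hma⟩, -, rfl⟩
    exact ⟨_, ⟨a, ha, hma, rfl⟩, restr_cut m.le_succ⟩

theorem R_eq_of_notMem_sp (hm : m ∉ Sp K A) (ha : a ∈ A) (hb : b ∈ A) (hma : m < a) (hmb : m < b)
    (h : cut K a m = cut K b m) : K.R a m = K.R b m := by
  by_contra hne
  exact hm (mem_sp.2 ⟨a, ha, b, hb, hma, hmb, h, hne⟩)

theorem strictMonoOn_restr_level_succ (hm : m ∉ Sp K A) :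
    StrictMonoOn (·.restr m) (level K A (m + 1) : Set (Node L)) := by
  intro s hs t ht hst
  obtain ⟨a, ha, hma, rfl⟩ := mem_level.1 hs
  obtain ⟨b, hb, hmb, rfl⟩ := mem_level.1 ht
  simp only [restr_cut m.le_succ]
  rcases (cut_succ_lt_cut_succ_iff hma hmb).1 hst with h | ⟨h, hlt⟩
  · exact h
  · exact absurd (R_eq_of_notMem_sp hm ha hb hma hmb h) hlt.ne

theorem card_level_succ_of_notMem_sp (hm : m ∉ Sp K A) :
    (level K A (m + 1)).card = (level K (A ∩ Set.Ioi m) m).card := by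
  rw [← image_restr_level_succ,
    Finset.card_image_of_injOn (strictMonoOn_restr_level_succ hm).injOn]

theorem position_succ_of_notMem_sp (hm : m ∉ Sp K A) (ha : a ∈ A) (hma : m < a) :
    position K A (m + 1) a = rank (level K (A ∩ Set.Ioi m) m) (cut K a m) := by
  rw [position, ← image_restr_level_succ,
    ← rank_image (strictMonoOn_restr_level_succ hm) (cut_mem_level ha hma)]
  exact congrArg _ (restr_cut m.le_succ)

theorem level_inter_Ioi_of_notMem (hA : m ∉ A) : level K (A ∩ Set.Ioi m) m = level K A m := by
  ext s
  simp only [mem_level]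
  constructor
  · rintro ⟨a, ha, h⟩
    exact ⟨a, ha.1, h⟩
  · rintro ⟨a, ha, hma, rfl⟩
    exact ⟨a, ⟨ha, lt_of_le_of_ne hma fun h => hA (h ▸ ha)⟩, hma, rfl⟩

theorem card_level_succ_of_noncritical (hA : m ∉ A) (hm : m ∉ Sp K A) :
    (level K A (m + 1)).card = (level K A m).card := by
  rw [card_level_succ_of_notMem_sp hm, level_inter_Ioi_of_notMem hA]

theorem position_succ_of_noncritical (hA : m ∉ A) (hm : m ∉ Sp K A) (ha : a ∈ A) (hma : m < a) :
    position K A (m + 1) a = position K A m a := by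
  rw [position_succ_of_notMem_sp hm ha hma, level_inter_Ioi_of_notMem hA, position]

theorem level_inter_Ioi_of_antichain (hanti : ∀ b ∈ A, m < b → cut K b m ≠ code K m) :
    level K (A ∩ Set.Ioi m) m = (level K A m).erase (code K m) := by
  ext s
  simp only [mem_level, Finset.mem_erase]
  constructor
  · rintro ⟨a, ⟨ha, hma⟩, h, rfl⟩
    exact ⟨hanti a ha hma, a, ha, h, rfl⟩
  · rintro ⟨hne, a, ha, hma, rfl⟩
    refine ⟨a, ⟨ha, lt_of_le_of_ne hma ?_⟩, hma, rfl⟩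
    rintro rfl
    exact hne (cut_self K m)

theorem card_level_succ_of_coding (hA : m ∈ A) (hm : m ∉ Sp K A)
    (hanti : ∀ b ∈ A, m < b → cut K b m ≠ code K m) :
    (level K A (m + 1)).card = (level K A m).card - 1 := by
  rw [card_level_succ_of_notMem_sp hm, level_inter_Ioi_of_antichain hanti,
    Finset.card_erase_of_mem (code_mem_level hA)]

theorem position_of_coding (hA : m ∈ A) (hm : m ∉ Sp K A)
    (hanti : ∀ b ∈ A, m < b → cut K b m ≠ code K m) (ha : a ∈ A) (hma : m < a) :
    position K A m a = position K A (m + 1) a +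
      if rank (level K A m) (code K m) ≤ position K A (m + 1) a then 1 else 0 := by
  rw [position_succ_of_notMem_sp hm ha hma, level_inter_Ioi_of_antichain hanti]
  exact rank_eq_rank_erase_add (code_mem_level hA) (cut_mem_level ha hma.le) (hanti a ha hma)

end Level

/-! ### Stability and age changes -/

/-- A structure attached to the first `m` vertices of `K` as vertices of `A` are attached stays in
`Forb F` when the vertex `m` is added. For `m` outside `A` and outside its splitting levels this
says that `m` is not an age-change level, but it makes sense at all levels and is monotone in
`A`. -/
def Stable (F : Set (FinStr L)) (K : Str L ℕ) (A : Set ℕ) (m : ℕ) : Prop :=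
  ∀ (V : Type) [Finite V] (M : Str L V) (f : V → ℕ),
    (∀ b, f b ∈ A ∧ m < f b ∧ M.U b = K.U (f b)) →
      Forb F (attach K m M f) → Forb F (attach K (m + 1) M f)

section Stability

variable {F : Set (FinStr L)} {K : Str L ℕ} {A D : Set ℕ} {m d : ℕ} {s t : Fin d → Node L}

theorem stable_of_fin
    (h : ∀ (n : ℕ) (M : Str L (Fin n)) (f : Fin n → ℕ),
      (∀ b, f b ∈ A ∧ m < f b ∧ M.U b = K.U (f b)) →
        Forb F (attach K m M f) → Forb F (attach K (m + 1) M f)) : Stable F K A m := by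
  intro V _ M f hf hforb
  obtain ⟨n, ⟨e⟩⟩ := Finite.exists_equiv_fin V
  have hfin := h n (M.pullback e.symm) (f ∘ e.symm) (fun b => hf _)
    (hforb.of_isEmb (isEmb_attach_pullback M f e.symm.injective))
  have hM : (M.pullback e.symm).pullback e = M := by
    ext <;> simp [Str.pullback]
  have hf' : (f ∘ e.symm) ∘ e = f := by
    funext
    simp
  simpa only [hM, hf'] using hfin.of_isEmb (isEmb_attach_pullback _ _ e.injective)

theorem Stable.mono (h : Stable F K A m) (hD : D ⊆ A) : Stable F K D m :=
  fun V _ M f hf => h V M f fun b => ⟨hD (hf b).1, (hf b).2⟩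

theorem Stable.of_forall_ne_zero (hF : ∀ M ∈ F, Irreducible M.2) (h : Stable F K A m)
    (hD : ∀ x ∈ D, m < x → K.R x m ≠ 0 → x ∈ A) : Stable F K D m := by
  intro V _ M f hf hforb
  refine forb_of_forall_clique hF fun S hS => ?_
  by_cases hm : .inl (Fin.last m) ∈ S
  · have hemb (n : ℕ) := isEmb_attach_pullback (K := K) (m := n) M f
      (Subtype.val_injective (p := fun b : V => K.R (f b) m ≠ 0))
    have hsub := h _ (M.pullback (Subtype.val : {b // K.R (f b) m ≠ 0} → V)) (f ∘ Subtype.val)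
      (fun b => ⟨hD _ (hf b).1 (hf b).2.1 b.2, (hf b).2⟩) (hforb.of_isEmb (hemb m))
    refine ⟨_, _, _, hsub, hemb (m + 1), ?_⟩
    rintro (x | b) hx
    · exact ⟨.inl x, rfl⟩
    · exact ⟨.inr ⟨b, hS.ne_zero_of_join hm hx⟩, rfl⟩
  · exact ⟨_, _, _, hforb, isEmb_attach_castLE M f m.le_succ, subset_range_attach_castLE hm⟩

theorem mem_age_iff_forb_attach {n : ℕ} {B : LabStr L d (Fin n)} {M : Str L (Fin n)}
    {f : Fin n → ℕ} (h : ∀ b, m ≤ f b ∧ s (B.lab b) = cut K (f b) m ∧ M.U b = K.U (f b))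
    (hR : M.R = B.R) :
    (⟨n, B⟩ : FinLab L d) ∈ age F K m s ↔ Forb F (attach K m M f) := by
  have hM : (B.toStr fun i => (s i).un) = M := by
    ext b c
    · simp [LabStr.toStr, h b]
    · simp [LabStr.toStr, hR]
  have hval : (fun b (x : Fin m) => (s (B.lab b)).val x) = fun b (x : Fin m) => K.R (f b) x := by
    funext b x
    rw [(h b).2.1, val_cut (h b).1 x.2]
  rw [mem_age, hM, hval]
  rfl

theorem Lists.eq_cut_of_noncritical {a : ℕ} (hA : m ∉ A) (hm : m ∉ Sp K A)
    (hs : Lists s (level K A m)) (ht : Lists t (level K A (m + 1))) (ha : a ∈ A) (hma : m < a)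
    {j : Fin d} (hj : t j = cut K a (m + 1)) : s j = cut K a m := by
  obtain ⟨i, hi, hi'⟩ := hs.exists_index ha hma.le
  obtain rfl : i = j := by
    rw [Fin.ext_iff, hi', ← ht.rank_eq j, hj, ← position_succ_of_noncritical hA hm ha hma,
      position]
  exact hi

theorem Lists.exists_vertex_of_noncritical (hA : m ∉ A) (hm : m ∉ Sp K A)
    (hs : Lists s (level K A m)) (ht : Lists t (level K A (m + 1))) (j : Fin d) :
    ∃ a ∈ A, m < a ∧ s j = cut K a m ∧ t j = cut K a (m + 1) := by
  obtain ⟨a, ha, hma, hj⟩ := ht.exists_vertex j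
  exact ⟨a, ha, hma, hs.eq_cut_of_noncritical hA hm ht ha hma hj, hj⟩

theorem age_succ_subset_of_noncritical (hA : m ∉ A) (hm : m ∉ Sp K A)
    (hs : Lists s (level K A m)) (ht : Lists t (level K A (m + 1))) :
    age F K (m + 1) t ⊆ age F K m s := by
  rintro ⟨n, B⟩ hB
  choose a ha hma hsa hta using hs.exists_vertex_of_noncritical hA hm ht
  have hU (b : Fin n) : (B.toStr fun i => (s i).un).U b = K.U (a (B.lab b)) := by
    simp [LabStr.toStr, hsa]
  rw [mem_age_iff_forb_attach (fun b => ⟨hma _, hta _, hU b⟩) rfl] at hB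
  rw [mem_age_iff_forb_attach (fun b => ⟨(hma _).le, hsa _, hU b⟩) rfl]
  exact hB.of_isEmb (isEmb_attach_castLE _ _ m.le_succ)

theorem age_eq_age_succ_iff_stable (hA : m ∉ A) (hm : m ∉ Sp K A) (hs : Lists s (level K A m))
    (ht : Lists t (level K A (m + 1))) : age F K m s = age F K (m + 1) t ↔ Stable F K A m := by
  constructor
  · intro h
    refine stable_of_fin fun n M f hf hforb => ?_
    choose lab hlab _ using fun b => ht.exists_index (hf b).1 (hf b).2.1
    rw [← mem_age_iff_forb_attach (B := M.toLab lab) (s := s) (fun b => ⟨(hf b).2.1.le,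
      hs.eq_cut_of_noncritical hA hm ht (hf b).1 (hf b).2.1 (hlab b), (hf b).2.2⟩) rfl, h] at hforb
    exact (mem_age_iff_forb_attach (fun b => ⟨(hf b).2.1, hlab b, (hf b).2.2⟩) rfl).1 hforb
  · intro h
    refine Set.Subset.antisymm ?_ (age_succ_subset_of_noncritical hA hm hs ht)
    rintro ⟨n, B⟩ hB
    choose a ha hma hsa hta using hs.exists_vertex_of_noncritical hA hm ht
    have hU (b : Fin n) : (B.toStr fun i => (s i).un).U b = K.U (a (B.lab b)) := by
      simp [LabStr.toStr, hsa]
    rw [mem_age_iff_forb_attach (fun b => ⟨(hma _).le, hsa _, hU b⟩) rfl] at hB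
    rw [mem_age_iff_forb_attach (fun b => ⟨hma _, hta _, hU b⟩) rfl]
    exact h _ _ _ (fun b => ⟨ha _, hma _, hU b⟩) hB

theorem levelAge_eq_iff_stable (hA : m ∉ A) (hm : m ∉ Sp K A) :
    levelAge F K A m = levelAge F K A (m + 1) ↔ Stable F K A m := by
  obtain ⟨s, hs⟩ := exists_lists (S := level K A m) rfl
  obtain ⟨t, ht⟩ := exists_lists (card_level_succ_of_noncritical hA hm)
  rw [levelAge_eq hs, levelAge_eq ht, ← age_eq_age_succ_iff_stable hA hm hs ht]
  simp

theorem mem_AC : m ∈ AC F K A ↔ m ∉ A ∧ m ∉ Sp K A ∧ ¬ Stable F K A m := by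
  simp only [AC, Set.mem_ofPred_eq, Set.mem_union, not_or, and_assoc]
  exact and_congr_right fun h => and_congr_right fun h' => not_congr (levelAge_eq_iff_stable h h')

theorem mem_crit : m ∈ Crit F K A ↔ m ∈ A ∨ m ∈ Sp K A ∨ ¬ Stable F K A m := by
  simp only [Crit, Set.mem_union, mem_AC]
  tauto

theorem stable_of_notMem_crit (hm : m ∉ Crit F K A) : Stable F K A m :=
  by_contra fun h => hm (mem_crit.2 (.inr (.inr h)))

end Stability

/-! ### Closures and interiors -/

section Closure

variable {F : Set (FinStr L)} {K : Str L ℕ} {A C : Set ℕ}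

theorem closed_iff : Closed F K C ↔ Sp K C ⊆ C ∧ ∀ m ∉ C, Stable F K C m := by
  have hC : C ⊆ Crit F K C := fun m hm => mem_crit.2 (.inl hm)
  rw [Closed, Set.Subset.antisymm_iff, and_iff_left hC]
  constructor
  · refine fun h => ⟨fun m hm => h (mem_crit.2 (.inr (.inl hm))), fun m hm => ?_⟩
    by_contra hst
    exact hm (h (mem_crit.2 (.inr (.inr hst))))
  · rintro ⟨hsp, hst⟩ m hm
    rcases mem_crit.1 hm with hm | hm | hm
    · exact hm
    · exact hsp hm
    · exact not_imp_comm.1 (hst m) hm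

theorem subset_cl (F : Set (FinStr L)) (K : Str L ℕ) (A : Set ℕ) : A ⊆ cl F K A :=
  fun _ ha _ hC => hC.1 ha

theorem cl_subset (h : A ⊆ C) (hC : Closed F K C) : cl F K A ⊆ C := fun _ ha => ha C ⟨h, hC⟩

theorem closed_cl (F : Set (FinStr L)) (K : Str L ℕ) (A : Set ℕ) : Closed F K (cl F K A) := by
  rw [closed_iff]
  constructor
  · rintro m hm C hC
    exact (closed_iff.1 hC.2).1 (sp_mono (cl_subset hC.1 hC.2) hm)
  · intro m hm
    simp only [cl, Set.mem_sInter, not_forall] at hm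
    obtain ⟨C, hC, hmC⟩ := hm
    exact ((closed_iff.1 hC.2).2 m hmC).mono (cl_subset hC.1 hC.2)

theorem isInteriorOf_cl (h : ∀ a ∈ A, Closed F K (cl F K A \ {a})) :
    IsInteriorOf F K (cl F K A) A := by
  have hcl : cl F K (cl F K A) = cl F K A :=
    (cl_subset subset_rfl (closed_cl F K A)).antisymm (subset_cl F K _)
  refine ⟨⟨subset_cl F K A, hcl.symm⟩, ?_⟩
  rintro S ⟨hS, hS'⟩ a ha
  by_contra haS
  have hsub : cl F K S ⊆ cl F K A \ {a} :=
    cl_subset (Set.subset_sdiff_singleton hS haS) (h a ha)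
  rw [hS', hcl] at hsub
  exact (hsub (subset_cl F K A ha)).2 rfl

end Closure

/-! ### Ages of nodes -/

section NodeAge

variable {F : Set (FinStr L)} {K : Str L ℕ} {A : Set ℕ} {a m n : ℕ} {i j : Fin L.ku} {q : Fin L.k}

theorem nodeAge_cut (h : m ≤ a) :
    nodeAge F K (cut K a m) = age F K m (fun _ : Fin 1 => cut K a m) := by
  rw [nodeAge, len_cut h]

theorem mem_nodeAge_cut {B : LabStr L 1 (Fin n)} (h : m ≤ a) :
    (⟨n, B⟩ : FinLab L 1) ∈ nodeAge F K (cut K a m) ↔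
      Forb F (attach K m (B.toStr fun _ => K.U a) fun _ => a) := by
  rw [nodeAge_cut h]
  exact mem_age_iff_forb_attach (fun b => ⟨h, rfl, rfl⟩) rfl

theorem nodeAge_cut_anti (h : m ≤ n) (hn : n ≤ a) :
    nodeAge F K (cut K a n) ⊆ nodeAge F K (cut K a m) := by
  rintro ⟨l, B⟩ hB
  rw [mem_nodeAge_cut hn] at hB
  rw [mem_nodeAge_cut (h.trans hn)]
  exact hB.of_isEmb (isEmb_attach_castLE _ _ h)

theorem Stable.nodeAge_eq (h : Stable F K A m) (ha : a ∈ A) (hm : m < a) :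
    nodeAge F K (cut K a (m + 1)) = nodeAge F K (cut K a m) := by
  refine (nodeAge_cut_anti m.le_succ hm).antisymm ?_
  rintro ⟨n, B⟩ hB
  rw [mem_nodeAge_cut hm.le] at hB
  rw [mem_nodeAge_cut hm]
  exact h _ _ _ (fun b => ⟨ha, hm, rfl⟩) hB

theorem mem_nodeAge_left_zero (hF : ∀ M ∈ F, Irreducible M.2) (hK : Forb F K)
    {B : LabStr L 1 (Fin n)} :
    (⟨n, B⟩ : FinLab L 1) ∈ nodeAge F K (Node.left i 0) ↔ Forb F (B.toStr fun _ => i) := by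
  change _ ∈ age F K 0 _ ↔ _
  rw [mem_age]
  exact ⟨fun h => h.of_isEmb (isEmb_inr _ _ _),
    fun h => forb_join_of_forall_eq_zero hF (hK.initial 0) h fun _ x => x.elim0⟩

theorem nodeAge_cut_of_forall_eq_zero (hF : ∀ M ∈ F, Irreducible M.2) (hK : Forb F K) (h : m ≤ a)
    (hzero : ∀ r < m, K.R a r = 0) :
    nodeAge F K (cut K a m) = nodeAge F K (Node.left (K.U a) 0) := by
  ext ⟨n, B⟩
  rw [mem_nodeAge_cut h, mem_nodeAge_left_zero hF hK]
  exact ⟨fun h => h.of_isEmb (isEmb_inr _ _ _),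
    fun h => forb_join_of_forall_eq_zero hF (hK.initial m) h fun _ x => hzero _ x.2⟩

theorem mem_gluingAge_pointGluing {B : LabStr L 1 (Fin n)} :
    (⟨n, B⟩ : FinLab L 1) ∈ gluingAge F (pointGluing i q j) ↔
      Forb F (join (pointGluing i q j).str (B.toStr fun _ => i) fun _ _ => q) :=
  mem_gluingAge

theorem attachAlong_const {V : Type} {M : Str L V} {f : V → ℕ} (hR : ∀ b, K.R (f b) m = q) :
    attachAlong K (fun _ : Fin 1 => m) M f =
      join (pointGluing i q (K.U m)).str M fun _ _ => q := by
  simp only [attachAlong, hR]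
  congr 1
  ext
  exacts [rfl, congrArg Fin.val (K.R_self m)]

theorem nodeAge_cut_start_succ_ne (hF : ∀ M ∈ F, Irreducible M.2) (hK : Forb F K)
    (hm : IsStart K a m) (hfree : ¬ HasFree F K (K.U a)) :
    nodeAge F K (cut K a (m + 1)) ≠ nodeAge F K (Node.left (K.U a) 0) := by
  intro heq
  rw [isStart_iff] at hm
  refine hfree ⟨K.R a m, K.U m, hm.2.1, Set.Subset.antisymm ?_ ?_⟩
  · rintro ⟨n, B⟩ hB
    rw [mem_gluingAge_pointGluing] at hB
    rw [mem_nodeAge_left_zero hF hK]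
    exact hB.of_isEmb (isEmb_inr _ _ _)
  · rintro ⟨n, B⟩ hB
    rw [← heq, mem_nodeAge_cut hm.1] at hB
    rw [mem_gluingAge_pointGluing, ← attachAlong_const fun _ => rfl]
    refine hB.of_range_subset (isEmb_attach K (m + 1) _ _)
      (isEmb_attachAlong (W := Fin 1) _ _ (Function.injective_of_subsingleton _)) ?_
    rintro _ ⟨x | b, rfl⟩
    exacts [⟨.inl (Fin.last m), rfl⟩, ⟨.inr b, rfl⟩]

theorem IsStart.not_stable (hF : ∀ M ∈ F, Irreducible M.2) (hK : Forb F K) (hm : IsStart K a m)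
    (ha : a ∈ A) (hfree : ¬ HasFree F K (K.U a)) : ¬ Stable F K A m := by
  intro h
  refine nodeAge_cut_start_succ_ne hF hK hm hfree ?_
  rw [isStart_iff] at hm
  rw [h.nodeAge_eq ha hm.1, nodeAge_cut_of_forall_eq_zero hF hK hm.1.le hm.2.2]

theorem IsStart.mem_crit (hF : ∀ M ∈ F, Irreducible M.2) (hK : Forb F K) (hm : IsStart K a m)
    (ha : a ∈ A) (hfree : ¬ HasFree F K (K.U a)) : m ∈ Crit F K A :=
  DiaryEnvelope.mem_crit.2 (.inr (.inr (hm.not_stable hF hK ha hfree)))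

end NodeAge

/-! ### Coding levels -/

section Coding

variable {F : Set (FinStr L)} {K : Str L ℕ} {ch : Choices F K} {A : Set ℕ} {m : ℕ}

theorem isEmb_attach_succ {n : ℕ} {M : Str L (Fin n)} {N : Str L (Fin (n + 1))} {f : Fin n → ℕ}
    (hMN : IsEmb Fin.castSucc M N) (hU : N.U (Fin.last n) = K.U m)
    (hR : ∀ b, N.R b.castSucc (Fin.last n) = K.R (f b) m) :
    IsEmb (Sum.elim (Fin.lastCases (.inr (Fin.last n)) .inl) fun b => .inr b.castSucc)
      (attach K (m + 1) M f) (attach K m N (Fin.lastCases m f)) := by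
  have hR' (b : Fin n) : N.R (Fin.last n) b.castSucc = K.R m (f b) := by
    rw [N.R_flip, hR, ← K.R_flip]
  refine ⟨?_, ?_, ?_⟩
  · rintro (x | b) (y | c)
    · induction x using Fin.lastCases <;> induction y using Fin.lastCases <;> simp
    · induction x using Fin.lastCases <;> simp [c.castSucc_ne_last.symm]
    · induction y using Fin.lastCases <;> simp
    · simp
  · rintro (x | b)
    · induction x using Fin.lastCases <;> simp [attach, attachAlong, join, Str.pullback, hU]
    · exact hMN.2.1 b
  · rintro (x | b) (y | c)
    · induction x using Fin.lastCases <;> induction y using Fin.lastCases <;>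
        simp [attach, attachAlong, join, Str.pullback, K.R_self, N.R_self, ← K.R_flip]
    · induction x using Fin.lastCases <;> simp [attach, attachAlong, join, hR', ← K.R_flip]
    · induction y using Fin.lastCases <;> simp [attach, attachAlong, join, hR]
    · exact hMN.2.2 b c

theorem WeaklyDiagonal.notMem_sp (hA : WeaklyDiagonal F K A) (hm : m ∈ A) : m ∉ Sp K A :=
  fun h => Set.notMem_empty m (hA.disjoint ▸ ⟨h, hm⟩)

theorem WeaklyDiagonal.cut_ne_code (hA : WeaklyDiagonal F K A) (hm : m ∈ A) :
    ∀ b ∈ A, m < b → cut K b m ≠ code K m := fun b hb hmb h => by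
  refine hA.antichain m hm b hb hmb.ne (code_below_code_iff.2 ⟨hmb.le, ?_⟩)
  rw [h, cut_self]

theorem Lists.eq_cut_of_coding (hA : WeaklyDiagonal F K A) {a e : ℕ} {s : Fin (e + 1) → Node L}
    {t : Fin e → Node L} (hm : m ∈ A) (hs : Lists s (level K A m))
    (ht : Lists t (level K A (m + 1))) {j : Fin (e + 1)} (hj : s j = code K m) (ha : a ∈ A)
    (hma : m < a) {α : Fin e} (hα : t α = cut K a (m + 1)) : s (j.succAbove α) = cut K a m := by
  obtain ⟨i, hi, hi'⟩ := hs.exists_index ha hma.le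
  rw [← hi, Fin.ext (a := j.succAbove α) (b := i)]
  rw [hi', position_of_coding hm (hA.notMem_sp hm) (hA.cut_ne_code hm) ha hma, ← hj, hs.rank_eq,
    position, ← hα, ht.rank_eq, Fin.succAbove]
  by_cases h : (j : ℕ) ≤ α
  · rw [if_pos h, if_neg (by simpa [Fin.lt_def] using h), Fin.val_succ]
  · rw [if_neg h, if_pos (by simpa [Fin.lt_def] using h), Fin.val_castSucc, add_zero]

/-- The condition `A' = A^ε` on controlled coding levels is what makes them stable: adding the new
vertex imposes no condition on the remaining ones. -/
theorem Diagonal.stable_of_mem (hA : Diagonal ch A) (hm : m ∈ A) : Stable F K A m := by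
  obtain ⟨e, s, t, hs, ht, j, hj, htri⟩ := hA.coding m hm
  refine stable_of_fin fun n M f hf hforb => ?_
  choose lab hlab _ using fun b => ht.exists_index (hf b).1 (hf b).2.1
  have hcut (b : Fin n) : s (j.succAbove (lab b)) = cut K (f b) m :=
    hs.eq_cut_of_coding hA.weak hm ht hj (hf b).1 (hf b).2.1 (hlab b)
  have hU (b : Fin n) : (s (j.succAbove (lab b))).un = M.U b := by
    rw [hcut, un_cut, (hf b).2.2]
  have hmem : (⟨n, M.toLab lab⟩ : FinLab L e) ∈ (age F K m s).pull j.succAbove :=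
    (mem_age_iff_forb_attach (fun b => ⟨(hf b).2.1.le, hcut b, (hf b).2.2⟩) rfl).2 hforb
  rw [← htri.next_eq] at hmem
  refine ((mem_age_iff_forb_attach (f := Fin.lastCases m f)
    (M := LabStr.toStr _ fun i => (s i).un) (fun b => ?_) rfl).1 hmem).of_isEmb
      (isEmb_attach_succ ⟨Fin.castSucc_injective n, fun b => ?_, fun b c => ?_⟩ ?_ fun b => ?_)
  · induction b using Fin.lastCases with
    | last => simp [LabStr.addPoint, LabStr.toStr, hj, cut_self, code]
    | cast b => simp [LabStr.addPoint, LabStr.toStr, Str.toLab, hcut, (hf b).2.1.le]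
  · simp [LabStr.toStr, LabStr.addPoint, Str.toLab, hU]
  · simp [LabStr.toStr, LabStr.addPoint, Str.toLab]
  · simp [LabStr.toStr, LabStr.addPoint, hj, code]
  · simp [LabStr.toStr, LabStr.addPoint, Str.toLab, hlab, val_cut (hf b).2.1]

end Coding

/-! ### Start levels -/

section Start

variable {F : Set (FinStr L)} {K : Str L ℕ} {ch : Choices F K} {A : Set ℕ} {a b m : ℕ}

theorem Diagonal.start_notMem (hF : ∀ M ∈ F, Irreducible M.2) (hK : Forb F K)
    (hA : Diagonal ch A) (ha : a ∈ A) (hm : IsStart K a m) (hfree : ¬ HasFree F K (K.U a)) :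
    m ∉ A :=
  fun h => hm.not_stable hF hK ha hfree (hA.stable_of_mem h)

theorem Diagonal.isStart_of_path_eq (hA : Diagonal ch A) (ha : a ∈ A) (hb : b ∈ A)
    (hfree : HasFree F K (K.U a)) (hm : IsStart K a m) (h : path F K a = path F K b) :
    IsStart K b m := by
  obtain ⟨n, hn⟩ := hA.weak.exists_start b hb
  have hU : K.U a = K.U b := congrArg Prod.fst h
  have hmax := hA.paths.maximal a ha
  have hrefl : ch.pathLE (path F K a) (path F K a) := or_self_iff.1 (ch.pathLE_total _ _ hmax hmax)
  have hmn : m ≤ n := (hA.paths.free_order a ha b hb hU hfree m n hm hn).2 (by rwa [← h])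
  have hnm : n ≤ m := (hA.paths.free_order b hb a ha hU.symm (hU ▸ hfree) n m hn hm).2
    (by rwa [← h])
  rwa [le_antisymm hmn hnm]

theorem Diagonal.U_free_start (hA : Diagonal ch A) (ha : a ∈ A) (hfree : HasFree F K (K.U a))
    (hm : IsStart K a m) : K.U m = (ch.free (K.U a)).2 :=
  ((code_eq_left_iff _).1 (hA.paths.free_start a ha hfree m hm).1).1

theorem Diagonal.R_free_start_eq_zero (hA : Diagonal ch A) {r : ℕ} (ha : a ∈ A)
    (hfree : HasFree F K (K.U a)) (hm : IsStart K a m) (hr : r < m) : K.R m r = 0 :=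
  ((code_eq_left_iff _).1 (hA.paths.free_start a ha hfree m hm).1).2 r hr

theorem Diagonal.R_free_start (hA : Diagonal ch A) (ha : a ∈ A) (hfree : HasFree F K (K.U a))
    (hm : IsStart K a m) : K.R a m = (ch.free (K.U a)).1 := by
  rw [← (hA.paths.free_start a ha hfree m hm).2.1, val_code (isStart_iff.1 hm).1]

theorem Diagonal.path_eq_of_free_start (hA : Diagonal ch A) (ha : a ∈ A)
    (hfree : HasFree F K (K.U a)) (hm : IsStart K a m) (hb : b ∈ A) (hmb : m < b)
    (hR : K.R b m ≠ 0) : path F K a = path F K b := by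
  by_contra h
  have hzero := (hA.paths.free_start a ha hfree m hm).2.2 b hb hmb (Ne.symm h)
  rw [val_code hmb] at hzero
  exact hR hzero

theorem Diagonal.notMem_of_mem_freeStart (hA : Diagonal ch A) (hm : m ∈ FreeStart F K A) :
    m ∉ A := by
  intro h
  obtain ⟨a, ha, hfree, hs⟩ := hm
  obtain ⟨r, hr⟩ := hA.weak.exists_start m h
  rw [isStart_iff] at hr
  exact hr.2.1 (hA.R_free_start_eq_zero ha hfree hs hr.1)

theorem Diagonal.nbhd_free_start (hA : Diagonal ch A) (hm : m ∈ FreeStart F K A) :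
    nbhd K m = {m} := by
  obtain ⟨a, ha, hfree, hs⟩ := hm
  refine Set.Subset.antisymm ?_ (Set.singleton_subset_iff.2 (.inl rfl))
  rintro x (hx | ⟨hx, hR⟩)
  · exact hx
  · exact absurd (hA.R_free_start_eq_zero ha hfree hs hx) hR

/-- The vertices of `A` related to the start level `m` are attached to it by the chosen free
relation, and `m` is unrelated to the previous vertices. -/
theorem Diagonal.stable_of_mem_freeStart (hF : ∀ M ∈ F, Irreducible M.2) (hK : Forb F K)
    (hA : Diagonal ch A) (hm : m ∈ FreeStart F K A) : Stable F K A m := by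
  obtain ⟨a, ha, hfree, hs⟩ := hm
  suffices hst : Stable F K {b | b ∈ A ∧ K.R b m ≠ 0} m from
    hst.of_forall_ne_zero hF fun x hx _ hR => ⟨hx, hR⟩
  refine stable_of_fin fun n M f hf hforb => ?_
  have hpath (b : Fin n) : path F K a = path F K (f b) :=
    hA.path_eq_of_free_start ha hfree hs (hf b).1.1 (hf b).2.1 (hf b).1.2
  have hU (b : Fin n) : K.U a = K.U (f b) := congrArg Prod.fst (hpath b)
  have hR (b : Fin n) : K.R (f b) m = (ch.free (K.U a)).1 := by
    rw [hU b]
    exact hA.R_free_start (hf b).1.1 (hU b ▸ hfree)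
      (hA.isStart_of_path_eq ha (hf b).1.1 hfree hs (hpath b))
  have hM : (M.toLab fun _ => (0 : Fin 1)).toStr (fun _ => K.U a) = M := by
    ext b c
    · simp [LabStr.toStr, (hf b).2.2, hU b]
    · rfl
  have hmem : (⟨n, M.toLab fun _ => 0⟩ : FinLab L 1) ∈ nodeAge F K (Node.left (K.U a) 0) := by
    rw [mem_nodeAge_left_zero hF hK, hM]
    exact hforb.of_isEmb (isEmb_inr _ _ _)
  rw [← (ch.free_spec _ hfree).2, mem_gluingAge_pointGluing, hM, ← hA.U_free_start ha hfree hs,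
    ← attachAlong_const hR] at hmem
  refine (forb_attach_succ_iff hF (Function.injective_of_subsingleton _) ?_).2 ⟨hforb, hmem⟩
  rw [hA.nbhd_free_start ⟨a, ha, hfree, hs⟩, Set.range_const]

theorem Diagonal.mem_sp_of_mem_freeStart (hF : ∀ M ∈ F, Irreducible M.2) (hK : Forb F K)
    (hA : Diagonal ch A) (hm : m ∈ FreeStart F K A) (hc : m ∈ Crit F K A) : m ∈ Sp K A := by
  rcases mem_crit.1 hc with h | h | h
  · exact absurd h (hA.notMem_of_mem_freeStart hm)
  · exact h
  · exact absurd (hA.stable_of_mem_freeStart hF hK hm) h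

end Start

/-! ### Age-change levels -/

section AgeChange

variable {F : Set (FinStr L)} {K : Str L ℕ} {ch : Choices F K} {A : Set ℕ} {m x : ℕ}

theorem notMem_of_mem_AC (hm : m ∈ AC F K A) : m ∉ A := (mem_AC.1 hm).1

theorem notMem_sp_of_mem_AC (hm : m ∈ AC F K A) : m ∉ Sp K A := (mem_AC.1 hm).2.1

theorem subset_crit : A ⊆ Crit F K A := fun _ hm => .inl (.inl hm)

theorem sp_subset_crit : Sp K A ⊆ Crit F K A := fun _ hm => .inl (.inr hm)

theorem ac_subset_crit : AC F K A ⊆ Crit F K A := Set.subset_union_right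

theorem crit_subset_critPlus : Crit F K A ⊆ CritPlus F K A := Set.subset_union_left

theorem IsStart.mem_critPlus {a : ℕ} (hm : IsStart K a m) (ha : a ∈ A) : m ∈ CritPlus F K A :=
  .inr ⟨a, ha, hm⟩

theorem LeftLeaning.range_eq_nbhd {W : Type} {I : Str L W} {φ : W → ℕ}
    (hφ : LeftLeaning K (Set.range φ)) (hemb : IsEmb φ I K) (hI : Irreducible I)
    (hm : IsGreatest (Set.range φ) m) : Set.range φ = nbhd K m := by
  refine Set.Subset.antisymm (fun x hx => ?_) ?_
  · exact (hm.2 hx).eq_or_lt.imp_right fun hxm =>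
      ⟨hxm, hemb.clique_range hI m hm.1 x hx hxm.ne'⟩
  · rintro x (rfl | ⟨hxm, hR⟩)
    exacts [hm.1, hφ m hm.1 x hxm hR]

/-- The age of `A` changes at the level `m`, where the nodes of `A` are `s`, to those of `t` at the
next level; the essential part of the change lies in the coordinates `e` and has cause `ζ`, which
is realised in `K` by the vertices `φ x`. -/
structure Realised (ch : Choices F K) (A : Set ℕ) (m : ℕ) {d d₀ : ℕ} (s t : Fin d → Node L)
    (e : Fin d₀ → Fin d) (ζ : Gluing L d₀) (φ : Fin ζ.size → ℕ) : Prop where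
  lists : Lists s (level K A m)
  lists_succ : Lists t (level K A (m + 1))
  strictMono : StrictMono e
  econ : ECon F K ((fun i => (s i).un) ∘ e) ((age F K m s).pull e) ((age F K (m + 1) t).pull e)
  cause_eq : ch.cause ((fun i => (s i).un) ∘ e) ((age F K m s).pull e)
    ((age F K (m + 1) t).pull e) = ζ
  isEmb : IsEmb φ ζ.str K
  mono : StrictMono φ
  range_eq : Set.range φ = nbhd K m
  leaning : LeftLeaning K (nbhd K m)
  att : ∀ j x, (t j).val (φ x) = (ζ.extend (fun i => (s i).un) e).att j x
  crit : ∀ x ∈ nbhd K m, ∀ c ∈ CritPlus F K A, x ≤ c → c ≤ m → c = m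

theorem Diagonal.exists_realised (hF : ∀ M ∈ F, Irreducible M.2) (hA : Diagonal ch A)
    (hm : m ∈ AC F K A) :
    ∃ (d d₀ : ℕ) (s t : Fin d → Node L) (e : Fin d₀ → Fin d) (ζ : Gluing L d₀)
      (φ : Fin ζ.size → ℕ), Realised ch A m s t e ζ φ := by
  obtain ⟨d, s, t, hs, ht, -, _, ⟨d₀, e, he, hec, rfl⟩, φ, hφ, hemb, hll, hmax, i, hi, hatt, -,
    hcrit⟩ := hA.ageChange m hm
  obtain ⟨M, hM, f, hf⟩ := (ch.cause_mem _ _ _ hec).1.2.2.1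
  have hrange : Set.range φ = nbhd K m := hll.range_eq_nbhd hemb ((hF M hM).of_isEmb hf) hmax
  exact ⟨d, d₀, s, t, e, _, φ, hs, ht, he, hec, rfl, hemb, hφ, hrange, hrange ▸ hll, hatt,
    fun x hx c hc hxc hcm => hcrit.subset ⟨hc, (hi.2 (hrange ▸ hx)).trans hxc, hcm⟩⟩

theorem Diagonal.nbhd_leaning (hF : ∀ M ∈ F, Irreducible M.2) (hA : Diagonal ch A)
    (hm : m ∈ AC F K A) : LeftLeaning K (nbhd K m) := by
  obtain ⟨d, d₀, s, t, e, ζ, φ, h⟩ := hA.exists_realised hF hm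
  exact h.leaning

theorem Diagonal.eq_of_mem_critPlus (hF : ∀ M ∈ F, Irreducible M.2) (hA : Diagonal ch A)
    (hm : m ∈ AC F K A) (hx : x ∈ nbhd K m) {c : ℕ} (hc : c ∈ CritPlus F K A) (hxc : x ≤ c)
    (hcm : c ≤ m) : c = m := by
  obtain ⟨d, d₀, s, t, e, ζ, φ, h⟩ := hA.exists_realised hF hm
  exact h.crit x hx c hc hxc hcm

end AgeChange

/-! ### A closed set containing a diagonal set -/

/-- The critical levels and free start levels of `A` together with the vertices realising the age
changes of `A`. This set is closed and contains `A`. -/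
def hull (F : Set (FinStr L)) (K : Str L ℕ) (A : Set ℕ) : Set ℕ :=
  {x | x ∈ A ∨ x ∈ Sp K A ∨ x ∈ FreeStart F K A ∨ ∃ m ∈ AC F K A, x ∈ nbhd K m}

section Hull

variable {F : Set (FinStr L)} {K : Str L ℕ} {ch : Choices F K} {A D : Set ℕ} {b m r x y : ℕ}

theorem subset_hull : A ⊆ hull F K A := fun _ => .inl

theorem nbhd_subset_hull (hm : m ∈ AC F K A) : nbhd K m ⊆ hull F K A :=
  fun _ hx => .inr (.inr (.inr ⟨m, hm, hx⟩))

theorem crit_subset_hull : Crit F K A ⊆ hull F K A := by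
  rintro x ((hx | hx) | hx)
  exacts [.inl hx, .inr (.inl hx), nbhd_subset_hull hx (.inl rfl)]

theorem IsStart.mem_hull (hF : ∀ M ∈ F, Irreducible M.2) (hK : Forb F K) (hm : IsStart K b m)
    (hb : b ∈ A) : m ∈ hull F K A := by
  by_cases hfree : HasFree F K (K.U b)
  · exact .inr (.inr (.inl ⟨b, hb, hfree, hm⟩))
  · exact crit_subset_hull (hm.mem_crit hF hK hb hfree)

theorem Diagonal.R_sp_eq_zero (hA : Diagonal ch A) (hm : m ∈ Sp K A) (hr : r < m) :
    K.R m r = 0 := by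
  obtain ⟨d, s, t, -, -, α, -, hfree, hsome, hleft⟩ := hA.splitting m hm
  obtain ⟨i, hi⟩ : ∃ i, code K m = Node.left i m := by
    by_cases hf : HasFree F K (s α).un
    · exact ⟨_, (hfree hf).1⟩
    · by_cases hl : s α = Node.left (s α).un m
      · obtain ⟨-, q, j, -, -, -, h⟩ := hleft hf hl
        exact ⟨_, h⟩
      · obtain ⟨r, -, h, -⟩ := hsome hf hl
        exact ⟨_, h⟩
  exact ((code_eq_left_iff _).1 hi).2 r hr

theorem Diagonal.exists_nbhd_of_ne_zero (hF : ∀ M ∈ F, Irreducible M.2) (hA : Diagonal ch A)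
    (hx : x ∈ hull F K A) (hxA : x ∉ A) (hyx : y < x) (hR : K.R x y ≠ 0) :
    ∃ m ∈ AC F K A, x ∈ nbhd K m ∧ y ∈ nbhd K m := by
  rcases hx with h | h | ⟨a, ha, hfree, hs⟩ | ⟨m, hm, h⟩
  · exact absurd h hxA
  · exact absurd (hA.R_sp_eq_zero h hyx) hR
  · exact absurd (hA.R_free_start_eq_zero ha hfree hs hyx) hR
  · exact ⟨m, hm, h, hA.nbhd_leaning hF hm x h y hyx hR⟩

theorem Diagonal.R_eq_zero_of_mem_critPlus (hF : ∀ M ∈ F, Irreducible M.2) (hA : Diagonal ch A)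
    (hx : x ∈ hull F K A) (hxA : x ∉ A) (hyx : y < x) (hy : y ∈ CritPlus F K A) :
    K.R x y = 0 := by
  by_contra hR
  obtain ⟨m, hm, hxm, hym⟩ := hA.exists_nbhd_of_ne_zero hF hx hxA hyx hR
  have hy_eq := hA.eq_of_mem_critPlus hF hm hym hy le_rfl (le_of_mem_nbhd hym)
  exact (hyx.trans_le (le_of_mem_nbhd hxm)).ne hy_eq

theorem Diagonal.R_eq_zero_of_notMem_hull (hF : ∀ M ∈ F, Irreducible M.2) (hA : Diagonal ch A)
    (hx : x ∈ hull F K A) (hxA : x ∉ A) (hyx : y < x) (hy : y ∉ hull F K A) : K.R x y = 0 := by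
  by_contra hR
  obtain ⟨m, hm, -, hym⟩ := hA.exists_nbhd_of_ne_zero hF hx hxA hyx hR
  exact hy (nbhd_subset_hull hm hym)

theorem exists_isStart_of_ne_zero (hr : r < b) (hR : K.R b r ≠ 0) : ∃ q ≤ r, IsStart K b q := by
  have hex : ∃ q, K.R b q ≠ 0 := ⟨r, hR⟩
  have hqr : Nat.find hex ≤ r := Nat.find_min' hex hR
  exact ⟨_, hqr, isStart_iff.2 ⟨hqr.trans_lt hr, Nat.find_spec hex, fun u hu =>
    not_not.1 (Nat.find_min hex hu)⟩⟩

/-- If `b` started earlier than `m`, then `x` would be related to the start level of `b`, which is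
not a level inside a realised age change. -/
theorem Diagonal.isStart_of_splitAt (hF : ∀ M ∈ F, Irreducible M.2) (hA : Diagonal ch A)
    (hx : x ∈ hull F K A) (hxA : x ∉ A) (hb : b ∈ A) (h : SplitAt K b x m) (hR : K.R b m ≠ 0) :
    IsStart K b m := by
  obtain ⟨q, hqm, hq⟩ := exists_isStart_of_ne_zero h.lt_left hR
  rcases hqm.eq_or_lt with rfl | hqm
  · exact hq
  have hxq : K.R x q = 0 := hA.R_eq_zero_of_mem_critPlus hF hx hxA (hqm.trans h.lt_right)
    (hq.mem_critPlus hb)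
  rw [← ((cut_eq_cut_iff h.lt_left.le h.lt_right.le).1 h.cut_eq).2 q hqm] at hxq
  exact absurd hxq (isStart_iff.1 hq).2.1

theorem Diagonal.mem_sp_or_isStart_of_mem_sp (hF : ∀ M ∈ F, Irreducible M.2) (hA : Diagonal ch A)
    (hD : D ⊆ hull F K A) (hzero : ∀ x ∈ D, x ∉ A → m < x → K.R x m = 0) (hm : m ∈ Sp K D) :
    m ∈ Sp K A ∨ ∃ b ∈ A, IsStart K b m := by
  have hstart {x b : ℕ} (hx : x ∈ D) (hxA : x ∉ A) (hb : b ∈ A) (h : SplitAt K b x m) :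
      IsStart K b m :=
    hA.isStart_of_splitAt hF (hD hx) hxA hb h (hzero x hx hxA h.lt_right ▸ h.ne)
  obtain ⟨x, hx, y, hy, h⟩ := mem_sp.1 hm
  by_cases hxA : x ∈ A
  · by_cases hyA : y ∈ A
    · exact .inl (mem_sp.2 ⟨x, hxA, y, hyA, h⟩)
    · exact .inr ⟨x, hxA, hstart hy hyA hxA h⟩
  · by_cases hyA : y ∈ A
    · exact .inr ⟨y, hyA, hstart hx hxA hyA h.symm⟩
    · exact absurd ((hzero x hx hxA h.lt_left).trans (hzero y hy hyA h.lt_right).symm) h.ne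

theorem Diagonal.closed_hull (hF : ∀ M ∈ F, Irreducible M.2) (hK : Forb F K)
    (hA : Diagonal ch A) : Closed F K (hull F K A) := by
  refine closed_iff.2 ⟨fun m hm => ?_, fun m hm => ?_⟩
  · by_contra hmh
    rcases hA.mem_sp_or_isStart_of_mem_sp hF subset_rfl
      (fun x hx hxA hmx => hA.R_eq_zero_of_notMem_hull hF hx hxA hmx hmh) hm with h | ⟨b, hb, h⟩
    · exact hmh (crit_subset_hull (sp_subset_crit h))
    · exact hmh (h.mem_hull hF hK hb)
  · have hst : Stable F K A m := by
      by_contra h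
      exact hm (crit_subset_hull (mem_crit.2 (.inr (.inr h))))
    refine hst.of_forall_ne_zero hF fun x hx hmx hR => ?_
    by_contra hxA
    exact hR (hA.R_eq_zero_of_notMem_hull hF hx hxA hmx hm)

theorem Diagonal.cl_subset_hull (hF : ∀ M ∈ F, Irreducible M.2) (hK : Forb F K)
    (hA : Diagonal ch A) : cl F K A ⊆ hull F K A :=
  cl_subset subset_hull (hA.closed_hull hF hK)

theorem Diagonal.not_isStart_of_mem (hF : ∀ M ∈ F, Irreducible M.2) (hK : Forb F K)
    (hA : Diagonal ch A) (hm : m ∈ A) (hb : b ∈ A) : ¬ IsStart K b m := fun hs => by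
  by_cases hfree : HasFree F K (K.U b)
  · exact hA.notMem_of_mem_freeStart ⟨b, hb, hfree, hs⟩ hm
  · exact hA.start_notMem hF hK hb hs hfree hm

theorem Diagonal.isInteriorOf (hF : ∀ M ∈ F, Irreducible M.2) (hK : Forb F K)
    (hA : Diagonal ch A) : IsInteriorOf F K (cl F K A) A := by
  have hhull := hA.cl_subset_hull hF hK
  have hcl := closed_iff.1 (closed_cl F K A)
  have hzero {m : ℕ} (hm : m ∈ A) : ∀ x ∈ cl F K A, x ∉ A → m < x → K.R x m = 0 :=
    fun x hx hxA hmx => hA.R_eq_zero_of_mem_critPlus hF (hhull hx) hxA hmx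
      (crit_subset_critPlus (subset_crit hm))
  refine isInteriorOf_cl fun a ha => closed_iff.2 ⟨fun m hm => ?_, fun m hm => ?_⟩
  · have hm' : m ∈ Sp K (cl F K A) := sp_mono Set.sdiff_subset hm
    refine ⟨hcl.1 hm', ?_⟩
    rintro rfl
    rcases hA.mem_sp_or_isStart_of_mem_sp hF hhull (hzero ha) hm' with h | ⟨b, hb, h⟩
    · exact hA.weak.notMem_sp ha h
    · exact hA.not_isStart_of_mem hF hK ha hb h
  · by_cases hma : m = a
    · refine (hA.stable_of_mem (hma ▸ ha)).of_forall_ne_zero hF fun x hx hmx hR => ?_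
      by_contra hxA
      exact hR (hzero (hma ▸ ha) x hx.1 hxA hmx)
    · exact (hcl.2 m fun h => hm ⟨h, hma⟩).mono Set.sdiff_subset

end Hull

/-! ### Causes lie in the closure -/

section CriticalGluing

variable {F : Set (FinStr L)} {K : Str L ℕ} {A : Set ℕ} {m n : ℕ} {V W : Type}
  {M : Str L V} {f : V → ℕ} {φ : W → ℕ}

theorem isEmb_attach_attachAlong (hφ : Function.Injective φ) (h : ∀ z, n ≤ φ z) :
    IsEmb (Sum.elim (Sum.inl ∘ Fin.val) (Sum.map φ id))
      (attach K n (attachAlong K φ M f) (Sum.elim φ f)) (attachAlong K id M f) := by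
  refine ⟨?_, ?_, ?_⟩
  · refine (Sum.inl_injective.comp Fin.val_injective).sumElim
      (hφ.sumMap Function.injective_id) ?_
    rintro x (z | b) hxz
    · exact (x.2.trans_le (h z)).ne (Sum.inl_injective hxz)
    · exact Sum.inl_ne_inr hxz
  · rintro (x | z | b) <;> rfl
  · rintro (x | z | b) (y | w | c)
    case inl.inr.inl => exact K.R_flip _ _
    all_goals rfl

/-- At the largest `φ y` outside the closure, stability of the closure would allow the whole of
`φ` to be added to the part of `K` before `φ y` and the part of `φ` after `φ y`. -/
theorem range_subset_cl_of_critical (hF : ∀ M ∈ F, Irreducible M.2) [Finite V] [Finite W]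
    (hf : ∀ b, f b ∈ A ∧ m < f b ∧ M.U b = K.U (f b)) (hφ : Function.Injective φ)
    (hφm : ∀ x, φ x ≤ m) (hlean : LeftLeaning K (Set.range φ))
    (hforb : Forb F (attach K m M f)) (hnot : ¬ Forb F (attachAlong K φ M f))
    (hmin : ∀ y : W, Forb F (attachAlong K (fun x : {x // x ≠ y} => φ x) M f)) :
    Set.range φ ⊆ cl F K A := by
  by_contra hsub
  obtain ⟨_, ⟨y₀, rfl⟩, hy₀⟩ := Set.not_subset.1 hsub
  obtain ⟨y, hy, hmax⟩ :=
    Set.exists_max_image {y | φ y ∉ cl F K A} φ (Set.toFinite _) ⟨y₀, hy₀⟩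
  let ψ : {z // φ y < φ z} → ℕ := fun z => φ z
  have hψ : Function.Injective ψ := hφ.comp Subtype.val_injective
  have hstable := (closed_iff.1 (closed_cl F K A)).2 _ hy _ (attachAlong K ψ M f) (Sum.elim ψ f) (by
    rintro (⟨z, hz⟩ | b)
    · exact ⟨not_not.1 fun h => hz.not_ge (hmax z h), hz, rfl⟩
    · exact ⟨subset_cl F K A (hf b).1, (hφm y).trans_lt (hf b).2.1, (hf b).2.2⟩)
  refine hnot ((hstable ?_).of_range_subset
    (isEmb_attach_attachAlong hψ fun z => z.2) (isEmb_attachAlong M f hφ) ?_)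
  · refine (isEmb_attach_attachAlong hψ fun z => z.2.le).forb_of_forall_clique hF
      fun S hSr hS => ?_
    by_cases hz : ∃ z, φ y < φ z ∧ .inl (φ z) ∈ S
    · obtain ⟨z, hyz, hz⟩ := hz
      refine ⟨_, _, _, hmin y, isEmb_attachAlong M f (hφ.comp Subtype.val_injective), ?_⟩
      intro v hv
      obtain ⟨x | x | b, rfl⟩ := hSr hv
      · have hxz : (x : ℕ) < φ z := x.2.trans hyz
        obtain ⟨w, hw⟩ := hlean _ ⟨z, rfl⟩ x hxz (hS _ hz _ hv (Sum.inl_injective.ne hxz.ne'))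
        exact ⟨.inl ⟨w, fun h => x.2.ne (h ▸ hw.symm)⟩, congrArg Sum.inl hw⟩
      · exact ⟨.inl ⟨x, fun h => x.2.ne (congrArg φ h.symm)⟩, rfl⟩
      · exact ⟨.inr b, rfl⟩
    · refine ⟨_, _, _, hforb, isEmb_attach K m M f, ?_⟩
      intro v hv
      obtain ⟨x | x | b, rfl⟩ := hSr hv
      · exact ⟨.inl ⟨x, x.2.trans_le (hφm y)⟩, rfl⟩
      · exact absurd ⟨x, x.2, hv⟩ hz
      · exact ⟨.inr b, rfl⟩
  · rintro _ ⟨x | b, rfl⟩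
    · rcases lt_or_ge (φ y) (φ x) with h | h
      · exact ⟨.inr (.inl ⟨x, h⟩), rfl⟩
      · exact ⟨.inl ⟨φ x, Nat.lt_succ_of_le h⟩, rfl⟩
    · exact ⟨.inr (.inr b), rfl⟩

end CriticalGluing

/-- The restriction of a gluing along a map into its underlying set. -/
def Gluing.restrict {d k : ℕ} (ζ : Gluing L d) (g : Fin k → Fin ζ.size) : Gluing L d where
  sort := ζ.sort
  size := k
  att i x := ζ.att i (g x)
  str := ζ.str.pullback g

section Restrict

variable {F : Set (FinStr L)} {K : Str L ℕ} {d k n : ℕ}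

theorem gluingAge_subset_restrict {ζ : Gluing L d} {g : Fin k → Fin ζ.size}
    (hg : Function.Injective g) : gluingAge F ζ ⊆ gluingAge F (ζ.restrict g) := by
  rintro ⟨n, B⟩ hB
  rw [mem_gluingAge] at hB ⊢
  exact hB.of_isEmb (IsEmb.join (isEmb_pullback _ hg)
    ⟨Function.injective_id, fun _ => rfl, fun _ _ => rfl⟩ fun _ _ => rfl)

theorem restrict_mem_spec {ρ : Fin d → Fin L.ku} {𝒜 : AgeClass L d} {ζ : Gluing L d}
    (hζ : ζ ∈ Spec F ρ 𝒜) {g : Fin k → Fin ζ.size} (hg : Function.Injective g) :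
    ζ.restrict g ∈ Spec F ρ 𝒜 := by
  obtain ⟨hsort, hforb, ⟨M, hM, f, hf⟩, hage⟩ := hζ
  have hemb : IsEmb g (ζ.restrict g).str ζ.str := isEmb_pullback _ hg
  exact ⟨hsort, hforb.of_isEmb hemb, ⟨M, hM, f ∘ g, hf.comp hemb⟩,
    hage.trans (gluingAge_subset_restrict hg)⟩

theorem restrict_cause_mem_spec {ch : Choices F K} {ρ : Fin d → Fin L.ku} {𝒜 ℬ : AgeClass L d}
    (h : ECon F K ρ 𝒜 ℬ) {ζ : Gluing L d} (hζ : ch.cause ρ 𝒜 ℬ = ζ) {g : Fin k → Fin ζ.size}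
    (hg : Function.Injective g) (hsurj : ¬ Function.Surjective g) :
    ζ.restrict g ∈ Spec F ρ 𝒜 := by
  subst hζ
  by_contra hcon
  have hlt := Fintype.card_lt_of_injective_not_surjective g hg hsurj
  rw [Fintype.card_fin, Fintype.card_fin] at hlt
  exact hlt.not_ge
    (ch.cause_min ρ 𝒜 ℬ h _ ⟨restrict_mem_spec (ch.cause_mem ρ 𝒜 ℬ h).1 hg, hcon⟩)

theorem not_subset_gluingAge_cause (ch : Choices F K) {ρ : Fin d → Fin L.ku}
    {𝒜 ℬ : AgeClass L d} (h : ECon F K ρ 𝒜 ℬ) : ¬ 𝒜 ⊆ gluingAge F (ch.cause ρ 𝒜 ℬ) := by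
  obtain ⟨⟨hsort, hforb, hemb, -⟩, hnot⟩ := ch.cause_mem ρ 𝒜 ℬ h
  exact fun hsub => hnot ⟨hsort, hforb, hemb, hsub⟩

theorem IsEmb.pullback_eq {V W : Type} {M : Str L V} {N : Str L W} {f : V → W}
    (h : IsEmb f M N) : N.pullback f = M := by
  ext a b
  exacts [congrArg Fin.val (h.2.1 a), congrArg Fin.val (h.2.2 a b)]

theorem mem_gluingAge_iff_forb_attachAlong {ζ : Gluing L d} {φ : Fin ζ.size → ℕ}
    (hφ : IsEmb φ ζ.str K) {B : LabStr L d (Fin n)} {f : Fin n → ℕ}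
    (hf : ∀ b x, K.R (f b) (φ x) = ζ.att (B.lab b) x) :
    (⟨n, B⟩ : FinLab L d) ∈ gluingAge F ζ ↔ Forb F (attachAlong K φ (B.toStr ζ.sort) f) := by
  rw [mem_gluingAge, attachAlong, hφ.pullback_eq]
  simp only [hf]

end Restrict

section Causes

variable {F : Set (FinStr L)} {K : Str L ℕ} {ch : Choices F K} {A B : Set ℕ} {m n d d₀ d₁ : ℕ}
  {s t s' t' : Fin d → Node L} {e : Fin d₀ → Fin d} {e' : Fin d₁ → Fin d}
  {ζ : Gluing L d₀} {ζ' : Gluing L d₁} {φ : Fin ζ.size → ℕ} {φ' : Fin ζ'.size → ℕ}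

theorem Realised.le (h : Realised ch A m s t e ζ φ) (x : Fin ζ.size) : φ x ≤ m :=
  le_of_mem_nbhd (h.range_eq.subset ⟨x, rfl⟩)

theorem Realised.exists_vertex (h : Realised ch A m s t e ζ φ) (hm : m ∈ AC F K A) (j : Fin d) :
    ∃ a ∈ A, m < a ∧ s j = cut K a m ∧ t j = cut K a (m + 1) ∧
      ∀ x, K.R a (φ x) = (ζ.extend (fun i => (s i).un) e).att j x := by
  obtain ⟨a, ha, hma, hs, ht⟩ := h.lists.exists_vertex_of_noncritical (notMem_of_mem_AC hm)
    (notMem_sp_of_mem_AC hm) h.lists_succ j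
  refine ⟨a, ha, hma, hs, ht, fun x => ?_⟩
  rw [← h.att, ht, val_cut hma (Nat.lt_succ_of_le (h.le x))]

theorem Realised.extend_att (h : Realised ch A m s t e ζ φ) (i : Fin d₀) (x : Fin ζ.size) :
    (ζ.extend (fun i => (s i).un) e).att (e i) x = ζ.att i x :=
  h.strictMono.injective.extend_apply (fun i => ζ.att i x) (fun _ => 0) i

theorem Realised.nbhd_subset_cl (hF : ∀ M ∈ F, Irreducible M.2)
    (h : Realised ch A m s t e ζ φ) (hm : m ∈ AC F K A) : nbhd K m ⊆ cl F K A := by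
  choose a ha hma hs _ hR using h.exists_vertex hm
  have hsort : ζ.sort = fun i => K.U (a (e i)) := by
    rw [← h.cause_eq, (ch.cause_mem _ _ _ h.econ).1.1]
    exact funext fun i => congrArg Node.un (hs (e i))
  have hnot := not_subset_gluingAge_cause ch h.econ
  rw [h.cause_eq] at hnot
  obtain ⟨⟨n, D⟩, hD, hDζ⟩ := Set.not_subset.1 hnot
  have hRD (b : Fin n) (x) : K.R (a (e (D.lab b))) (φ x) = ζ.att (D.lab b) x :=
    (hR _ x).trans (h.extend_att _ x)
  rw [← h.range_eq]
  refine range_subset_cl_of_critical hF (m := m) (M := D.toStr ζ.sort)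
    (f := fun b => a (e (D.lab b))) (fun b => ⟨ha _, hma _, congrFun hsort _⟩) h.mono.injective
    h.le (h.range_eq ▸ h.leaning) ?_ ?_ fun y => ?_
  · exact (mem_age_iff_forb_attach (fun b => ⟨(hma _).le, hs _, congrFun hsort _⟩) rfl).1 hD
  · rwa [mem_gluingAge_iff_forb_attachAlong h.isEmb hRD] at hDζ
  · let g : Fin (Fintype.card {x // x ≠ y}) → Fin ζ.size := Subtype.val ∘ (Fintype.equivFin _).symm
    have hg : Function.Injective g := Subtype.val_injective.comp (Equiv.injective _)
    have hgy : ¬ Function.Surjective g := fun hsurj =>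
      let ⟨x, hx⟩ := hsurj y
      ((Fintype.equivFin _).symm x).2 hx
    have hDg := (mem_gluingAge_iff_forb_attachAlong (ζ := ζ.restrict g)
      (h.isEmb.comp (isEmb_pullback _ hg)) fun b x => hRD b (g x)).1
        ((restrict_cause_mem_spec h.econ h.cause_eq hg hgy).2.2.2 hD)
    refine hDg.of_range_subset (isEmb_attachAlong _ _ (h.mono.injective.comp hg))
      (isEmb_attachAlong _ _ (h.mono.injective.comp Subtype.val_injective)) ?_
    rintro _ ⟨x | b, rfl⟩
    · exact ⟨.inl (Fintype.equivFin _ x), congrArg (Sum.inl ∘ φ ∘ Subtype.val)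
        ((Fintype.equivFin _).symm_apply_apply x)⟩
    · exact ⟨.inr b, rfl⟩

theorem Diagonal.nbhd_subset_cl (hF : ∀ M ∈ F, Irreducible M.2) (hA : Diagonal ch A)
    (hm : m ∈ AC F K A) : nbhd K m ⊆ cl F K A :=
  let ⟨_, _, _, _, _, _, _, h⟩ := hA.exists_realised hF hm
  h.nbhd_subset_cl hF hm

theorem crit_subset_cl : Crit F K A ⊆ cl F K A := by
  intro m hm
  have hcl := closed_iff.1 (closed_cl F K A)
  rcases mem_crit.1 hm with h | h | h
  · exact subset_cl F K A h
  · exact hcl.1 (sp_mono (subset_cl F K A) h)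
  · by_contra hm
    exact h ((hcl.2 m hm).mono (subset_cl F K A))

/-! ### Ages determine causes -/

theorem Realised.age_succ_eq (hF : ∀ M ∈ F, Irreducible M.2) (h : Realised ch A m s t e ζ φ)
    (hm : m ∈ AC F K A) :
    age F K (m + 1) t = age F K m s ∩ gluingAge F (ζ.extend (fun i => (s i).un) e) := by
  choose a _ hma hs ht hR using h.exists_vertex hm
  have hU (i : Fin d) : (s i).un = K.U (a i) := congrArg Node.un (hs i)
  ext ⟨n, B⟩
  let M : Str L (Fin n) := B.toStr fun i => (s i).un
  rw [Set.mem_inter_iff,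
    mem_age_iff_forb_attach (M := M) (fun b => ⟨hma (B.lab b), ht _, hU _⟩) rfl,
    mem_age_iff_forb_attach (M := M) (fun b => ⟨(hma (B.lab b)).le, hs _, hU _⟩) rfl,
    mem_gluingAge_iff_forb_attachAlong (ζ := ζ.extend _ e) h.isEmb fun b x => hR _ x]
  exact forb_attach_succ_iff hF h.mono.injective h.range_eq

/-- The labelled structure on `V` induced by a map `V → W`. -/
def LabStr.pullback {V W : Type} (B : LabStr L d W) (g : V → W) : LabStr L d V where
  lab v := B.lab (g v)
  R u v := B.R (g u) (g v)
  R_self _ := B.R_self _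
  R_flip _ _ := B.R_flip _ _

theorem pullback_mem_gluingAge {k : ℕ} {γ : Gluing L d} {D : LabStr L d (Fin n)}
    (hD : (⟨n, D⟩ : FinLab L d) ∈ gluingAge F γ) {g : Fin k → Fin n}
    (hg : Function.Injective g) : (⟨k, D.pullback g⟩ : FinLab L d) ∈ gluingAge F γ := by
  rw [mem_gluingAge] at hD ⊢
  exact hD.of_isEmb (IsEmb.join (f := id) ⟨Function.injective_id, fun _ => rfl, fun _ _ => rfl⟩
    ⟨hg, fun _ => rfl, fun _ _ => rfl⟩ fun _ _ => rfl)

theorem forb_join_of_forall_notMem_range (hF : ∀ M ∈ F, Irreducible M.2) {V V' W : Type}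
    {I : Str L W} {M : Str L V} {η : V → W → Fin L.k} {g : V' → V} (hg : Function.Injective g)
    (hη : ∀ b ∉ Set.range g, ∀ x, η b x = 0) (hM : Forb F M)
    (h : Forb F (join I (M.pullback g) (η ∘ g))) : Forb F (join I M η) := by
  refine forb_of_forall_clique hF fun S hS => ?_
  by_cases hx : ∃ x, .inl x ∈ S
  · obtain ⟨x, hx⟩ := hx
    refine ⟨_, _, _, h, IsEmb.join (f := id)
      ⟨Function.injective_id, fun _ => rfl, fun _ _ => rfl⟩ (isEmb_pullback M hg)
      fun _ _ => rfl, ?_⟩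
    rintro (y | b) hb
    · exact ⟨.inl y, rfl⟩
    · obtain ⟨c, rfl⟩ := not_not.1 fun hbg => hS.ne_zero_of_join hx hb (hη b hbg x)
      exact ⟨.inr c, rfl⟩
  · refine ⟨_, M, _, hM, isEmb_inr I M η, ?_⟩
    rintro (y | b) hb
    · exact absurd ⟨y, hb⟩ hx
    · exact ⟨b, rfl⟩

theorem pullback_mem_of_mem_P {k : ℕ} {ρ : Fin d → Fin L.ku} {𝒜 : AgeClass L d}
    (h𝒜 : 𝒜 ∈ P F K ρ) {D : LabStr L d (Fin n)} (hD : (⟨n, D⟩ : FinLab L d) ∈ 𝒜) {g : Fin k → Fin n}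
    (hg : Function.Injective g) : (⟨k, D.pullback g⟩ : FinLab L d) ∈ 𝒜 := by
  obtain ⟨m, s, -, -, -, rfl⟩ := h𝒜
  exact pullback_mem_gluingAge hD hg

theorem forb_toStr_of_mem_P {ρ : Fin d → Fin L.ku} {𝒜 : AgeClass L d} (h𝒜 : 𝒜 ∈ P F K ρ)
    {D : LabStr L d (Fin n)} (hD : (⟨n, D⟩ : FinLab L d) ∈ 𝒜) : Forb F (D.toStr ρ) := by
  obtain ⟨m, s, -, -, hρ, rfl⟩ := h𝒜
  obtain rfl : (fun i => (s i).un) = ρ := funext hρ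
  exact (mem_age.1 hD).of_isEmb (isEmb_inr _ _ _)

theorem ECon.mem_of_forall_lab_ne {ρ : Fin d → Fin L.ku} {𝒜 ℬ : AgeClass L d}
    (h : ECon F K ρ 𝒜 ℬ) {D : LabStr L d (Fin n)} (hD : (⟨n, D⟩ : FinLab L d) ∈ 𝒜) {i : Fin d}
    (hi : ∀ b, D.lab b ≠ i) : (⟨n, D⟩ : FinLab L d) ∈ ℬ := by
  cases d with
  | zero => exact i.elim0
  | succ d =>
    choose lab hlab using fun b => Fin.exists_succAbove_eq (hi b)
    let D' : LabStr L d (Fin n) := { D with lab := lab }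
    have hD' : D'.relabel i.succAbove = D := by
      cases D
      simp only [LabStr.relabel, D', hlab]
    have hpull := h.2 d i.succAbove i.strictMono_succAbove d.lt_succ_self
    rw [← hD'] at hD ⊢
    exact hpull.subset (show (⟨n, D'⟩ : FinLab L d) ∈ 𝒜.pull i.succAbove from hD)

theorem ECon.range_subset (hF : ∀ M ∈ F, Irreducible M.2) {ρ : Fin d → Fin L.ku}
    {𝒜 ℬ : AgeClass L d} (hec : ECon F K (ρ ∘ e') (𝒜.pull e') (ℬ.pull e'))
    (hℬ : ℬ = 𝒜 ∩ gluingAge F (ζ.extend ρ e)) : Set.range e' ⊆ Set.range e := by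
  rintro _ ⟨i, rfl⟩
  by_contra hi
  refine hec.1.2.2.1.2 ?_
  rintro ⟨n, D⟩ hD
  have hforb : Forb F ((D.relabel e').toStr ρ) := forb_toStr_of_mem_P hec.1.1 hD
  let S : Finset (Fin n) := {b | D.lab b ≠ i}
  let g : Fin S.card → Fin n := S.orderEmbOfFin rfl
  have hg : Function.Injective g := (S.orderEmbOfFin rfl).injective
  have hrange (b : Fin n) : b ∈ Set.range g ↔ D.lab b ≠ i := by
    simp only [g, Finset.range_orderEmbOfFin, S, Finset.coe_filter_univ, Set.mem_ofPred_eq]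
  have hDg : (⟨_, D.pullback g⟩ : FinLab L d₁) ∈ 𝒜.pull e' := pullback_mem_of_mem_P hec.1.1 hD hg
  have hDgℬ : (⟨_, (D.pullback g).relabel e'⟩ : FinLab L d) ∈ ℬ :=
    hec.mem_of_forall_lab_ne hDg fun b => (hrange _).1 ⟨b, rfl⟩
  rw [hℬ] at hDgℬ
  refine hℬ.symm.subset ⟨hD, mem_gluingAge.2 ?_⟩
  refine forb_join_of_forall_notMem_range hF hg (fun b hb x => ?_) hforb
    (mem_gluingAge.1 hDgℬ.2)
  rw [hrange, not_not] at hb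
  exact Function.extend_apply' (fun i => ζ.att i x) (fun _ => 0) _ (by
    rw [show (D.relabel e').lab b = e' i from congrArg e' hb]
    exact hi)

theorem exists_eq_comp_cast_of_range_eq {α : Type*} [LinearOrder α] {f : Fin m → α} {g : Fin n → α}
    (hf : StrictMono f) (hg : StrictMono g) (h : Set.range f = Set.range g) :
    ∃ hmn : m = n, f = g ∘ Fin.cast hmn := by
  obtain rfl : m = n := by
    rw [← Fintype.card_fin m, ← Fintype.card_fin n, ← Set.card_range_of_injective hf.injective,
      ← Set.card_range_of_injective hg.injective]
    simp only [h]
  exact ⟨rfl, (hf.range_inj hg).1 h⟩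

theorem Realised.index_unique (hF : ∀ M ∈ F, Irreducible M.2)
    {μ : ℕ} (h : Realised ch A m s t e ζ φ) (hm : m ∈ AC F K A)
    (h' : Realised ch B μ s' t' e' ζ' φ') (hμ : μ ∈ AC F K B)
    (hsort : (fun i => (s i).un) = fun i => (s' i).un) (hage : age F K m s = age F K μ s')
    (hage_succ : age F K (m + 1) t = age F K (μ + 1) t') :
    ∃ hd : d₀ = d₁, e = e' ∘ Fin.cast hd := by
  have hcap := h.age_succ_eq hF hm
  have hcap' := h'.age_succ_eq hF hμ
  have hec := h.econ
  rw [hage, hage_succ, hsort] at hcap hec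
  exact exists_eq_comp_cast_of_range_eq h.strictMono h'.strictMono
    (Set.Subset.antisymm (hec.range_subset hF hcap') (h'.econ.range_subset hF hcap))

end Causes

/-! ### Splitting levels -/

section Splitting

variable {F : Set (FinStr L)} {K : Str L ℕ} {A : Set ℕ} {a b m : ℕ} {s s' : Node L}

theorem SplitAt.mem_spNode (h : SplitAt K a b m) (ha : a ∈ A) (hb : b ∈ A) :
    cut K a m ∈ SpNode K A :=
  DiaryEnvelope.mem_spNode.2 ⟨a, ha, b, hb, m, h, rfl⟩

theorem exists_ne_zero_of_mem_spNode (hs : s ∈ SpNode K A) (hm : s.len = m) :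
    ∃ a ∈ A, m < a ∧ cut K a m = s ∧ K.R a m ≠ 0 := by
  obtain ⟨a, ha, b, hb, n, h, rfl⟩ := mem_spNode.1 hs
  obtain rfl : n = m := (len_cut h.lt_left.le).symm.trans hm
  by_cases h0 : K.R a n = 0
  · exact ⟨b, hb, h.lt_right, h.cut_eq.symm, fun h' => h.ne (h0.trans h'.symm)⟩
  · exact ⟨a, ha, h.lt_left, rfl, h0⟩

namespace WeaklyDiagonal

theorem spNode_unique (hA : WeaklyDiagonal F K A) (hs : s ∈ SpNode K A) (hs' : s' ∈ SpNode K A)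
    (h : s.len = s'.len) : s = s' :=
  (hA.unique_split _ ⟨s, hs, rfl⟩).unique ⟨hs, rfl⟩ ⟨hs', h.symm⟩

theorem exists_eq_zero (hA : WeaklyDiagonal F K A) (hm : m ∈ Sp K A) (ha : a ∈ A) (hma : m ≤ a) :
    ∃ b ∈ A, m < b ∧ cut K b m = cut K a m ∧ K.R b m = 0 := by
  obtain ⟨b, hb, hmb, h⟩ := mem_level.1 (hA.succ_zero m hm _ (cut_mem_level ha hma))
  rw [cut_succ hmb, Node.succ_inj] at h
  exact ⟨b, hb, hmb, h.1.symm, h.2.symm⟩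

theorem cut_eq_of_ne_zero (hA : WeaklyDiagonal F K A) (hs : s ∈ SpNode K A) (hm : s.len = m)
    (ha : a ∈ A) (hma : m < a) (hR : K.R a m ≠ 0) : cut K a m = s := by
  obtain ⟨b, hb, hmb, h, h0⟩ := hA.exists_eq_zero ⟨s, hs, hm⟩ ha hma.le
  have hsplit : SplitAt K a b m := ⟨hma, hmb, h.symm, h0 ▸ hR⟩
  exact hA.spNode_unique (hsplit.mem_spNode ha hb) hs ((len_cut hma.le).trans hm.symm)

theorem R_eq_of_ne_zero (hA : WeaklyDiagonal F K A) (hm : m ∈ Sp K A) (ha : a ∈ A) (hb : b ∈ A)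
    (hma : m < a) (hmb : m < b) (hRa : K.R a m ≠ 0) (hRb : K.R b m ≠ 0) : K.R a m = K.R b m := by
  obtain ⟨s, hs, rfl⟩ := hm
  obtain ⟨c, hc, hmc, hcut, h0⟩ := hA.exists_eq_zero ⟨s, hs, rfl⟩ ha hma.le
  have hca := hA.cut_eq_of_ne_zero hs rfl ha hma hRa
  have hcb := hA.cut_eq_of_ne_zero hs rfl hb hmb hRb
  have hsucc {x : ℕ} (hx : x ∈ A) (hmx : s.len < x) (hxs : cut K x s.len = s) :
      s.succ (K.R x s.len) ∈ {t | t ∈ level K A (s.len + 1) ∧ s.Below t} := by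
    refine ⟨?_, rfl, List.prefix_append _ _⟩
    have := cut_mem_level (K := K) hx hmx
    rwa [cut_succ hmx, hxs] at this
  by_contra hne
  refine (Set.two_lt_ncard_iff (Set.finite_of_ncard_ne_zero ?_)).2
    ⟨_, _, _, hsucc ha hma hca, hsucc hb hmb hcb, hsucc hc hmc (hcut.trans hca), ?_, ?_, ?_⟩ |>.ne'
    (hA.two_succ s hs)
  · simp [hA.two_succ s hs]
  all_goals simp only [ne_eq, Node.succ_inj, true_and, h0]
  exacts [hne, hRa, hRb]

theorem level_succ_of_spNode (hA : WeaklyDiagonal F K A) (hs : s ∈ SpNode K A) (hm : s.len = m)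
    (ha : a ∈ A) (hma : m < a) (hR : K.R a m ≠ 0) :
    level K A (m + 1) = insert (s.succ (K.R a m)) ((level K A m).image (·.succ 0)) := by
  ext t
  simp only [Finset.mem_insert, Finset.mem_image]
  constructor
  · intro ht
    obtain ⟨b, hb, hmb, rfl⟩ := mem_level.1 ht
    rw [cut_succ hmb]
    by_cases h0 : K.R b m = 0
    · exact .inr ⟨cut K b m, cut_mem_level hb (Nat.le_of_succ_le hmb), by rw [h0]⟩
    · rw [hA.cut_eq_of_ne_zero hs hm hb hmb h0,
        hA.R_eq_of_ne_zero ⟨s, hs, hm⟩ hb ha hmb hma h0 hR]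
      exact .inl rfl
  · rintro (rfl | ⟨u, hu, rfl⟩)
    · rw [← hA.cut_eq_of_ne_zero hs hm ha hma hR, ← cut_succ hma]
      exact cut_mem_level ha hma
    · exact hA.succ_zero m ⟨s, hs, hm⟩ u hu

theorem strictMonoOn_succ_level (q : Fin L.k) :
    StrictMonoOn (·.succ q) (level K A m : Set (Node L)) := by
  intro s hs t ht hst
  obtain ⟨a, -, hma, rfl⟩ := mem_level.1 hs
  obtain ⟨b, -, hmb, rfl⟩ := mem_level.1 ht
  exact (Node.succ_lt_succ_iff ((len_cut hma).trans (len_cut hmb).symm) q q).2 (.inl hst)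

theorem position_succ_of_eq_zero (hA : WeaklyDiagonal F K A) (hs : s ∈ SpNode K A)
    (hm : s.len = m) (ha : a ∈ A) (hma : m < a) (hR : K.R a m = 0) :
    position K A (m + 1) a = position K A m a + if s < cut K a m then 1 else 0 := by
  obtain ⟨c, hc, hmc, -, hc0⟩ := exists_ne_zero_of_mem_spNode hs hm
  have hnot : s.succ (K.R c m) ∉ (level K A m).image (·.succ 0) := by
    simp only [Finset.mem_image, Node.succ_inj, not_exists, not_and]
    exact fun _ _ _ h => hc0 h.symm
  rw [position, hA.level_succ_of_spNode hs hm hc hmc hc0, rank_insert hnot, cut_succ hma, hR,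
    rank_image (strictMonoOn_succ_level 0) (cut_mem_level ha hma.le)]
  simp only [Node.succ_lt_succ_iff (hm.trans (len_cut hma.le).symm), Fin.not_lt_zero, and_false,
    or_false]
  rfl

theorem position_succ_of_ne_zero (hA : WeaklyDiagonal F K A) (hs : s ∈ SpNode K A)
    (hm : s.len = m) (ha : a ∈ A) (hma : m < a) (hR : K.R a m ≠ 0) :
    position K A (m + 1) a = position K A m a + 1 := by
  obtain ⟨b, hb, hmb, hcut, h0⟩ := hA.exists_eq_zero ⟨s, hs, hm⟩ ha hma.le
  have has := hA.cut_eq_of_ne_zero hs hm ha hma hR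
  have hb' := hA.position_succ_of_eq_zero hs hm hb hmb h0
  rw [hcut, has, if_neg (lt_irrefl s)] at hb'
  have hpos : position K A m b = position K A m a := by rw [position, position, hcut]
  rw [← hpos, ← add_zero (position K A m b), ← hb']
  refine rank_eq_rank_add_one (cut_mem_level hb hmb)
    ((cut_succ_lt_cut_succ_iff hmb hma).2 (.inr ⟨hcut, h0 ▸ Fin.pos_iff_ne_zero.2 hR⟩)) ?_
  intro u hu hua
  obtain ⟨c, hc, hmc, rfl⟩ := mem_level.1 hu
  by_contra! hbc
  rw [cut_succ_lt_cut_succ_iff hmc hma] at hua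
  rw [cut_succ_lt_cut_succ_iff hmb hmc, hcut, h0] at hbc
  rcases hua with hca | ⟨hca, hRlt⟩
  · exact hbc.elim (fun h => hca.not_gt h) fun h => hca.ne h.1.symm
  · have hc0 : K.R c m ≠ 0 := hbc.elim (fun h => absurd hca h.ne') fun h => h.2.ne'
    exact hRlt.ne (hA.R_eq_of_ne_zero ⟨s, hs, hm⟩ hc ha hmc hma hc0 hR)

theorem position_of_spNode (hA : WeaklyDiagonal F K A) (hs : s ∈ SpNode K A) (hm : s.len = m)
    (ha : a ∈ A) (hma : m < a) :
    position K A m a = position K A (m + 1) a -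
        (if rank (level K A m) s < position K A (m + 1) a then 1 else 0) ∧
      (K.R a m ≠ 0 ↔ position K A m a = rank (level K A m) s ∧
        position K A (m + 1) a = rank (level K A m) s + 1) := by
  by_cases h0 : K.R a m = 0
  · have hsucc := hA.position_succ_of_eq_zero hs hm ha hma h0
    obtain ⟨c, hc, hmc, hcs, -⟩ := exists_ne_zero_of_mem_spNode hs hm
    have hlt : rank (level K A m) s < position K A m a ↔ s < cut K a m :=
      rank_lt_rank_iff (hcs ▸ cut_mem_level hc hmc.le) (cut_mem_level ha hma.le)
    simp only [h0, ne_eq, not_true, false_iff]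
    split_ifs at hsucc with h
    · rw [← hlt] at h
      rw [if_pos (by omega)]
      omega
    · rw [← hlt] at h
      rw [if_neg (by omega)]
      omega
  · have hsucc := hA.position_succ_of_ne_zero hs hm ha hma h0
    have hrank : position K A m a = rank (level K A m) s := by
      rw [position, hA.cut_eq_of_ne_zero hs hm ha hma h0]
    rw [if_pos (by omega)]
    simp only [ne_eq, h0, not_false_eq_true, true_iff]
    omega

end WeaklyDiagonal

end Splitting

/-! ### Consecutive critical levels -/

/-- No critical level lies strictly between `m` and `m'`. -/
def NoCritBetween (F : Set (FinStr L)) (K : Str L ℕ) (A : Set ℕ) (m m' : ℕ) : Prop :=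
  ∀ x ∈ Crit F K A, m < x → m' ≤ x

section Consecutive

variable {F : Set (FinStr L)} {K : Str L ℕ} {A : Set ℕ} {a m m' : ℕ}

theorem exists_next_crit (ha : a ∈ Crit F K A) (hma : m < a) :
    ∃ m' ∈ Crit F K A, m < m' ∧ m' ≤ a ∧ NoCritBetween F K A m m' := by
  classical
  have hex : ∃ x, x ∈ Crit F K A ∧ m < x := ⟨a, ha, hma⟩
  exact ⟨Nat.find hex, (Nat.find_spec hex).1, (Nat.find_spec hex).2, Nat.find_min' hex ⟨ha, hma⟩,
    fun x hx hmx => Nat.find_min' hex ⟨hx, hmx⟩⟩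

theorem eq_of_forall_succ_eq {α : Type*} {f : ℕ → α} (hmm : m ≤ m')
    (h : ∀ x, m ≤ x → x < m' → f (x + 1) = f x) : f m' = f m := by
  induction m', hmm using Nat.le_induction with
  | base => rfl
  | succ n hn ih => rw [h n hn n.lt_succ_self, ih fun x hx hxn => h x hx (hxn.trans n.lt_succ_self)]

namespace NoCritBetween

theorem notMem {x : ℕ} (h : NoCritBetween F K A m m') (hmx : m < x) (hx : x < m') :
    x ∉ Crit F K A := fun hxc => absurd (h x hxc hmx) (not_le.2 hx)

theorem position_eq (h : NoCritBetween F K A m m') (hmm : m < m') (ha : a ∈ A) (hma : m' ≤ a) :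
    position K A m' a = position K A (m + 1) a :=
  eq_of_forall_succ_eq (f := fun x => position K A x a) hmm fun _ hmx hx =>
    have hnot := h.notMem hmx hx
    position_succ_of_noncritical (fun hA => hnot (subset_crit hA))
      (fun hs => hnot (sp_subset_crit hs)) ha (hx.trans_le hma)

theorem levelAge_eq (h : NoCritBetween F K A m m') (hmm : m < m') :
    levelAge F K A m' = levelAge F K A (m + 1) :=
  eq_of_forall_succ_eq hmm fun _ hmx hx =>
    have hnot := h.notMem hmx hx
    ((levelAge_eq_iff_stable (fun hA => hnot (subset_crit hA)) fun hs => hnot (sp_subset_crit hs)).2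
      (stable_of_notMem_crit hnot)).symm

end NoCritBetween

theorem nodeAge_cut_eq_of_forall_crit (ha : a ∈ A) (hmm : m ≤ m') (hma : m' ≤ a)
    (h : ∀ x ∈ Crit F K A, m ≤ x → m' ≤ x) :
    nodeAge F K (cut K a m') = nodeAge F K (cut K a m) :=
  eq_of_forall_succ_eq (f := fun x => nodeAge F K (cut K a x)) hmm fun x hmx hx =>
    (stable_of_notMem_crit fun hc => hx.not_ge (h x hc hmx)).nodeAge_eq ha (hx.trans_le hma)

theorem path_snd_eq (ha : a ∈ A) :
    (path F K a).2 = {C | ∃ m ∈ Crit F K A, m ≤ a ∧ C = nodeAge F K (cut K a m)} := by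
  classical
  ext C
  constructor
  · rintro ⟨m, hma, rfl⟩
    have hex : ∃ x, x ∈ Crit F K A ∧ m ≤ x := ⟨a, subset_crit ha, hma⟩
    obtain ⟨hcrit, hm⟩ := Nat.find_spec hex
    have hle : Nat.find hex ≤ a := Nat.find_min' hex ⟨subset_crit ha, hma⟩
    exact ⟨_, hcrit, hle, (nodeAge_cut_eq_of_forall_crit ha hm hle
      fun x hx hmx => Nat.find_min' hex ⟨hx, hmx⟩).symm⟩
  · rintro ⟨m, -, hma, rfl⟩
    exact ⟨m, hma, rfl⟩

end Consecutive

/-! ### Diary entries -/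

namespace Entry

/-- The age of the node at position `p`, read off from a diary entry. Like the two functions below,
it takes the position as a number, so that it applies to entries which are equal only
propositionally; positions out of range get a default value. -/
def nodeCls (E : Entry L) (p : ℕ) : AgeClass L 1 :=
  if h : p < E.size then E.cls.pull (fun _ => ⟨p, h⟩) else ∅

/-- The unary predicate of the node at position `p`, read off from a diary entry. -/
def sortAt (E : Entry L) (p : ℕ) : Option (Fin L.ku) :=
  if h : p < E.size then some (E.sort ⟨p, h⟩) else none

/-- The `p`-th passing number of a diary entry. -/
def passAt (E : Entry L) (p : ℕ) : Option (Fin L.k) :=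
  if h : p < E.size - 1 then some (E.pass ⟨p, h⟩) else none

end Entry

section Entries

variable {F : Set (FinStr L)} {K : Str L ℕ} {A : Set ℕ} {a m : ℕ}

theorem vec_position (ha : a ∈ A) (hma : m ≤ a) :
    vec (level K A m) ⟨position K A m a, position_lt_card ha hma⟩ = cut K a m := by
  obtain ⟨i, hi, hpos⟩ := (lists_vec (level K A m)).exists_index ha hma
  rw [← hi]
  exact congrArg _ (Fin.ext hpos.symm)

theorem entry_nodeCls (ha : a ∈ A) (hma : m ≤ a) :
    (entry F K A m).nodeCls (position K A m a) = nodeAge F K (cut K a m) := by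
  rw [nodeAge_cut hma, ← vec_position ha hma]
  refine (dif_pos (position_lt_card ha hma)).trans ?_
  ext ⟨n, D⟩
  exact (mem_age (B := D.relabel _)).trans (mem_age (B := D)
    (s := fun _ : Fin 1 => vec (level K A m) ⟨_, position_lt_card ha hma⟩)).symm

theorem entry_sortAt (ha : a ∈ A) (hma : m ≤ a) :
    (entry F K A m).sortAt (position K A m a) = some (K.U a) := by
  rw [← un_cut K a m, ← vec_position ha hma]
  exact dif_pos (position_lt_card ha hma)

theorem entry_pos_of_mem (hm : m ∈ A) : (entry F K A m).pos = position K A m m := by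
  simp only [entry, if_pos hm, position, rank, cut_self]

theorem entry_label_eq_cd_iff : (entry F K A m).label = .Cd ↔ m ∈ A := by
  simp only [entry]
  split_ifs <;> simp_all

theorem Lists.entry_eq {d : ℕ} {s : Fin d → Node L} (hs : Lists s (level K A m)) :
    (⟨(entry F K A m).size, (entry F K A m).sort, (entry F K A m).cls⟩ :
      Σ d, (Fin d → Fin L.ku) × AgeClass L d) = ⟨d, fun i => (s i).un, age F K m s⟩ := by
  obtain rfl := hs.card_eq
  rw [hs.unique (lists_vec _)]
  rfl

theorem entry_levelAge :
    (⟨(entry F K A m).size, (entry F K A m).cls⟩ : Σ d, AgeClass L d) = levelAge F K A m := rfl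

namespace WeaklyDiagonal

theorem entry_passAt (hA : WeaklyDiagonal F K A) (hm : m ∈ A) (ha : a ∈ A) (hma : m < a) :
    (entry F K A m).passAt (position K A (m + 1) a) = some (K.R a m) := by
  have hpos := position_lt_card (K := K) (m := m + 1) ha hma
  have hcard := card_level_succ_of_coding hm (hA.notMem_sp hm) (hA.cut_ne_code hm)
  have hlt : position K A (m + 1) a < (entry F K A m).size - 1 := hcard ▸ hpos
  rw [Entry.passAt, dif_pos hlt, ← val_cut hma m.lt_succ_self, ← vec_position ha hma]
  simp only [entry, if_pos hm, dif_pos hpos]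

theorem entry_pos_of_spNode (hA : WeaklyDiagonal F K A) {s : Node L} (hs : s ∈ SpNode K A)
    (hm : s.len = m) : (entry F K A m).pos = rank (level K A m) s := by
  classical
  have hsp : m ∈ Sp K A := ⟨s, hs, hm⟩
  have hmA : m ∉ A := fun h => hA.notMem_sp h hsp
  simp only [entry, if_neg hmA, if_pos hsp, rank]
  refine congrArg Finset.card (Finset.filter_congr fun u _ => ⟨fun h => h s hs hm, ?_⟩)
  intro h x hx hxm
  rwa [hA.spNode_unique hx hs (hxm.trans hm.symm)]

theorem entry_label_eq_sp_iff (hA : WeaklyDiagonal F K A) :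
    (entry F K A m).label = .sp ↔ m ∈ Sp K A := by
  have := hA.notMem_sp (m := m)
  simp only [entry]
  split_ifs <;> simp_all

end WeaklyDiagonal

end Entries

/-! ### Matchings of critical levels -/

/-- `T` is an increasing bijection between the critical levels of `A` and `B` under which the diary
entries agree. -/
structure Matching (F : Set (FinStr L)) (K : Str L ℕ) (A B : Set ℕ) (T : ℕ → ℕ → Prop) : Prop where
  left : ∀ {x y}, T x y → x ∈ Crit F K A
  right : ∀ {x y}, T x y → y ∈ Crit F K B
  exists_right : ∀ x ∈ Crit F K A, ∃ y, T x y
  exists_left : ∀ y ∈ Crit F K B, ∃ x, T x y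
  lt_iff : ∀ {x y x' y'}, T x y → T x' y' → (x < x' ↔ y < y')
  entry_eq : ∀ {x y}, T x y → entry F K A x = entry F K B y

namespace Matching

section Positions

variable {F : Set (FinStr L)} {K : Str L ℕ} {A B : Set ℕ} {T : ℕ → ℕ → Prop}
  {a α m μ m' μ' : ℕ}

theorem symm (hM : Matching F K A B T) : Matching F K B A fun y x => T x y where
  left := hM.right
  right := hM.left
  exists_right := hM.exists_left
  exists_left := hM.exists_right
  lt_iff h h' := (hM.lt_iff h h').symm
  entry_eq h := (hM.entry_eq h).symm

theorem le_iff (hM : Matching F K A B T) (h : T m μ) (h' : T m' μ') : m ≤ m' ↔ μ ≤ μ' := by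
  rw [← not_lt, ← not_lt, hM.lt_iff h' h]

theorem right_unique (hM : Matching F K A B T) (h : T m μ) (h' : T m μ') : μ = μ' :=
  le_antisymm ((hM.le_iff h h').1 le_rfl) ((hM.le_iff h' h).1 le_rfl)

theorem mem_iff (hM : Matching F K A B T) (h : T m μ) : m ∈ A ↔ μ ∈ B := by
  rw [← entry_label_eq_cd_iff (F := F) (K := K), hM.entry_eq h, entry_label_eq_cd_iff]

theorem sp_iff (hM : Matching F K A B T) (hA : WeaklyDiagonal F K A) (hB : WeaklyDiagonal F K B)
    (h : T m μ) : m ∈ Sp K A ↔ μ ∈ Sp K B := by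
  rw [← hA.entry_label_eq_sp_iff, hM.entry_eq h, hB.entry_label_eq_sp_iff]

theorem ac_of_ac (hM : Matching F K A B T) (hA : WeaklyDiagonal F K A) (hB : WeaklyDiagonal F K B)
    (h : T m μ) (hm : m ∈ AC F K A) : μ ∈ AC F K B := by
  rcases hM.right h with (hμ | hμ) | hμ
  · exact absurd ((hM.mem_iff h).2 hμ) (notMem_of_mem_AC hm)
  · exact absurd ((hM.sp_iff hA hB h).2 hμ) (notMem_sp_of_mem_AC hm)
  · exact hμ

theorem exists_right_of_mem (hM : Matching F K A B T) (ha : a ∈ A) : ∃ α ∈ B, T a α := by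
  obtain ⟨α, h⟩ := hM.exists_right a (subset_crit ha)
  exact ⟨α, (hM.mem_iff h).1 ha, h⟩

theorem exists_next (hM : Matching F K A B T) (haα : T a α) (h : T m μ) (hma : m < a) :
    ∃ m' μ', T m' μ' ∧ m < m' ∧ m' ≤ a ∧ μ < μ' ∧ μ' ≤ α ∧
      NoCritBetween F K A m m' ∧ NoCritBetween F K B μ μ' := by
  obtain ⟨m', hm', hmm, hm'a, hno⟩ := exists_next_crit (hM.left haα) hma
  obtain ⟨μ', h'⟩ := hM.exists_right m' hm'
  refine ⟨m', μ', h', hmm, hm'a, (hM.lt_iff h h').1 hmm, (hM.le_iff h' haα).1 hm'a, hno,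
    fun y hy hμy => ?_⟩
  obtain ⟨x, hx⟩ := hM.exists_left y hy
  exact (hM.le_iff h' hx).1 (hno x (hM.left hx) ((hM.lt_iff h hx).2 hμy))

theorem position_eq_of_position_succ_eq (hM : Matching F K A B T) (hA : WeaklyDiagonal F K A)
    (hB : WeaklyDiagonal F K B) (haα : T a α) (ha : a ∈ A) (h : T m μ) (hma : m < a)
    (hsucc : position K A (m + 1) a = position K B (μ + 1) α) :
    position K A m a = position K B μ α := by
  have hα := (hM.mem_iff haα).1 ha
  have hμα := (hM.lt_iff h haα).1 hma
  have hpos := congrArg Entry.pos (hM.entry_eq h)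
  rcases hM.left h with (hm | hm) | hm
  · have hμ := (hM.mem_iff h).1 hm
    rw [entry_pos_of_mem hm, entry_pos_of_mem hμ, position, position, cut_self, cut_self] at hpos
    rw [position_of_coding hm (hA.notMem_sp hm) (hA.cut_ne_code hm) ha hma,
      position_of_coding hμ (hB.notMem_sp hμ) (hB.cut_ne_code hμ) hα hμα, hsucc, hpos]
  · obtain ⟨s', hs', hsm'⟩ := (hM.sp_iff hA hB h).1 hm
    obtain ⟨s, hs, hsm⟩ := hm
    rw [hA.entry_pos_of_spNode hs hsm, hB.entry_pos_of_spNode hs' hsm'] at hpos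
    rw [(hA.position_of_spNode hs hsm ha hma).1, (hB.position_of_spNode hs' hsm' hα hμα).1, hsucc,
      hpos]
  · have hμ := hM.ac_of_ac hA hB h hm
    rwa [position_succ_of_noncritical (notMem_of_mem_AC hm) (notMem_sp_of_mem_AC hm) ha hma,
      position_succ_of_noncritical (notMem_of_mem_AC hμ) (notMem_sp_of_mem_AC hμ) hα hμα] at hsucc

theorem position_eq (hM : Matching F K A B T) (hA : WeaklyDiagonal F K A)
    (hB : WeaklyDiagonal F K B) (haα : T a α) (ha : a ∈ A) (h : T m μ) (hma : m ≤ a) :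
    position K A m a = position K B μ α := by
  have hα := (hM.mem_iff haα).1 ha
  induction hk : a - m using Nat.strong_induction_on generalizing m μ with
  | _ k ih =>
  rcases hma.eq_or_lt with rfl | hma
  · obtain rfl := hM.right_unique h haα
    rw [← entry_pos_of_mem (F := F) ha, hM.entry_eq h, entry_pos_of_mem hα]
  · obtain ⟨m', μ', h', hmm, hm'a, hμμ, hμ'α, hno, hno'⟩ := hM.exists_next haα h hma
    refine hM.position_eq_of_position_succ_eq hA hB haα ha h hma ?_
    rw [← hno.position_eq hmm ha hm'a, ← hno'.position_eq hμμ hα hμ'α]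
    exact ih (a - m') (by omega) h' hm'a rfl

theorem position_succ_eq (hM : Matching F K A B T) (hA : WeaklyDiagonal F K A)
    (hB : WeaklyDiagonal F K B) (haα : T a α) (ha : a ∈ A) (h : T m μ) (hma : m < a) :
    position K A (m + 1) a = position K B (μ + 1) α := by
  obtain ⟨m', μ', h', hmm, hm'a, hμμ, hμ'α, hno, hno'⟩ := hM.exists_next haα h hma
  rw [← hno.position_eq hmm ha hm'a, ← hno'.position_eq hμμ ((hM.mem_iff haα).1 ha) hμ'α]
  exact hM.position_eq hA hB haα ha h' hm'a

theorem U_eq (hM : Matching F K A B T) (hA : WeaklyDiagonal F K A)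
    (hB : WeaklyDiagonal F K B) (haα : T a α) (ha : a ∈ A) : K.U a = K.U α := by
  rw [← Option.some_inj, ← entry_sortAt (F := F) ha le_rfl,
    hM.position_eq hA hB haα ha haα le_rfl, hM.entry_eq haα,
    entry_sortAt ((hM.mem_iff haα).1 ha) le_rfl]

theorem nodeAge_eq (hM : Matching F K A B T) (hA : WeaklyDiagonal F K A)
    (hB : WeaklyDiagonal F K B) (haα : T a α) (ha : a ∈ A) (h : T m μ) (hma : m ≤ a) :
    nodeAge F K (cut K a m) = nodeAge F K (cut K α μ) := by
  rw [← entry_nodeCls ha hma, hM.position_eq hA hB haα ha h hma, hM.entry_eq h,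
    entry_nodeCls ((hM.mem_iff haα).1 ha) ((hM.le_iff h haα).1 hma)]

theorem nodeAge_succ_eq (hM : Matching F K A B T) (hA : WeaklyDiagonal F K A)
    (hB : WeaklyDiagonal F K B) (haα : T a α) (ha : a ∈ A) (h : T m μ) (hma : m < a) :
    nodeAge F K (cut K a (m + 1)) = nodeAge F K (cut K α (μ + 1)) := by
  obtain ⟨m', μ', h', hmm, hm'a, hμμ, hμ'α, hno, hno'⟩ := hM.exists_next haα h hma
  rw [← nodeAge_cut_eq_of_forall_crit ha hmm hm'a hno,
    ← nodeAge_cut_eq_of_forall_crit ((hM.mem_iff haα).1 ha) hμμ hμ'α hno']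
  exact hM.nodeAge_eq hA hB haα ha h' hm'a

theorem path_eq (hM : Matching F K A B T) (hA : WeaklyDiagonal F K A)
    (hB : WeaklyDiagonal F K B) (haα : T a α) (ha : a ∈ A) : path F K a = path F K α := by
  refine Prod.ext (hM.U_eq hA hB haα ha) ?_
  rw [path_snd_eq ha, path_snd_eq ((hM.mem_iff haα).1 ha)]
  ext C
  constructor
  · rintro ⟨m, hm, hma, rfl⟩
    obtain ⟨μ, h⟩ := hM.exists_right m hm
    exact ⟨μ, hM.right h, (hM.le_iff h haα).1 hma, hM.nodeAge_eq hA hB haα ha h hma⟩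
  · rintro ⟨μ, hμ, hμα, rfl⟩
    obtain ⟨m, h⟩ := hM.exists_left μ hμ
    have hma := (hM.le_iff h haα).2 hμα
    exact ⟨m, hM.left h, hma, (hM.nodeAge_eq hA hB haα ha h hma).symm⟩

theorem R_eq_of_mem (hM : Matching F K A B T) (hA : WeaklyDiagonal F K A)
    (hB : WeaklyDiagonal F K B) (haα : T a α) (ha : a ∈ A) (h : T m μ) (hm : m ∈ A)
    (hma : m < a) : K.R a m = K.R α μ := by
  rw [← Option.some_inj, ← hA.entry_passAt hm ha hma, hM.position_succ_eq hA hB haα ha h hma,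
    hM.entry_eq h, hB.entry_passAt ((hM.mem_iff h).1 hm) ((hM.mem_iff haα).1 ha)
      ((hM.lt_iff h haα).1 hma)]

theorem R_ne_zero_iff_of_mem_sp (hM : Matching F K A B T) (hA : WeaklyDiagonal F K A)
    (hB : WeaklyDiagonal F K B) (haα : T a α) (ha : a ∈ A) (h : T m μ) (hm : m ∈ Sp K A)
    (hma : m < a) : K.R a m ≠ 0 ↔ K.R α μ ≠ 0 := by
  obtain ⟨s', hs', hsm'⟩ := (hM.sp_iff hA hB h).1 hm
  obtain ⟨s, hs, hsm⟩ := hm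
  rw [(hA.position_of_spNode hs hsm ha hma).2,
    (hB.position_of_spNode hs' hsm' ((hM.mem_iff haα).1 ha) ((hM.lt_iff h haα).1 hma)).2,
    ← hA.entry_pos_of_spNode hs hsm, ← hB.entry_pos_of_spNode hs' hsm', hM.entry_eq h,
    hM.position_eq hA hB haα ha h hma.le, hM.position_succ_eq hA hB haα ha h hma]

end Positions

end Matching

/-! ### Matching start levels -/

section MatchingStarts

variable {F : Set (FinStr L)} {K : Str L ℕ} {ch : Choices F K} {A B : Set ℕ} {T : ℕ → ℕ → Prop}
  {a b α β m n μ ν r : ℕ}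

theorem Diagonal.start_lt_iff (hA : Diagonal ch A) (ha : a ∈ A) (hb : b ∈ A)
    (hfa : HasFree F K (K.U a)) (hfb : HasFree F K (K.U b)) (hm : IsStart K a m)
    (hn : IsStart K b n) :
    m < n ↔ K.U a < K.U b ∨ K.U a = K.U b ∧ ¬ ch.pathLE (path F K b) (path F K a) := by
  rcases lt_trichotomy (K.U a) (K.U b) with h | h | h
  · simp only [h, true_or, iff_true]
    exact hA.paths.free_sep a ha b hb hfa hfb h m n hm hn
  · simp only [h, lt_irrefl, false_or, true_and]
    rw [← hA.paths.free_order b hb a ha h.symm hfb n m hn hm, not_le]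
  · simp only [h.not_gt, h.ne', false_or, false_and, iff_false, not_lt]
    exact (hA.paths.free_sep b hb a ha hfb hfa h n m hn hm).le

theorem nodeAge_cut_eq_left_zero_iff (hF : ∀ M ∈ F, Irreducible M.2) (hK : Forb F K)
    (hr : IsStart K a r) (hfree : ¬ HasFree F K (K.U a)) (hm : m ≤ a) :
    nodeAge F K (cut K a m) = nodeAge F K (Node.left (K.U a) 0) ↔ m ≤ r := by
  obtain ⟨hra, -, hzero⟩ := isStart_iff.1 hr
  constructor
  · intro h
    by_contra! hlt
    refine nodeAge_cut_start_succ_ne hF hK hr hfree (Set.Subset.antisymm ?_ ?_)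
    · rw [← nodeAge_cut_of_forall_eq_zero hF hK hra.le hzero]
      exact nodeAge_cut_anti r.le_succ hra
    · rw [← h]
      exact nodeAge_cut_anti hlt hm
  · exact fun h => nodeAge_cut_of_forall_eq_zero hF hK hm fun x hx => hzero x (hx.trans_le h)

theorem IsStart.splitAt (hm : IsStart K a m) (hn : IsStart K b n) (hmn : m < n)
    (hU : K.U a = K.U b) : SplitAt K a b m := by
  obtain ⟨hma, hR, hzero⟩ := isStart_iff.1 hm
  obtain ⟨hnb, -, hzero'⟩ := isStart_iff.1 hn
  refine ⟨hma, hmn.trans hnb, (cut_eq_cut_iff hma.le (hmn.trans hnb).le).2 ⟨hU, fun r hr => ?_⟩, ?_⟩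
  · rw [hzero r hr, hzero' r (hr.trans hmn)]
  · rwa [hzero' m hmn]

theorem WeaklyDiagonal.exists_isStart_gt (hA : WeaklyDiagonal F K A) (hm : m ∈ Sp K A) (hb : b ∈ A)
    (hstart : IsStart K b m) : ∃ c ∈ A, ∃ n, K.U c = K.U b ∧ IsStart K c n ∧ m < n := by
  obtain ⟨hmb, -, hzero⟩ := isStart_iff.1 hstart
  obtain ⟨c, hc, hmc, hcut, hc0⟩ := hA.exists_eq_zero hm hb hmb.le
  obtain ⟨hU, hagree⟩ := (cut_eq_cut_iff hmc.le hmb.le).1 hcut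
  obtain ⟨n, hn⟩ := hA.exists_start c hc
  refine ⟨c, hc, n, hU, hn, not_le.1 fun hnm => (isStart_iff.1 hn).2.1 ?_⟩
  rcases hnm.eq_or_lt with rfl | hlt
  · exact hc0
  · exact (hagree n hlt).trans (hzero n hlt)

namespace Matching

theorem exists_isStart_of_not_hasFree (hM : Matching F K A B T) (hF : ∀ M ∈ F, Irreducible M.2)
    (hK : Forb F K) (hA : Diagonal ch A) (hB : Diagonal ch B) (haα : T a α) (ha : a ∈ A)
    (hfree : ¬ HasFree F K (K.U a)) (hm : IsStart K a m) : ∃ μ, T m μ ∧ IsStart K α μ := by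
  have hα := (hM.mem_iff haα).1 ha
  have hU := hM.U_eq hA.weak hB.weak haα ha
  have hfree' : ¬ HasFree F K (K.U α) := hU ▸ hfree
  obtain ⟨μ, h⟩ := hM.exists_right m (hm.mem_crit hF hK ha hfree)
  obtain ⟨ν, hν⟩ := hB.weak.exists_start α hα
  obtain ⟨n, h'⟩ := hM.exists_left ν (hν.mem_crit hF hK hα hfree')
  have hma : m < a := (isStart_iff.1 hm).1
  have hνα : ν < α := (isStart_iff.1 hν).1
  have hna : n < a := (hM.lt_iff h' haα).2 hνα
  have hμν : μ ≤ ν := by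
    rw [← nodeAge_cut_eq_left_zero_iff hF hK hν hfree' ((hM.lt_iff h haα).1 hma).le,
      ← hM.nodeAge_eq hA.weak hB.weak haα ha h hma.le, ← hU]
    exact (nodeAge_cut_eq_left_zero_iff hF hK hm hfree hma.le).2 le_rfl
  have hnm : n ≤ m := by
    rw [← nodeAge_cut_eq_left_zero_iff hF hK hm hfree hna.le,
      hM.nodeAge_eq hA.weak hB.weak haα ha h' hna.le, hU]
    exact (nodeAge_cut_eq_left_zero_iff hF hK hν hfree' hνα.le).2 le_rfl
  obtain rfl := hμν.antisymm ((hM.le_iff h' h).1 hnm)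
  exact ⟨μ, h, hν⟩

theorem start_lt_iff (hM : Matching F K A B T) (hA : Diagonal ch A) (hB : Diagonal ch B)
    (haα : T a α) (hbβ : T b β) (ha : a ∈ A) (hb : b ∈ A) (hfa : HasFree F K (K.U a))
    (hfb : HasFree F K (K.U b)) (hm : IsStart K a m) (hn : IsStart K b n) (hμ : IsStart K α μ)
    (hν : IsStart K β ν) : m < n ↔ μ < ν := by
  have hUa := hM.U_eq hA.weak hB.weak haα ha
  have hUb := hM.U_eq hA.weak hB.weak hbβ hb
  rw [hA.start_lt_iff ha hb hfa hfb hm hn, hB.start_lt_iff ((hM.mem_iff haα).1 ha)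
    ((hM.mem_iff hbβ).1 hb) (hUa ▸ hfa) (hUb ▸ hfb) hμ hν, hUa, hUb,
    hM.path_eq hA.weak hB.weak haα ha, hM.path_eq hA.weak hB.weak hbβ hb]

theorem start_mem_sp (hM : Matching F K A B T) (hA : Diagonal ch A) (hB : Diagonal ch B)
    (hbβ : T b β) (hb : b ∈ A) (hfree : HasFree F K (K.U b)) (hm : IsStart K b m)
    (hsp : m ∈ Sp K A) (hν : IsStart K β ν) : ν ∈ Sp K B := by
  obtain ⟨c, hc, n, hU, hn, hmn⟩ := hA.weak.exists_isStart_gt hsp hb hm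
  obtain ⟨γ, hγ, hcγ⟩ := hM.exists_right_of_mem hc
  obtain ⟨l, hl⟩ := hB.weak.exists_start γ hγ
  have hνl : ν < l := (hM.start_lt_iff hA hB hbβ hcγ hb hc hfree (hU ▸ hfree) hm hn hν hl).1 hmn
  have hUβγ : K.U β = K.U γ := by
    rw [← hM.U_eq hA.weak hB.weak hbβ hb, ← hM.U_eq hA.weak hB.weak hcγ hc, hU]
  exact mem_sp.2 ⟨β, (hM.mem_iff hbβ).1 hb, γ, hγ, hν.splitAt hl hνl hUβγ⟩

theorem isStart_of_hasFree (hM : Matching F K A B T) (hF : ∀ M ∈ F, Irreducible M.2)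
    (hK : Forb F K) (hA : Diagonal ch A) (hB : Diagonal ch B) (hb : b ∈ A)
    (hfree : HasFree F K (K.U b)) (hm : IsStart K b m) (h : T m μ) (hbβ : T b β) :
    IsStart K β μ := by
  induction m using Nat.strong_induction_on generalizing b β μ with
  | _ m ih =>
  have hmF : m ∈ FreeStart F K A := ⟨b, hb, hfree, hm⟩
  have hsp := hA.mem_sp_of_mem_freeStart hF hK hmF (hM.left h)
  obtain ⟨hmb, hR, -⟩ := isStart_iff.1 hm
  obtain ⟨ν, hν⟩ := hB.weak.exists_start β ((hM.mem_iff hbβ).1 hb)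
  have hβμ : K.R β μ ≠ 0 :=
    (hM.R_ne_zero_iff_of_mem_sp hA.weak hB.weak hbβ hb h hsp hmb).1 hR
  have hνμ : ν ≤ μ := not_lt.1 fun hlt => hβμ ((isStart_iff.1 hν).2.2 μ hlt)
  rcases hνμ.eq_or_lt with rfl | hlt
  · exact hν
  obtain ⟨x, hx⟩ :=
    hM.exists_left ν (sp_subset_crit (hM.start_mem_sp hA hB hbβ hb hfree hm hsp hν))
  have hxm : x < m := (hM.lt_iff hx h).2 hlt
  obtain ⟨c, hc, hfc, hcx⟩ :=
    hA.weak.freeStart_initial x (crit_subset_critPlus (hM.left hx)) m hmF hxm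
  obtain ⟨γ, -, hcγ⟩ := hM.exists_right_of_mem hc
  have hγν := ih x hxm hc hfc hcx hx hcγ
  exact absurd ((hM.start_lt_iff hA hB hcγ hbβ hc hb hfc hfree hcx hm hγν hν).1 hxm)
    (lt_irrefl ν)

end Matching

end MatchingStarts

/-! ### Matching age-change levels -/

section MatchingAgeChanges

variable {F : Set (FinStr L)} {K : Str L ℕ} {ch : Choices F K} {A B : Set ℕ} {T : ℕ → ℕ → Prop}
  {a m μ : ℕ}

theorem exists_gt_of_mem_AC (hF : ∀ M ∈ F, Irreducible M.2) (hK : Forb F K) (hm : m ∈ AC F K A) :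
    ∃ a ∈ A, m < a := by
  by_contra! hle
  refine (mem_AC.1 hm).2.2 fun V _ M f hf _ => forb_of_forall_clique hF fun S _ =>
    ⟨_, _, Sum.inl, hK.initial (m + 1), isEmb_inl _ _ _, ?_⟩
  rintro (x | b) -
  · exact ⟨x, rfl⟩
  · exact absurd (hf b).2.1 (hle _ (hf b).1).not_gt

theorem exists_eq_of_range_eq_nbhd {n : ℕ} {φ φ' : Fin n → ℕ} (hφ : StrictMono φ)
    (hφ' : StrictMono φ') (hr : Set.range φ = nbhd K m) (hr' : Set.range φ' = nbhd K μ) :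
    ∃ z, φ z = m ∧ φ' z = μ := by
  obtain ⟨z, hz⟩ : m ∈ Set.range φ := hr.symm.subset (.inl rfl)
  obtain ⟨z', hz'⟩ : μ ∈ Set.range φ' := hr'.symm.subset (.inl rfl)
  have hle : z ≤ z' := hφ'.le_iff_le.1 (hz'.symm ▸ le_of_mem_nbhd (hr'.subset ⟨z, rfl⟩))
  have hge : z' ≤ z := hφ.le_iff_le.1 (hz.symm ▸ le_of_mem_nbhd (hr.subset ⟨z', rfl⟩))
  exact ⟨z, hz, hle.antisymm hge ▸ hz'⟩

namespace Matching

theorem levelAge_succ_eq (hM : Matching F K A B T) (ha : a ∈ A) (hma : m < a) (h : T m μ) :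
    levelAge F K A (m + 1) = levelAge F K B (μ + 1) := by
  obtain ⟨α, -, haα⟩ := hM.exists_right_of_mem ha
  obtain ⟨m', μ', h', hmm, -, hμμ, -, hno, hno'⟩ := hM.exists_next haα h hma
  rw [← hno.levelAge_eq hmm, ← hno'.levelAge_eq hμμ, ← entry_levelAge, ← entry_levelAge,
    hM.entry_eq h']

theorem exists_realised (hM : Matching F K A B T) (hF : ∀ M ∈ F, Irreducible M.2) (hK : Forb F K)
    (hA : Diagonal ch A) (hB : Diagonal ch B) (h : T m μ) (hm : m ∈ AC F K A) :
    ∃ (d d₀ : ℕ) (s t s' t' : Fin d → Node L) (e : Fin d₀ → Fin d) (ζ : Gluing L d₀)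
      (φ φ' : Fin ζ.size → ℕ), Realised ch A m s t e ζ φ ∧ Realised ch B μ s' t' e ζ φ' ∧
        (fun i => (s i).un) = fun i => (s' i).un := by
  have hμ := hM.ac_of_ac hA.weak hB.weak h hm
  obtain ⟨d, d₀, s, t, e, ζ, φ, hr⟩ := hA.exists_realised hF hm
  obtain ⟨d', d₁, s', t', e', ζ', φ', hr'⟩ := hB.exists_realised hF hμ
  obtain ⟨a, ha, hma⟩ := exists_gt_of_mem_AC hF hK hm
  have hentry : (⟨d, fun i => (s i).un, age F K m s⟩ : Σ d, (Fin d → Fin L.ku) × AgeClass L d) =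
      ⟨d', fun i => (s' i).un, age F K μ s'⟩ := by
    rw [← hr.lists.entry_eq, ← hr'.lists.entry_eq, hM.entry_eq h]
  have hlevel : (⟨d, age F K (m + 1) t⟩ : Σ d, AgeClass L d) = ⟨d', age F K (μ + 1) t'⟩ := by
    rw [← levelAge_eq hr.lists_succ, ← levelAge_eq hr'.lists_succ, hM.levelAge_succ_eq ha hma h]
  obtain rfl : d = d' := congrArg Sigma.fst hentry
  obtain ⟨hsort, hage⟩ := Prod.mk.inj (eq_of_heq (Sigma.mk.inj hentry).2)
  have hage_succ := eq_of_heq (Sigma.mk.inj hlevel).2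
  obtain ⟨rfl, he⟩ := hr.index_unique hF hm hr' hμ hsort hage hage_succ
  obtain rfl : e = e' := he
  obtain rfl : ζ = ζ' := by
    rw [← hr.cause_eq, ← hr'.cause_eq, hsort, hage, hage_succ]
  exact ⟨_, _, s, t, s', t', e, ζ, φ, φ', hr, hr', hsort⟩

theorem exists_nbhd (hM : Matching F K A B T) (hF : ∀ M ∈ F, Irreducible M.2) (hK : Forb F K)
    (hA : Diagonal ch A) (hB : Diagonal ch B) (h : T m μ) (hm : m ∈ AC F K A) :
    ∃ (n : ℕ) (I : Str L (Fin n)) (φ φ' : Fin n → ℕ), StrictMono φ ∧ StrictMono φ' ∧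
      Set.range φ = nbhd K m ∧ Set.range φ' = nbhd K μ ∧ IsEmb φ I K ∧ IsEmb φ' I K ∧
      ∀ a ∈ A, ∀ α, T a α → m < a → ∀ x, K.R a (φ x) = K.R α (φ' x) := by
  obtain ⟨d, d₀, s, t, s', t', e, ζ, φ, φ', hr, hr', hsort⟩ := hM.exists_realised hF hK hA hB h hm
  refine ⟨_, _, φ, φ', hr.mono, hr'.mono, hr.range_eq, hr'.range_eq, hr.isEmb, hr'.isEmb, ?_⟩
  intro a ha α haα hma x
  have hα := (hM.mem_iff haα).1 ha
  have hμα := (hM.lt_iff h haα).1 hma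
  obtain ⟨j, hj, hpos⟩ := hr.lists_succ.exists_index ha hma
  obtain ⟨i, hi, hpos'⟩ := hr'.lists_succ.exists_index hα hμα
  obtain rfl : i = j :=
    Fin.ext (by rw [hpos', hpos, hM.position_succ_eq hA.weak hB.weak haα ha h hma])
  rw [← val_cut hma (Nat.lt_succ_of_le (hr.le x)), ← hj, hr.att, hsort,
    ← val_cut hμα (Nat.lt_succ_of_le (hr'.le x)), ← hi, hr'.att]

end Matching

end MatchingAgeChanges

/-! ### Matching splitting levels -/

section MatchingSplittings

variable {F : Set (FinStr L)} {K : Str L ℕ} {ch : Choices F K} {A B : Set ℕ} {T : ℕ → ℕ → Prop}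
  {a α m μ r : ℕ} {q : Fin L.k}

theorem pointGluing_inj {i j j' : Fin L.ku} {q' : Fin L.k}
    (h : pointGluing i q j = pointGluing i q' j') : q = q' ∧ j = j' := by
  simp only [pointGluing, Gluing.mk.injEq, heq_eq_eq, true_and, Str.mk.injEq, and_true] at h
  exact ⟨congrFun (congrFun h.1 0) 0, congrFun h.2 0⟩

theorem isStart_of_isStart_cut (hma : m ≤ a) (h : (cut K a m).IsStart r) :
    r < m ∧ IsStart K a r := by
  obtain ⟨hr, hne, hzero⟩ := h
  rw [len_cut hma] at hr
  rw [val_cut hma hr] at hne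
  refine ⟨hr, isStart_iff.2 ⟨hr.trans_le hma, hne, fun x hx => ?_⟩⟩
  rw [← val_cut hma (hx.trans hr), hzero x hx]

theorem WeaklyDiagonal.R_eq_of_succ_mem_level (hA : WeaklyDiagonal F K A) (hm : m ∈ Sp K A)
    (ha : a ∈ A) (hma : m < a) (hR : K.R a m ≠ 0) (hq : q ≠ 0)
    (h : (cut K a m).succ q ∈ level K A (m + 1)) : K.R a m = q := by
  obtain ⟨b, hb, hmb, h⟩ := mem_level.1 h
  rw [cut_succ hmb, Node.succ_inj] at h
  rw [h.2] at hq ⊢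
  exact hA.R_eq_of_ne_zero hm ha hb hma hmb hR hq

theorem Diagonal.splitting_of_ne_zero (hA : Diagonal ch A) (hm : m ∈ Sp K A) (ha : a ∈ A)
    (hma : m < a) (hR : K.R a m ≠ 0) :
    (HasFree F K (K.U a) → K.U m = (ch.free (K.U a)).2 ∧ K.R a m = (ch.free (K.U a)).1) ∧
    (¬ HasFree F K (K.U a) → ∀ r, IsStart K a r → r < m → K.U m = K.U r ∧ K.R a m = K.R a r) ∧
    (¬ HasFree F K (K.U a) → IsStart K a m →
      ch.cause (sort1 (K.U a)) (nodeAge F K (cut K a m)) (nodeAge F K (cut K a (m + 1))) =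
        pointGluing (K.U a) (K.R a m) (K.U m)) := by
  obtain ⟨d, s, t, hs, ht, i, hi, hfree, hlate, hfirst⟩ := hA.splitting m hm
  have hlen : (s i).len = m := by
    obtain ⟨b, -, hb, h⟩ := mem_level.1 (hs.mem i)
    rw [h, len_cut hb]
  have hcut : s i = cut K a m := (hA.weak.cut_eq_of_ne_zero hi hlen ha hma hR).symm
  have hR_eq {q : Fin L.k} (hq : q ≠ 0) (htq : t i.succ = (cut K a m).succ q) : K.R a m = q :=
    hA.weak.R_eq_of_succ_mem_level hm ha hma hR hq (htq ▸ ht.mem i.succ)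
  rw [hcut, un_cut] at hfree hlate hfirst
  refine ⟨fun h => ?_, fun h r hr hrm => ?_, fun h hm => ?_⟩
  · obtain ⟨hcode, ht'⟩ := hfree h
    exact ⟨((code_eq_left_iff _).1 hcode).1, hR_eq (ch.free_spec _ h).1 ht'⟩
  · have hne : cut K a m ≠ Node.left (K.U a) m := fun h =>
      (isStart_iff.1 hr).2.1 (((cut_eq_left_iff hma.le _).1 h).2 r hrm)
    obtain ⟨r', hr', hcode, ht'⟩ := hlate h hne
    obtain rfl := hr.unique (isStart_of_isStart_cut hma.le hr').2
    rw [← val_cut hma.le hrm]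
    exact ⟨((code_eq_left_iff _).1 hcode).1, hR_eq hr'.2.1 ht'⟩
  · have hleft : cut K a m = Node.left (K.U a) m :=
      (cut_eq_left_iff hma.le _).2 ⟨rfl, (isStart_iff.1 hm).2.2⟩
    obtain ⟨-, q, j, hq, ht', hcause, hcode⟩ := hfirst h hleft
    rw [← hR_eq hq ht', ← cut_succ hma] at hcause
    rw [hcause, ((code_eq_left_iff _).1 hcode).1]

/-- `m` and `μ` have the same unary predicate, and the same relations to all later pairs of vertices
matched by `T`. -/
def Similar (K : Str L ℕ) (A : Set ℕ) (T : ℕ → ℕ → Prop) (m μ : ℕ) : Prop :=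
  K.U m = K.U μ ∧ ∀ a ∈ A, ∀ α, T a α → m < a → K.R a m = K.R α μ

namespace Matching

theorem similar_of_mem (hM : Matching F K A B T) (hA : WeaklyDiagonal F K A)
    (hB : WeaklyDiagonal F K B) (h : T m μ) (hm : m ∈ A) : Similar K A T m μ :=
  ⟨hM.U_eq hA hB h hm, fun _ ha _ haα hma => hM.R_eq_of_mem hA hB haα ha h hm hma⟩

theorem similar_of_mem_AC (hM : Matching F K A B T) (hF : ∀ M ∈ F, Irreducible M.2)
    (hK : Forb F K) (hA : Diagonal ch A) (hB : Diagonal ch B) (h : T m μ) (hm : m ∈ AC F K A) :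
    Similar K A T m μ := by
  obtain ⟨n, I, φ, φ', hφ, hφ', hr, hr', he, he', hR⟩ := hM.exists_nbhd hF hK hA hB h hm
  obtain ⟨z, rfl, rfl⟩ := exists_eq_of_range_eq_nbhd hφ hφ' hr hr'
  exact ⟨(he.2.1 z).trans (he'.2.1 z).symm, fun a ha α haα hma => hR a ha α haα hma z⟩

theorem eq_of_sp_of_ne_zero (hM : Matching F K A B T) (hF : ∀ M ∈ F, Irreducible M.2)
    (hK : Forb F K) (hA : Diagonal ch A) (hB : Diagonal ch B) (h : T m μ) (hm : m ∈ Sp K A)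
    (ih : ∀ r ρ, T r ρ → r < m → Similar K A T r ρ) (ha : a ∈ A) (haα : T a α) (hma : m < a)
    (hR : K.R a m ≠ 0) : K.U m = K.U μ ∧ K.R a m = K.R α μ := by
  have hU := hM.U_eq hA.weak hB.weak haα ha
  have hR' := (hM.R_ne_zero_iff_of_mem_sp hA.weak hB.weak haα ha h hm hma).1 hR
  obtain ⟨hfree, hlate, hfirst⟩ := hA.splitting_of_ne_zero hm ha hma hR
  obtain ⟨hfree', hlate', hfirst'⟩ := hB.splitting_of_ne_zero
    ((hM.sp_iff hA.weak hB.weak h).1 hm) ((hM.mem_iff haα).1 ha) ((hM.lt_iff h haα).1 hma) hR'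
  rw [← hU] at hfree' hlate' hfirst'
  by_cases hf : HasFree F K (K.U a)
  · exact ⟨(hfree hf).1.trans (hfree' hf).1.symm, (hfree hf).2.trans (hfree' hf).2.symm⟩
  obtain ⟨r, hr⟩ := hA.weak.exists_start a ha
  obtain ⟨ρ, hrρ, hρ⟩ := hM.exists_isStart_of_not_hasFree hF hK hA hB haα ha hf hr
  obtain ⟨hra, -, hzero⟩ := isStart_iff.1 hr
  rcases lt_trichotomy r m with hrm | rfl | hmr
  · obtain ⟨hU_eq, hR_eq⟩ := ih r ρ hrρ hrm
    obtain ⟨hU₁, hR₁⟩ := hlate hf r hr hrm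
    obtain ⟨hU₂, hR₂⟩ := hlate' hf ρ hρ ((hM.lt_iff hrρ h).1 hrm)
    rw [hU₁, hU₂, hR₁, hR₂]
    exact ⟨hU_eq, hR_eq a ha α haα hra⟩
  · obtain rfl := hM.right_unique h hrρ
    have hcause := hfirst hf hr
    rw [hM.nodeAge_eq hA.weak hB.weak haα ha h hma.le,
      hM.nodeAge_succ_eq hA.weak hB.weak haα ha h hma, hfirst' hf hρ] at hcause
    exact (pointGluing_inj hcause).symm.imp Eq.symm Eq.symm
  · exact absurd (hzero m hmr) hR

theorem similar_of_mem_sp (hM : Matching F K A B T) (hF : ∀ M ∈ F, Irreducible M.2)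
    (hK : Forb F K) (hA : Diagonal ch A) (hB : Diagonal ch B) (h : T m μ) (hm : m ∈ Sp K A)
    (ih : ∀ r ρ, T r ρ → r < m → Similar K A T r ρ) : Similar K A T m μ := by
  constructor
  · obtain ⟨s, hs, hsm⟩ := hm
    obtain ⟨a, ha, hma, -, hR⟩ := exists_ne_zero_of_mem_spNode hs hsm
    obtain ⟨α, -, haα⟩ := hM.exists_right_of_mem ha
    exact (hM.eq_of_sp_of_ne_zero hF hK hA hB h ⟨s, hs, hsm⟩ ih ha haα hma hR).1
  · intro a ha α haα hma
    by_cases hR : K.R a m = 0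
    · have hiff := hM.R_ne_zero_iff_of_mem_sp hA.weak hB.weak haα ha h hm hma
      rw [hR, not_not.1 (mt hiff.2 (not_not.2 hR))]
    · exact (hM.eq_of_sp_of_ne_zero hF hK hA hB h hm ih ha haα hma hR).2

theorem similar (hM : Matching F K A B T) (hF : ∀ M ∈ F, Irreducible M.2) (hK : Forb F K)
    (hA : Diagonal ch A) (hB : Diagonal ch B) (h : T m μ) : Similar K A T m μ := by
  induction m using Nat.strong_induction_on generalizing μ with
  | _ m ih =>
  rcases hM.left h with (hm | hm) | hm
  · exact hM.similar_of_mem hA.weak hB.weak h hm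
  · exact hM.similar_of_mem_sp hF hK hA hB h hm fun r ρ hrρ hrm => ih r hrm hrρ
  · exact hM.similar_of_mem_AC hF hK hA hB h hm

end Matching

end MatchingSplittings

/-! ### Matchings of hulls -/

/-- The extension of a matching of critical levels to the free start levels: those of matched
vertices correspond. -/
def LevelMatch (F : Set (FinStr L)) (K : Str L ℕ) (A : Set ℕ) (T : ℕ → ℕ → Prop) (m μ : ℕ) : Prop :=
  T m μ ∨ ∃ a α, T a α ∧ a ∈ A ∧ HasFree F K (K.U a) ∧ IsStart K a m ∧ IsStart K α μ

open Classical in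
/-- The vertices which the level `m` contributes to `hull F K A`. -/
def block (F : Set (FinStr L)) (K : Str L ℕ) (A : Set ℕ) (m : ℕ) : Set ℕ :=
  if m ∈ AC F K A then nbhd K m else {m}

open Classical in
/-- The extension of a matching of critical levels to the hulls: vertices of the same index in the
blocks of corresponding levels correspond. -/
def HullMatch (F : Set (FinStr L)) (K : Str L ℕ) (A B : Set ℕ) (T : ℕ → ℕ → Prop)
    (x y : ℕ) : Prop :=
  ∃ m μ, LevelMatch F K A T m μ ∧ x ∈ block F K A m ∧ y ∈ block F K B μ ∧
    Nat.count (· ∈ block F K A m) x = Nat.count (· ∈ block F K B μ) y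

/-- The vertices of the hull of `A` which correspond to vertices in the closure of `B`. -/
def clPreimage (F : Set (FinStr L)) (K : Str L ℕ) (A B : Set ℕ) (T : ℕ → ℕ → Prop) : Set ℕ :=
  {x | ∃ y ∈ cl F K B, HullMatch F K A B T x y}

/-- Diagonal sets, with a matching of their critical levels. -/
structure Matched {F : Set (FinStr L)} {K : Str L ℕ} (ch : Choices F K) (A B : Set ℕ)
    (T : ℕ → ℕ → Prop) : Prop where
  irreducible : ∀ M ∈ F, Irreducible M.2
  forb : Forb F K
  fst : Diagonal ch A
  snd : Diagonal ch B
  matching : Matching F K A B T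

section Blocks

variable {F : Set (FinStr L)} {K : Str L ℕ} {ch : Choices F K} {A : Set ℕ} {c m x : ℕ}

theorem count_of_range_eq {n : ℕ} {φ : Fin n → ℕ} (hφ : StrictMono φ) {Y : Set ℕ}
    [DecidablePred (· ∈ Y)] (h : Set.range φ = Y) (z : Fin n) : Nat.count (· ∈ Y) (φ z) = z := by
  subst h
  rw [Nat.count_eq_card_filter_range, ← Fin.card_Iio z,
    ← Finset.card_image_of_injective _ hφ.injective]
  congr 1
  ext x
  simp only [Finset.mem_filter, Finset.mem_range, Set.mem_range, Finset.mem_image, Finset.mem_Iio]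
  constructor
  · rintro ⟨hx, y, rfl⟩
    exact ⟨y, hφ.lt_iff_lt.1 hx, rfl⟩
  · rintro ⟨y, hy, rfl⟩
    exact ⟨hφ hy, y, rfl⟩

theorem block_of_mem_AC (hm : m ∈ AC F K A) : block F K A m = nbhd K m := if_pos hm

theorem block_of_notMem_AC (hm : m ∉ AC F K A) : block F K A m = {m} := if_neg hm

theorem count_block_self [DecidablePred (· ∈ block F K A m)] (hm : m ∉ AC F K A) :
    Nat.count (· ∈ block F K A m) m = 0 :=
  count_of_range_eq (φ := fun _ : Fin 1 => m) (Subsingleton.strictMono _)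
    (by rw [block_of_notMem_AC hm, Set.range_const]) 0

theorem le_of_mem_block (hx : x ∈ block F K A m) : x ≤ m := by
  by_cases hm : m ∈ AC F K A
  · exact le_of_mem_nbhd (block_of_mem_AC hm ▸ hx)
  · rw [block_of_notMem_AC hm] at hx
    exact hx.le

theorem Diagonal.eq_of_mem_block (hF : ∀ M ∈ F, Irreducible M.2) (hA : Diagonal ch A)
    (hx : x ∈ block F K A m) (hc : c ∈ CritPlus F K A) (hxc : x ≤ c) (hcm : c ≤ m) : c = m := by
  by_cases hm : m ∈ AC F K A
  · exact hA.eq_of_mem_critPlus hF hm (block_of_mem_AC hm ▸ hx) hc hxc hcm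
  · rw [block_of_notMem_AC hm] at hx
    exact hcm.antisymm (hx ▸ hxc)

theorem Diagonal.notMem_AC_of_mem_freeStart (hF : ∀ M ∈ F, Irreducible M.2) (hK : Forb F K)
    (hA : Diagonal ch A) (hm : m ∈ FreeStart F K A) : m ∉ AC F K A :=
  fun h => (mem_AC.1 h).2.2 (hA.stable_of_mem_freeStart hF hK hm)

end Blocks

namespace Matched

section Levels

variable {F : Set (FinStr L)} {K : Str L ℕ} {ch : Choices F K} {A B : Set ℕ} {T : ℕ → ℕ → Prop}
  {a α m μ m' μ' : ℕ}

theorem symm (H : Matched ch A B T) : Matched ch B A fun y x => T x y :=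
  ⟨H.irreducible, H.forb, H.snd, H.fst, H.matching.symm⟩

theorem U_eq (H : Matched ch A B T) (h : T a α) (ha : a ∈ A) : K.U a = K.U α :=
  H.matching.U_eq H.fst.weak H.snd.weak h ha

theorem levelMatch_symm (H : Matched ch A B T) (h : LevelMatch F K A T m μ) :
    LevelMatch F K B (fun y x => T x y) μ m := by
  rcases h with h | ⟨a, α, haα, ha, hfree, hs, hs'⟩
  · exact .inl h
  · exact .inr ⟨α, a, haα, (H.matching.mem_iff haα).1 ha, H.U_eq haα ha ▸ hfree, hs', hs⟩

theorem mem_critPlus (H : Matched ch A B T) (h : LevelMatch F K A T m μ) :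
    m ∈ CritPlus F K A := by
  rcases h with h | ⟨a, α, -, ha, -, hs, -⟩
  · exact crit_subset_critPlus (H.matching.left h)
  · exact hs.mem_critPlus ha

theorem rel_and_mem_AC (H : Matched ch A B T) (h : LevelMatch F K A T m μ) (hm : m ∈ AC F K A) :
    T m μ ∧ μ ∈ AC F K B := by
  rcases h with h | ⟨a, α, -, ha, hfree, hs, -⟩
  · exact ⟨h, H.matching.ac_of_ac H.fst.weak H.snd.weak h hm⟩
  · exact absurd hm (H.fst.notMem_AC_of_mem_freeStart H.irreducible H.forb ⟨a, ha, hfree, hs⟩)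

theorem notMem_AC (H : Matched ch A B T) (h : LevelMatch F K A T m μ) (hm : m ∉ AC F K A) :
    μ ∉ AC F K B :=
  fun hμ => hm (H.symm.rel_and_mem_AC (H.levelMatch_symm h) hμ).2

theorem lt_start_of_lt (H : Matched ch A B T) (h : T m μ) (haα : T a α) (ha : a ∈ A)
    (hfree : HasFree F K (K.U a)) (hs : IsStart K a m') (hs' : IsStart K α μ') (hlt : m < m') :
    μ < μ' := by
  obtain ⟨b, hb, hfb, hbs⟩ := H.fst.weak.freeStart_initial m
    (crit_subset_critPlus (H.matching.left h)) m' ⟨a, ha, hfree, hs⟩ hlt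
  obtain ⟨β, -, hbβ⟩ := H.matching.exists_right_of_mem hb
  have hβs := H.matching.isStart_of_hasFree H.irreducible H.forb H.fst H.snd hb hfb hbs h hbβ
  exact (H.matching.start_lt_iff H.fst H.snd hbβ haα hb ha hfb hfree hbs hs hβs hs').1 hlt

theorem start_lt_of_lt (H : Matched ch A B T) (h : T m μ) (haα : T a α) (ha : a ∈ A)
    (hfree : HasFree F K (K.U a)) (hs : IsStart K a m') (hs' : IsStart K α μ') (hlt : m' < m) :
    μ' < μ := by
  have hα := (H.matching.mem_iff haα).1 ha
  have hfree' := H.U_eq haα ha ▸ hfree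
  by_contra! hle
  rcases hle.eq_or_lt with rfl | hle
  · exact hlt.ne (hs.unique (H.symm.matching.isStart_of_hasFree H.irreducible H.forb H.snd H.fst
      hα hfree' hs' h haα))
  · exact hlt.not_gt (H.symm.lt_start_of_lt h haα hα hfree' hs' hs hle)

theorem levelMatch_lt (H : Matched ch A B T) (h : LevelMatch F K A T m μ)
    (h' : LevelMatch F K A T m' μ') (hlt : m < m') : μ < μ' := by
  rcases h with h | ⟨a, α, haα, ha, hfree, hs, hs'⟩ <;>
    rcases h' with h' | ⟨b, β, hbβ, hb, hfb, hbs, hbs'⟩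
  · exact (H.matching.lt_iff h h').1 hlt
  · exact H.lt_start_of_lt h hbβ hb hfb hbs hbs' hlt
  · exact H.start_lt_of_lt h' haα ha hfree hs hs' hlt
  · exact (H.matching.start_lt_iff H.fst H.snd haα hbβ ha hb hfree hfb hs hbs hs' hbs').1 hlt

theorem levelMatch_unique (H : Matched ch A B T) (h : LevelMatch F K A T m μ)
    (h' : LevelMatch F K A T m μ') : μ = μ' := by
  by_contra hne
  rcases Ne.lt_or_gt hne with hlt | hlt
  · exact (H.symm.levelMatch_lt (H.levelMatch_symm h) (H.levelMatch_symm h') hlt).false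
  · exact (H.symm.levelMatch_lt (H.levelMatch_symm h') (H.levelMatch_symm h) hlt).false

end Levels

section HullMatching

variable {F : Set (FinStr L)} {K : Str L ℕ} {ch : Choices F K} {A B : Set ℕ} {T : ℕ → ℕ → Prop}
  {m μ x y x' y' : ℕ}

theorem hullMatch_symm (H : Matched ch A B T) (h : HullMatch F K A B T x y) :
    HullMatch F K B A (fun y x => T x y) y x := by
  obtain ⟨m, μ, hm, hx, hy, hc⟩ := h
  exact ⟨μ, m, H.levelMatch_symm hm, hy, hx, hc.symm⟩

theorem hullMatch_lt (H : Matched ch A B T) (h : HullMatch F K A B T x y)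
    (h' : HullMatch F K A B T x' y') (hlt : x < x') : y < y' := by
  obtain ⟨m, μ, hm, hx, hy, hc⟩ := h
  obtain ⟨m', μ', hm', hx', hy', hc'⟩ := h'
  rcases lt_trichotomy m m' with hmm | rfl | hmm
  · have hμ := H.levelMatch_lt hm hm' hmm
    by_contra! hle
    exact hμ.ne (H.snd.eq_of_mem_block H.irreducible hy'
      (H.symm.mem_critPlus (H.levelMatch_symm hm)) (hle.trans (le_of_mem_block hy)) hμ.le)
  · obtain rfl := H.levelMatch_unique hm hm'
    classical
    have hcount : Nat.count (· ∈ block F K A m) x < Nat.count (· ∈ block F K A m) x' :=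
      Nat.count_strict_mono hx hlt
    rw [hc, hc'] at hcount
    exact Nat.lt_of_count_lt_count hcount
  · exact absurd (H.fst.eq_of_mem_block H.irreducible hx (H.mem_critPlus hm')
      (hlt.le.trans (le_of_mem_block hx')) hmm.le) hmm.ne

theorem hullMatch_lt_iff (H : Matched ch A B T) (h : HullMatch F K A B T x y)
    (h' : HullMatch F K A B T x' y') : x < x' ↔ y < y' :=
  ⟨H.hullMatch_lt h h', H.symm.hullMatch_lt (H.hullMatch_symm h) (H.hullMatch_symm h')⟩

theorem hullMatch_unique (H : Matched ch A B T) (h : HullMatch F K A B T x y)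
    (h' : HullMatch F K A B T x y') : y = y' :=
  le_antisymm (not_lt.1 fun hlt => ((H.hullMatch_lt_iff h' h).2 hlt).false)
    (not_lt.1 fun hlt => ((H.hullMatch_lt_iff h h').2 hlt).false)

theorem hullMatch_of_notMem_AC (H : Matched ch A B T) (h : LevelMatch F K A T m μ)
    (hm : m ∉ AC F K A) : HullMatch F K A B T m μ := by
  classical
  have hμ := H.notMem_AC h hm
  exact ⟨m, μ, h, by rw [block_of_notMem_AC hm]; rfl, by rw [block_of_notMem_AC hμ]; rfl,
    (count_block_self hm).trans (count_block_self hμ).symm⟩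

theorem hullMatch_of_mem_AC (H : Matched ch A B T) {n : ℕ} (h : T m μ) (hm : m ∈ AC F K A)
    {φ φ' : Fin n → ℕ} (hφ : StrictMono φ) (hφ' : StrictMono φ') (hr : Set.range φ = nbhd K m)
    (hr' : Set.range φ' = nbhd K μ) (z : Fin n) : HullMatch F K A B T (φ z) (φ' z) := by
  classical
  have hr := hr.trans (block_of_mem_AC hm).symm
  have hr' := hr'.trans (block_of_mem_AC (H.rel_and_mem_AC (.inl h) hm).2).symm
  exact ⟨m, μ, .inl h, hr.subset ⟨z, rfl⟩, hr'.subset ⟨z, rfl⟩,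
    (count_of_range_eq hφ hr z).trans (count_of_range_eq hφ' hr' z).symm⟩

theorem exists_isEmb (H : Matched ch A B T) (h : T m μ) (hm : m ∈ AC F K A) :
    ∃ (n : ℕ) (I : Str L (Fin n)) (φ φ' : Fin n → ℕ),
      Set.range φ = nbhd K m ∧ Set.range φ' = nbhd K μ ∧ IsEmb φ I K ∧ IsEmb φ' I K ∧
      (∀ z, HullMatch F K A B T (φ z) (φ' z)) ∧
      ∀ a ∈ A, ∀ α, T a α → m < a → ∀ z, K.R a (φ z) = K.R α (φ' z) := by
  obtain ⟨n, I, φ, φ', hφ, hφ', hr, hr', he, he', hR⟩ :=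
    H.matching.exists_nbhd H.irreducible H.forb H.fst H.snd h hm
  exact ⟨n, I, φ, φ', hr, hr', he, he', H.hullMatch_of_mem_AC h hm hφ hφ' hr hr', hR⟩

theorem exists_hullMatch_of_mem_nbhd (H : Matched ch A B T) (hm : m ∈ AC F K A)
    (hx : x ∈ nbhd K m) : ∃ y ∈ cl F K B, HullMatch F K A B T x y := by
  obtain ⟨μ, h⟩ := H.matching.exists_right m (ac_subset_crit hm)
  obtain ⟨n, I, φ, φ', hr, hr', -, -, hφφ', -⟩ := H.exists_isEmb h hm
  obtain ⟨z, rfl⟩ := hr.superset hx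
  exact ⟨φ' z, H.snd.nbhd_subset_cl H.irreducible (H.rel_and_mem_AC (.inl h) hm).2
    (hr'.subset ⟨z, rfl⟩), hφφ' z⟩

theorem exists_hullMatch_of_mem_crit (H : Matched ch A B T) (hx : x ∈ Crit F K A) :
    ∃ y ∈ cl F K B, HullMatch F K A B T x y := by
  by_cases hAC : x ∈ AC F K A
  · exact H.exists_hullMatch_of_mem_nbhd hAC (.inl rfl)
  · obtain ⟨y, h⟩ := H.matching.exists_right x hx
    exact ⟨y, crit_subset_cl (H.matching.right h), H.hullMatch_of_notMem_AC (.inl h) hAC⟩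

theorem exists_hullMatch_of_notMem_freeStart (H : Matched ch A B T) (hx : x ∈ hull F K A)
    (hfs : x ∉ FreeStart F K A) : ∃ y ∈ cl F K B, HullMatch F K A B T x y := by
  rcases hx with hx | hx | hx | ⟨m, hm, hx⟩
  · exact H.exists_hullMatch_of_mem_crit (subset_crit hx)
  · exact H.exists_hullMatch_of_mem_crit (sp_subset_crit hx)
  · exact absurd hx hfs
  · exact H.exists_hullMatch_of_mem_nbhd hm hx

theorem exists_hullMatch (H : Matched ch A B T) (hx : x ∈ hull F K A) :
    ∃ y, HullMatch F K A B T x y := by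
  by_cases hfs : x ∈ FreeStart F K A
  · have hAC := H.fst.notMem_AC_of_mem_freeStart H.irreducible H.forb hfs
    obtain ⟨a, ha, hfree, hs⟩ := hfs
    obtain ⟨α, hα, haα⟩ := H.matching.exists_right_of_mem ha
    obtain ⟨y, hy⟩ := H.snd.weak.exists_start α hα
    exact ⟨y, H.hullMatch_of_notMem_AC (.inr ⟨a, α, haα, ha, hfree, hs, hy⟩) hAC⟩
  · obtain ⟨y, -, h⟩ := H.exists_hullMatch_of_notMem_freeStart hx hfs
    exact ⟨y, h⟩

theorem mem_nbhd_or_levelMatch (H : Matched ch A B T) (h : HullMatch F K A B T x y) :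
    (∃ m μ, m ∈ AC F K A ∧ T m μ ∧ x ∈ nbhd K m) ∨ LevelMatch F K A T x y := by
  obtain ⟨m, μ, hm, hx, hy, -⟩ := h
  by_cases hAC : m ∈ AC F K A
  · exact .inl ⟨m, μ, hAC, (H.rel_and_mem_AC hm hAC).1, block_of_mem_AC hAC ▸ hx⟩
  · rw [block_of_notMem_AC hAC, Set.mem_singleton_iff] at hx
    rw [block_of_notMem_AC (H.notMem_AC hm hAC), Set.mem_singleton_iff] at hy
    exact .inr (hx ▸ hy ▸ hm)

theorem mem_hull (H : Matched ch A B T) (h : HullMatch F K A B T x y) : x ∈ hull F K A := by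
  rcases H.mem_nbhd_or_levelMatch h with ⟨m, -, hm, -, hx⟩ | h | ⟨a, -, -, ha, hfree, hs, -⟩
  · exact nbhd_subset_hull hm hx
  · exact crit_subset_hull (H.matching.left h)
  · exact .inr (.inr (.inl ⟨a, ha, hfree, hs⟩))

theorem rel_of_mem (H : Matched ch A B T) (h : HullMatch F K A B T x y) (hx : x ∈ A) :
    T x y := by
  rcases H.mem_nbhd_or_levelMatch h with ⟨m, -, hm, -, hxm⟩ | h | ⟨a, -, -, ha, hfree, hs, -⟩
  · obtain rfl := H.fst.eq_of_mem_critPlus H.irreducible hm hxm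
      (crit_subset_critPlus (subset_crit hx)) le_rfl (le_of_mem_nbhd hxm)
    exact absurd hx (notMem_of_mem_AC hm)
  · exact h
  · exact absurd hx (H.fst.notMem_of_mem_freeStart ⟨a, ha, hfree, hs⟩)

end HullMatching

section HullRelations

variable {F : Set (FinStr L)} {K : Str L ℕ} {ch : Choices F K} {A B : Set ℕ} {T : ℕ → ℕ → Prop}
  {a α c γ x y x' y' : ℕ}

theorem similar (H : Matched ch A B T) (h : T x y) : Similar K A T x y :=
  H.matching.similar H.irreducible H.forb H.fst H.snd h

theorem hullMatch_U (H : Matched ch A B T) (h : HullMatch F K A B T x y) : K.U x = K.U y := by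
  rcases H.mem_nbhd_or_levelMatch h with ⟨m, μ, hm, hmμ, hx⟩ | h | ⟨a, α, haα, ha, hfree, hs, hs'⟩
  · obtain ⟨n, I, φ, φ', hr, -, he, he', hφφ', -⟩ := H.exists_isEmb hmμ hm
    obtain ⟨z, rfl⟩ := hr.superset hx
    rw [H.hullMatch_unique h (hφφ' z), he.2.1, he'.2.1]
  · exact (H.similar h).1
  · have hU := H.U_eq haα ha
    rw [H.fst.U_free_start ha hfree hs,
      H.snd.U_free_start ((H.matching.mem_iff haα).1 ha) (hU ▸ hfree) hs', hU]

theorem R_eq_of_free_start (H : Matched ch A B T) (haα : T a α) (ha : a ∈ A) (hcγ : T c γ)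
    (hc : c ∈ A) (hfree : HasFree F K (K.U c)) (hx : IsStart K c x) (hy : IsStart K γ y)
    (hxa : x < a) (hR : K.R a x ≠ 0) : K.R a x = K.R α y := by
  have hα := (H.matching.mem_iff haα).1 ha
  have hγ := (H.matching.mem_iff hcγ).1 hc
  have hUc := H.U_eq hcγ hc
  have hpath := H.fst.path_eq_of_free_start hc hfree hx ha hxa hR
  have hpath' : path F K γ = path F K α := by
    rw [← H.matching.path_eq H.fst.weak H.snd.weak hcγ hc,
      ← H.matching.path_eq H.fst.weak H.snd.weak haα ha, hpath]
  have hxs := H.fst.isStart_of_path_eq hc ha hfree hx hpath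
  have hys := H.snd.isStart_of_path_eq hγ hα (hUc ▸ hfree) hy hpath'
  have hUca : K.U c = K.U a := congrArg Prod.fst hpath
  have hU := H.U_eq haα ha
  rw [H.fst.R_free_start ha (hUca ▸ hfree) hxs,
    H.snd.R_free_start hα (hU ▸ hUca ▸ hfree) hys, hU]

theorem R_eq_of_mem (H : Matched ch A B T) (h : HullMatch F K A B T x y)
    (h' : HullMatch F K A B T x' y') (hx : x ∈ A) (hlt : x' < x) (hR : K.R x x' ≠ 0) :
    K.R x x' = K.R y y' := by
  have hxy := H.rel_of_mem h hx
  rcases H.mem_nbhd_or_levelMatch h' with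
    ⟨m, μ, hm, hmμ, hx'⟩ | h' | ⟨c, γ, hcγ, hc, hfree, hs, hs'⟩
  · have hmx : m < x := by
      by_contra! hle
      obtain rfl := H.fst.eq_of_mem_critPlus H.irreducible hm hx'
        (crit_subset_critPlus (subset_crit hx)) hlt.le hle
      exact notMem_of_mem_AC hm hx
    obtain ⟨n, I, φ, φ', hr, -, -, -, hφφ', hatt⟩ := H.exists_isEmb hmμ hm
    obtain ⟨z, rfl⟩ := hr.superset hx'
    rw [H.hullMatch_unique h' (hφφ' z)]
    exact hatt x hx y hxy hmx z
  · exact (H.similar h').2 x hx y hxy hlt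
  · exact H.R_eq_of_free_start hxy hx hcγ hc hfree hs hs' hlt hR

theorem R_eq_of_notMem (H : Matched ch A B T) (h : HullMatch F K A B T x y)
    (h' : HullMatch F K A B T x' y') (hx : x ∉ A) (hlt : x' < x) (hR : K.R x x' ≠ 0) :
    K.R x x' = K.R y y' := by
  obtain ⟨m, hm, hxm, hx'm⟩ := H.fst.exists_nbhd_of_ne_zero H.irreducible (H.mem_hull h) hx hlt hR
  obtain ⟨μ, hmμ⟩ := H.matching.exists_right m (ac_subset_crit hm)
  obtain ⟨n, I, φ, φ', hr, -, he, he', hφφ', -⟩ := H.exists_isEmb hmμ hm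
  obtain ⟨z, rfl⟩ := hr.superset hxm
  obtain ⟨z', rfl⟩ := hr.superset hx'm
  rw [H.hullMatch_unique h (hφφ' z), H.hullMatch_unique h' (hφφ' z'), he.2.2, he'.2.2]

theorem R_eq_of_ne_zero (H : Matched ch A B T) (h : HullMatch F K A B T x y)
    (h' : HullMatch F K A B T x' y') (hlt : x' < x) (hR : K.R x x' ≠ 0) :
    K.R x x' = K.R y y' := by
  by_cases hx : x ∈ A
  · exact H.R_eq_of_mem h h' hx hlt hR
  · exact H.R_eq_of_notMem h h' hx hlt hR

theorem R_eq_of_lt (H : Matched ch A B T) (h : HullMatch F K A B T x y)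
    (h' : HullMatch F K A B T x' y') (hlt : x' < x) : K.R x x' = K.R y y' := by
  by_cases hR : K.R x x' = 0
  · by_contra hne
    exact hne (H.symm.R_eq_of_ne_zero (H.hullMatch_symm h) (H.hullMatch_symm h')
      (H.hullMatch_lt h' h hlt) fun hR' => hne (hR.trans hR'.symm)).symm
  · exact H.R_eq_of_ne_zero h h' hlt hR

theorem hullMatch_R (H : Matched ch A B T) (h : HullMatch F K A B T x y)
    (h' : HullMatch F K A B T x' y') : K.R x x' = K.R y y' := by
  rcases lt_trichotomy x x' with hlt | rfl | hlt
  · rw [K.R_flip x', K.R_flip y', H.R_eq_of_lt h' h hlt]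
  · rw [H.hullMatch_unique h h', K.R_self, K.R_self]
  · exact H.R_eq_of_lt h h' hlt

end HullRelations

section Closures

variable {F : Set (FinStr L)} {K : Str L ℕ} {ch : Choices F K} {A B : Set ℕ} {T : ℕ → ℕ → Prop}
  {m x : ℕ}

theorem clPreimage_subset_hull (H : Matched ch A B T) : clPreimage F K A B T ⊆ hull F K A := by
  rintro x ⟨y, -, h⟩
  exact H.mem_hull h

theorem sp_clPreimage_subset (H : Matched ch A B T) :
    Sp K (clPreimage F K A B T) ⊆ clPreimage F K A B T := by
  intro m hm
  have hmh := (closed_iff.1 (H.fst.closed_hull H.irreducible H.forb)).1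
    (sp_mono H.clPreimage_subset_hull hm)
  obtain ⟨μ, hmμ⟩ := H.exists_hullMatch hmh
  obtain ⟨a, ⟨α, hα, haα⟩, b, ⟨β, hβ, hbβ⟩, hab⟩ := mem_sp.1 hm
  have hagree := (cut_eq_cut_iff hab.lt_left.le hab.lt_right.le).1 hab.cut_eq
  have hU : K.U α = K.U β := by rw [← H.hullMatch_U haα, ← H.hullMatch_U hbβ, hagree.1]
  have hne : K.R α μ ≠ K.R β μ := by
    rw [← H.hullMatch_R haα hmμ, ← H.hullMatch_R hbβ hmμ]
    exact hab.ne
  obtain ⟨ν, hνμ, hαβ⟩ := exists_splitAt_le hU (H.hullMatch_lt hmμ haα hab.lt_left)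
    (H.hullMatch_lt hmμ hbβ hab.lt_right) hne
  have hν : ν ∈ cl F K B := (closed_iff.1 (closed_cl F K B)).1 (mem_sp.2 ⟨α, hα, β, hβ, hαβ⟩)
  rcases hνμ.eq_or_lt with rfl | hlt
  · exact ⟨ν, hν, hmμ⟩
  · obtain ⟨n, hνn⟩ := H.symm.exists_hullMatch (H.snd.cl_subset_hull H.irreducible H.forb hν)
    have hnν := H.symm.hullMatch_symm hνn
    have hR := hagree.2 n ((H.hullMatch_lt_iff hnν hmμ).2 hlt)
    rw [H.hullMatch_R haα hnν, H.hullMatch_R hbβ hnν] at hR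
    exact absurd hR hαβ.ne

theorem stable_clPreimage (H : Matched ch A B T) (hm : m ∉ clPreimage F K A B T) :
    Stable F K (clPreimage F K A B T) m := by
  by_cases hfs : m ∈ FreeStart F K A
  · refine (H.fst.stable_of_mem_freeStart H.irreducible H.forb hfs).of_forall_ne_zero H.irreducible
      fun x hx hmx hR => ?_
    by_contra hxA
    obtain ⟨a, ha, -, hs⟩ := hfs
    exact hR (H.fst.R_eq_zero_of_mem_critPlus H.irreducible (H.clPreimage_subset_hull hx) hxA hmx
      (hs.mem_critPlus ha))
  · have hmh : m ∉ hull F K A := fun h => hm (H.exists_hullMatch_of_notMem_freeStart h hfs)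
    exact ((closed_iff.1 (H.fst.closed_hull H.irreducible H.forb)).2 m hmh).mono
      H.clPreimage_subset_hull

theorem exists_mem_cl (H : Matched ch A B T) (hx : x ∈ cl F K A) :
    ∃ y ∈ cl F K B, HullMatch F K A B T x y :=
  cl_subset (C := clPreimage F K A B T)
    (fun _ ha => H.exists_hullMatch_of_mem_crit (subset_crit ha))
    (closed_iff.2 ⟨H.sp_clPreimage_subset, fun _ => H.stable_clPreimage⟩) hx

end Closures

end Matched

/-! ### Enumerations -/

section Enumerations

variable {X Y : Set ℕ} {Θ : ℕ → ℕ → Prop} {m n x y : ℕ}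

theorem forall_finite_lt_card_iff :
    (∀ hf : X.Finite, n < hf.toFinset.card) ↔ (n : ℕ∞) < X.encard := by
  by_cases hf : X.Finite
  · simp only [hf, forall_true_left, hf.encard_eq_coe_toFinset_card, Nat.cast_lt]
  · simp [hf, Set.Infinite.encard_eq hf]

theorem nth_mem_set (h : (n : ℕ∞) < X.encard) : Nat.nth (· ∈ X) n ∈ X :=
  Nat.nth_mem n (forall_finite_lt_card_iff.2 h)

theorem nth_lt_nth_iff (hm : (m : ℕ∞) < X.encard) (hn : (n : ℕ∞) < X.encard) :
    Nat.nth (· ∈ X) m < Nat.nth (· ∈ X) n ↔ m < n := by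
  have hmono : StrictMonoOn (Nat.nth (· ∈ X)) {n : ℕ | (n : ℕ∞) < X.encard} :=
    fun _ _ _ hn h => Nat.nth_lt_nth' h (forall_finite_lt_card_iff.2 hn)
  exact hmono.lt_iff_lt hm hn

theorem exists_nth_eq (hx : x ∈ X) : ∃ n : ℕ, (n : ℕ∞) < X.encard ∧ Nat.nth (· ∈ X) n = x := by
  obtain ⟨n, hn, h⟩ := Nat.exists_lt_card_nth_eq (p := (· ∈ X)) hx
  exact ⟨n, forall_finite_lt_card_iff.1 hn, h⟩

/-- `Θ` is the graph of a strictly increasing partial map, possibly defined outside `X`, which maps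
`X` onto `Y`. -/
structure IncreasingBij (X Y : Set ℕ) (Θ : ℕ → ℕ → Prop) : Prop where
  exists_right : ∀ x ∈ X, ∃ y ∈ Y, Θ x y
  exists_left : ∀ y ∈ Y, ∃ x ∈ X, Θ x y
  lt_iff : ∀ {x y x' y'}, Θ x y → Θ x' y' → (x < x' ↔ y < y')

namespace IncreasingBij

theorem symm (h : IncreasingBij X Y Θ) : IncreasingBij Y X fun y x => Θ x y where
  exists_right := h.exists_left
  exists_left := h.exists_right
  lt_iff h₁ h₂ := (h.lt_iff h₁ h₂).symm

theorem left_unique (h : IncreasingBij X Y Θ) {x' : ℕ} (hx : Θ x y) (hx' : Θ x' y) : x = x' :=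
  le_antisymm (not_lt.1 fun hlt => lt_irrefl y ((h.lt_iff hx' hx).1 hlt))
    (not_lt.1 fun hlt => lt_irrefl y ((h.lt_iff hx hx').1 hlt))

theorem encard_le (h : IncreasingBij X Y Θ) : X.encard ≤ Y.encard := by
  choose! f hf hΘ using h.exists_right
  exact Set.encard_le_encard_of_injOn (f := f) hf fun x hx x' hx' hxx' =>
    h.left_unique (hΘ x hx) (hxx' ▸ hΘ x' hx')

theorem encard_eq (h : IncreasingBij X Y Θ) : X.encard = Y.encard :=
  h.encard_le.antisymm h.symm.encard_le

theorem count_le [DecidablePred (· ∈ X)] [DecidablePred (· ∈ Y)]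
    (h : IncreasingBij X Y Θ) (hxy : Θ x y) : Nat.count (· ∈ X) x ≤ Nat.count (· ∈ Y) y := by
  rw [Nat.count_eq_card_filter_range, Nat.count_eq_card_filter_range]
  refine Finset.card_le_card_of_forall_subsingleton Θ (fun x' hx' => ?_)
    fun y' _ x₁ h₁ x₂ h₂ => h.left_unique h₁.2 h₂.2
  obtain ⟨hlt, hx'X⟩ := Finset.mem_filter.1 hx'
  obtain ⟨y', hy', hΘ⟩ := h.exists_right x' hx'X
  exact ⟨y', Finset.mem_filter.2
    ⟨Finset.mem_range.2 ((h.lt_iff hΘ hxy).1 (Finset.mem_range.1 hlt)), hy'⟩, hΘ⟩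

theorem count_eq [DecidablePred (· ∈ X)] [DecidablePred (· ∈ Y)]
    (h : IncreasingBij X Y Θ) (hxy : Θ x y) : Nat.count (· ∈ X) x = Nat.count (· ∈ Y) y :=
  (h.count_le hxy).antisymm (h.symm.count_le hxy)

theorem nth_rel_nth (h : IncreasingBij X Y Θ) (hn : (n : ℕ∞) < X.encard) :
    Θ (Nat.nth (· ∈ X) n) (Nat.nth (· ∈ Y) n) := by
  classical
  obtain ⟨y, hy, hΘ⟩ := h.exists_right _ (nth_mem_set hn)
  have hcount := h.count_eq hΘ
  rw [Nat.count_nth (p := (· ∈ X)) (forall_finite_lt_card_iff.2 hn)] at hcount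
  rwa [hcount, Nat.nth_count (p := (· ∈ Y)) hy, ← hcount]

end IncreasingBij

theorem sigma_below_eq {α : Type} {N N' : ℕ∞} {f : Below N → α} {g : Below N' → α}
    (h : (⟨N, f⟩ : Σ N : ℕ∞, (Below N → α)) = ⟨N', g⟩) :
    N = N' ∧ ∀ (n : ℕ) (hn : (n : ℕ∞) < N) (hn' : (n : ℕ∞) < N'), f ⟨n, hn⟩ = g ⟨n, hn'⟩ := by
  cases h
  exact ⟨rfl, fun _ _ _ => rfl⟩

theorem sigma_pullback_eq {K : Str L ℕ} {N N' : ℕ∞} {f g : ℕ → ℕ} (hN : N = N')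
    (hU : ∀ n : ℕ, (n : ℕ∞) < N → K.U (f n) = K.U (g n))
    (hR : ∀ m n : ℕ, (m : ℕ∞) < N → (n : ℕ∞) < N → K.R (f m) (f n) = K.R (g m) (g n)) :
    (⟨N, K.pullback fun n : Below N => f n.1⟩ : EnumStr L) =
      ⟨N', K.pullback fun n : Below N' => g n.1⟩ := by
  subst hN
  congr 1
  ext m n
  · exact congrArg _ (hU m.1 m.2)
  · exact congrArg _ (hR m.1 n.1 m.2 n.2)

end Enumerations

section Envelopes

variable {F : Set (FinStr L)} {K : Str L ℕ} {A B : Set ℕ}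

theorem envelope_eq_of_increasingBij {Θ : ℕ → ℕ → Prop}
    (h : IncreasingBij (cl F K A) (cl F K B) Θ) (hU : ∀ {x y}, Θ x y → K.U x = K.U y)
    (hR : ∀ {x y x' y'}, Θ x y → Θ x' y' → K.R x x' = K.R y y') :
    envelope F K A = envelope F K B :=
  sigma_pullback_eq h.encard_eq (fun _ hn => hU (h.nth_rel_nth hn))
    fun _ _ hm hn => hR (h.nth_rel_nth hm) (h.nth_rel_nth hn)

theorem exists_matching_of_diary_eq (h : diary F K A = diary F K B) :
    ∃ T, Matching F K A B T := by
  obtain ⟨hcard, hentry⟩ := sigma_below_eq h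
  exact ⟨fun x y => ∃ n : ℕ, (n : ℕ∞) < (Crit F K A).encard ∧ x = Nat.nth (· ∈ Crit F K A) n ∧
    y = Nat.nth (· ∈ Crit F K B) n,
  { left := by
      rintro _ _ ⟨n, hn, rfl, rfl⟩
      exact nth_mem_set hn
    right := by
      rintro _ _ ⟨n, hn, rfl, rfl⟩
      exact nth_mem_set (hcard ▸ hn)
    exists_right := fun x hx => by
      obtain ⟨n, hn, rfl⟩ := exists_nth_eq hx
      exact ⟨_, n, hn, rfl, rfl⟩
    exists_left := fun y hy => by
      obtain ⟨n, hn, rfl⟩ := exists_nth_eq hy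
      exact ⟨_, n, hcard ▸ hn, rfl, rfl⟩
    lt_iff := by
      rintro _ _ _ _ ⟨n, hn, rfl, rfl⟩ ⟨n', hn', rfl, rfl⟩
      rw [nth_lt_nth_iff hn hn', nth_lt_nth_iff (hcard ▸ hn) (hcard ▸ hn')]
    entry_eq := by
      rintro _ _ ⟨n, hn, rfl, rfl⟩
      exact hentry n hn (hcard ▸ hn) }⟩

theorem Matched.increasingBij {ch : Choices F K} {T : ℕ → ℕ → Prop} (H : Matched ch A B T) :
    IncreasingBij (cl F K A) (cl F K B) (HullMatch F K A B T) where
  exists_right _ hx := H.exists_mem_cl hx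
  exists_left y hy := by
    obtain ⟨x, hx, hyx⟩ := H.symm.exists_mem_cl hy
    exact ⟨x, hx, H.symm.hullMatch_symm hyx⟩
  lt_iff := H.hullMatch_lt_iff

theorem Diagonal.envelope_eq {ch : Choices F K} (hF : ∀ M ∈ F, Irreducible M.2) (hK : Forb F K)
    (hA : Diagonal ch A) (hB : Diagonal ch B) (h : diary F K A = diary F K B) :
    envelope F K A = envelope F K B := by
  obtain ⟨T, hM⟩ := exists_matching_of_diary_eq h
  have H : Matched ch A B T := ⟨hF, hK, hA, hB, hM⟩
  exact envelope_eq_of_increasingBij H.increasingBij H.hullMatch_U H.hullMatch_R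

end Envelopes

end DiaryEnvelope

end

theorem mainTheorem7_general (L : DiaryEnvelope.Lang) (F : Set (DiaryEnvelope.FinStr L))
    (hF : ∀ M ∈ F, DiaryEnvelope.Irreducible M.2) (K : DiaryEnvelope.Str L ℕ)
    (hK : DiaryEnvelope.Forb F K) (ch : DiaryEnvelope.Choices F K) :
    (∀ A B : Set ℕ, DiaryEnvelope.Diagonal ch A → DiaryEnvelope.Diagonal ch B →
      DiaryEnvelope.diary F K A = DiaryEnvelope.diary F K B →
      DiaryEnvelope.envelope F K A = DiaryEnvelope.envelope F K B) ∧
    (∀ A : Set ℕ, DiaryEnvelope.Diagonal ch A →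
      DiaryEnvelope.IsInteriorOf F K (DiaryEnvelope.cl F K A) A) :=
  ⟨fun _ _ hA hB h => hA.envelope_eq hF hK hB h, fun _ hA => hA.isInteriorOf hF hK⟩

theorem mainTheorem7 (L : DiaryEnvelope.Lang) (F : Set (DiaryEnvelope.FinStr L))
    (hF : DiaryEnvelope.Admissible F) (hnd : ∀ i, DiaryEnvelope.NonDegenerate F i)
    (K : DiaryEnvelope.Str L ℕ) (hK : DiaryEnvelope.IsFraisseLimit F K)
    (hKl : DiaryEnvelope.LeftDense F K) (ch : DiaryEnvelope.Choices F K) :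
    (∀ A B : Set ℕ, DiaryEnvelope.Diagonal ch A → DiaryEnvelope.Diagonal ch B →
      DiaryEnvelope.diary F K A = DiaryEnvelope.diary F K B →
      DiaryEnvelope.envelope F K A = DiaryEnvelope.envelope F K B) ∧
    (∀ A : Set ℕ, DiaryEnvelope.Diagonal ch A →
      DiaryEnvelope.IsInteriorOf F K (DiaryEnvelope.cl F K A) A) :=
  mainTheorem7_general L F hF.irreducible K hK.forb ch
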